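/- **Conventions.** For $C\subseteq\mathbb R^n$ and $\varepsilon\ge 0$ let $B(C,\varepsilon)=\{x:\exists y\in C,\ \|x-y\|_2\le\varepsilon\}$ and $B(C,-\varepsilon)=\{x: B(x,\varepsilon)\subseteq C\}$, where $B(x,\varepsilon)$ is the closed Euclidean ball. *Vectors.* Oracle inputs and outputs are binary fixed-point vectors. A fixed-point format consists of a number of bits $b$ and a step $\tau>0$; its coordinates take the values $\tau(j-2^{b-1})$, $0\le j<2^b$. A unit vector $g$ is represented by a nonzero fixed-point vector $v$ with $g=v/\|v\|$. For a constant $D>0$ and a precision $\varepsilon>0$, a format is called *$(D,\varepsilon)$-adequate* (for given $n,r,R$) if $2^b\tau\ge 2R$ and $\tau\le r\varepsilon/(DnR)$, i.e. it covers $[-R,R]$ up to one step and has at least $\log_2\!\big(D\,nR/(r\varepsilon)\big)$ bits after the binary point. *Quantum oracles.* A relational quantum oracle for $\mathcal F:X\to\mathcal P(Y)$ with success probability at least $1-\rho$ is a unitary $U$ on three finite-dimensional registers with $U|x,0,0\rangle=\sum_{y\in Y}\alpha_{x,y}|x,y,\psi_{x,y}\rangle$ for all $x\in X$, where the $\psi_{x,y}$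 are normalized states and $\sum_{y\in\mathcal F(x)}|\alpha_{x,y}|^2\ge 1-\rho$. - $\mathrm{MEM}_{\varepsilon,\rho}(K)$ is such an oracle which, on a query vector $y$, with success probability at least $1-\rho$ correctly asserts $y\in B(K,\varepsilon)$ or correctly asserts $y\notin B(K,-\varepsilon)$. - $\mathrm{SEP}_{\varepsilon,\rho}(K)$ is such an oracle which, on a query vector $y$, with success probability at least $1-\rho$ correctly asserts $y\in B(K,\varepsilon)$, or correctly asserts $y\notin B(K,-\varepsilon)$ and in that case also returns a unit vector $g$ such that $\langle g,x\rangle\le\langle g,y\rangle+\varepsilon$ for all $x\in B(K,-\varepsilon)$. A quantum query algorithm is a sequence of fixed unitaries and of applications of a black-box unitary $U$ or of $U^{-1}$ to some of its registers; every application of $U$ or $U^{-1}$ counts as one query. **Theorem.** There are universal constants $C,D>0$ such that the following holds. Let $n\ge 1$, $0<r\le R$, $\eta\in(0,R]$, $\rho\in(0,1/3]$, let $$\varepsilon_0=\eta\,(58n)^{-9/2}\Big(\frac rR\Big)^{3}\Big(\frac{\eta}{R}\Big)^{2}\rho ,\qquad 0\le\varepsilon\le\varepsilon_0 ,$$ and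 fix a $(D,\varepsilon_0)$-adequate format for the membership oracle, a $(D,\eta)$-adequate format for the separation oracle, and the dimension of the workspace register of the membership oracle. Then there is a quantum query algorithm that makes at most $$C\,\log\Big(\frac n\rho\Big)\,\log\Big(\frac n\rho\cdot\frac R\eta\cdot\frac Rr\Big)$$ queries to its black box and its inverse and such that, for every convex set $K\subseteq\mathbb R^n$ with $B(0,r)\subseteq K\subseteq B(0,R)$ and every quantum oracle $\mathrm{MEM}_{\varepsilon,0}(K)$ used as the black box, the unitary performed by the algorithm is a quantum oracle $\mathrm{SEP}_{\eta,\rho}(K)$. -/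

import Mathlib

set_option synthInstance.maxSize 1024

/-! ### Parallel sets -/

/-- `B(C, ε)`: the points at Euclidean distance at most `ε` from some point of `C`. -/
def outerParallel {n : ℕ} (C : Set (EuclideanSpace ℝ (Fin n))) (ε : ℝ) :
    Set (EuclideanSpace ℝ (Fin n)) :=
  {x | ∃ y ∈ C, ‖x - y‖ ≤ ε}

/-- `B(C, -ε)`: the points `x` whose closed Euclidean ball `B(x, ε)` is contained in `C`. -/
def innerParallel {n : ℕ} (C : Set (EuclideanSpace ℝ (Fin n))) (ε : ℝ) :
    Set (EuclideanSpace ℝ (Fin n)) :=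
  {x | Metric.closedBall x ε ⊆ C}

/-! ### Binary fixed-point vectors -/

/-- A fixed-point number format: `bits` bits, the least significant of which has weight `step`.
The integer `j ∈ {0, …, 2 ^ bits - 1}` represents the real number `step * (j - 2 ^ bits / 2)`. -/
structure FixedPointFormat where
  bits : ℕ
  step : ℝ
  step_pos : 0 < step

namespace FixedPointFormat

/-- The bit patterns of `n`-dimensional fixed-point vectors (the classical basis states of a vector
register). -/
abbrev Vec (F : FixedPointFormat) (n : ℕ) : Type := Fin n → Fin (2 ^ F.bits)

/-- The all-zeros bit pattern. -/
def zeroBits (F : FixedPointFormat) (n : ℕ) : F.Vec n :=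
  fun _ => ⟨0, Nat.two_pow_pos F.bits⟩

/-- The real vector that a bit pattern represents. -/
noncomputable def decode (F : FixedPointFormat) {n : ℕ} (v : F.Vec n) :
    EuclideanSpace ℝ (Fin n) :=
  WithLp.toLp 2 fun i => F.step * (((v i : ℕ) : ℝ) - 2 ^ F.bits / 2)

/-- The format covers the interval `[-R, R]` (up to one step), and it has at least
`log₂ (D * n * R / (r * ε))` bits of precision, that is, this many bits after the binary point. -/
def Resolves (F : FixedPointFormat) (D : ℝ) (n : ℕ) (r R ε : ℝ) : Prop :=
  2 * R ≤ 2 ^ F.bits * F.step ∧ F.step ≤ r * ε / (D * n * R)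

end FixedPointFormat

/-! ### Relational quantum oracles -/

/-- `U` is a relational quantum oracle for `𝓕`, with success probability at least `1 - ρ`. The three
registers are the query register `X`, the answer register `Y` (with initial state `|y₀⟩`) and the
workspace `W` (with initial state `|w₀⟩`). The entries of the column of `U` at `(x, y₀, w₀)` are the
coordinates of `U |x, y₀, w₀⟩`, so the second clause says
`U |x, y₀, w₀⟩ = ∑ y, α x y • |x, y, ψ x y⟩`. -/
def IsRelationalOracle {X Y W : Type} [Fintype X] [DecidableEq X] [Fintype Y] [DecidableEq Y]
    [Fintype W] [DecidableEq W] (𝓕 : X → Set Y) (ρ : ℝ) (y₀ : Y) (w₀ : W)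
    (U : Matrix.unitaryGroup (X × Y × W) ℂ) : Prop :=
  ∃ (α : X → Y → ℂ) (ψ : X → Y → EuclideanSpace ℂ W),
    (∀ x y, ‖ψ x y‖ = 1) ∧
    (∀ x x' y w, (U : Matrix (X × Y × W) (X × Y × W) ℂ) (x', y, w) (x, y₀, w₀) =
      if x' = x then α x y * ψ x y w else 0) ∧
    ∀ x, 1 - ρ ≤ ∑ y, (𝓕 x).indicator (fun y => ‖α x y‖ ^ 2) y

/-- The correct answers of a membership oracle with precision `ε` on the query `y`: the answer
`true` asserts `y ∈ B(K, ε)`, the answer `false` asserts `y ∉ B(K, -ε)`. -/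
def memAnswers {n : ℕ} (K : Set (EuclideanSpace ℝ (Fin n))) (ε : ℝ)
    (y : EuclideanSpace ℝ (Fin n)) : Set Bool :=
  {a | (a = true ∧ y ∈ outerParallel K ε) ∨ (a = false ∧ y ∉ innerParallel K ε)}

/-- The correct answers of a separation oracle with precision `ε` on the query `y`. An answer is an
assertion bit together with a fixed-point vector `v`; the unit vector that is returned is
`g = v / ‖v‖` (the demand `‖g‖ = 1` says that `v` is not the zero vector). -/
def sepAnswers {n : ℕ} (F : FixedPointFormat) (K : Set (EuclideanSpace ℝ (Fin n))) (ε : ℝ)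
    (y : EuclideanSpace ℝ (Fin n)) : Set (Bool × F.Vec n) :=
  {a | (a.1 = true ∧ y ∈ outerParallel K ε) ∨
    (a.1 = false ∧ y ∉ innerParallel K ε ∧
      ∃ g : EuclideanSpace ℝ (Fin n), g = ‖F.decode a.2‖⁻¹ • F.decode a.2 ∧ ‖g‖ = 1 ∧
        ∀ x ∈ innerParallel K ε, inner ℝ g x ≤ inner ℝ g y + ε)}

/-- `MEM_{ε,ρ}(K)` as a quantum oracle whose query vectors are in format `F`. -/
def IsMEM {n : ℕ} (F : FixedPointFormat) {W : Type} [Fintype W] [DecidableEq W] (w₀ : W)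
    (K : Set (EuclideanSpace ℝ (Fin n))) (ε ρ : ℝ)
    (U : Matrix.unitaryGroup (F.Vec n × Bool × W) ℂ) : Prop :=
  IsRelationalOracle (fun x => memAnswers K ε (F.decode x)) ρ false w₀ U

/-- `SEP_{ε,ρ}(K)` as a quantum oracle whose query and answer vectors are in format `F`. -/
def IsSEP {n : ℕ} (F : FixedPointFormat) {W : Type} [Fintype W] [DecidableEq W] (w₀ : W)
    (K : Set (EuclideanSpace ℝ (Fin n))) (ε ρ : ℝ)
    (U : Matrix.unitaryGroup (F.Vec n × (Bool × F.Vec n) × W) ℂ) : Prop :=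
  IsRelationalOracle (fun x => sepAnswers F K ε (F.decode x)) ρ (false, F.zeroBits n) w₀ U

/-! ### Quantum query algorithms -/

/-- A quantum query algorithm on a register with basis states `H`: a sequence of fixed unitary gates
and of calls to a black-box unitary and to its inverse. -/
inductive QueryAlgorithm (H : Type) [Fintype H] [DecidableEq H] : Type
  | gate (V : Matrix.unitaryGroup H ℂ) : QueryAlgorithm H
  | query : QueryAlgorithm H
  | queryInverse : QueryAlgorithm H
  | andThen (first second : QueryAlgorithm H) : QueryAlgorithm H

namespace QueryAlgorithm

/-- The total number of calls to the black box and to its inverse. -/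
def queries {H : Type} [Fintype H] [DecidableEq H] : QueryAlgorithm H → ℕ
  | gate _ => 0
  | query => 1
  | queryInverse => 1
  | andThen first second => first.queries + second.queries

/-- The unitary that the algorithm performs when the black box acts as `O` on its register. -/
def run {H : Type} [Fintype H] [DecidableEq H] (O : Matrix.unitaryGroup H ℂ) :
    QueryAlgorithm H → Matrix.unitaryGroup H ℂ
  | gate V => V
  | query => O
  | queryInverse => O⁻¹
  | andThen first second => second.run O * first.run O

end QueryAlgorithm

/-- `I ⊗ U`: the operation `U` applied to the second of two registers. -/
def onSecond (P : Type) [Fintype P] [DecidableEq P] {Q : Type} [Fintype Q] [DecidableEq Q]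
    (U : Matrix.unitaryGroup Q ℂ) : Matrix.unitaryGroup (P × Q) ℂ :=
  ⟨Matrix.kronecker (1 : Matrix P P ℂ) (U : Matrix Q Q ℂ),
    Matrix.kronecker_mem_unitary (one_mem _) U.2⟩

/-! A query `y` with `‖y‖ > R` is separated from `K` by `y` itself. Otherwise one membership query
decides whether to assert that `y` is nearly in `K`. If not, put `p = y / ‖y‖` and consider `h(d) =
reach K p d`, the height at which the ray from `d` in direction `p` leaves `K`. For `‖d‖ ≤ r / 3`,
Hahn–Banach gives a functional `G d` that supports `K` at the exit point, normalized by `⟨G d, p⟩ =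
1`, with `‖G d‖ ≤ 2R/r` (`exists_support`). Then `-G z` is a supergradient of `h` at `z`, `h` is
`2R/r`-Lipschitz on the small ball, and `G z` for any `z` close enough to `0` separates `y`, with
room for an error in the vector (`IsSlope.separates`).

Finding `G z` is quantum gradient estimation. Bisection along the ray computes `h` to accuracy `δ`
with `T` queries (`exists_bisection`, `membership_on_ray`). Computing it, applying the phase `-2πS
h`, and uncomputing, on a superposition of lattice points around `z`, creates a nearly linear phase
whose `n` frequencies are all read off by one Fourier transform. So one run costs `2T` queries
whatever the dimension. With a triangular window each frequency is found up to `O(1/M)` with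
constant probability, by Parseval and Chebyshev (`sum_normSq_fourierGate`,
`sum_bad_fourierGate_le`).

The obstacle is that `h` need not be differentiable. The base point `z` is therefore put in uniform
superposition over a grid cube much larger than the displacements. The gap between `h` and its
linearization is nonnegative, hence bounded by a second difference, and second differences telescope
over a cube up to boundary terms (`sum_second_difference_le`, `IsSlope.sum_gap_le`). Only the
average gap is controlled this way. That suffices because a phase error `B ≥ 0` costs at most `2B`
in squared norm (`normSq_exp_sub_exp_le`).

Repeating `k = O(log(n/ρ))` times at the same `z` and taking coordinatewise medians makes failure of
the estimation unlikely (`exists_repeated_estimation`); half of `ρ` pays for this and half for the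
nonlinearity. The total is `1 + 2kT` queries. Everything runs coherently on an oracle that may
answer in any superposition: all that is used of it is that every branch of nonzero amplitude
carries a correct answer (`IsRelationalOracle.mem_of_ne_zero`). -/

/-! ### Controlled unitaries and their implementation by query algorithms -/

/-- The unitary operations on a register with basis states `H`. -/
abbrev UnitaryOn (H : Type) [Fintype H] [DecidableEq H] : Type := Matrix.unitaryGroup H ℂ

section Registers

variable {P S T H H' Q : Type} [Fintype P] [DecidableEq P] [Fintype S] [DecidableEq S]
  [Fintype T] [DecidableEq T] [Fintype H] [DecidableEq H] [Fintype H'] [DecidableEq H']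
  [Fintype Q] [DecidableEq Q]

/-- The block diagonal unitary that applies `V p` when the control register is in state `p`. -/
def ctrl (V : P → UnitaryOn S) : UnitaryOn (P × S) :=
  ⟨Matrix.of fun a b => if a.1 = b.1 then V a.1 a.2 b.2 else 0, by
    rw [Matrix.mem_unitaryGroup_iff]
    ext a b
    have h := congrFun (congrFun (Matrix.mem_unitaryGroup_iff.1 (V a.1).2) a.2) b.2
    rw [Matrix.mul_apply] at h ⊢
    simp only [Matrix.star_apply, Matrix.of_apply, Fintype.sum_prod_type] at h ⊢
    rw [Finset.sum_eq_single a.1 (by intro p _ hp; simp [hp.symm]) (by simp)]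
    by_cases hab : a.1 = b.1
    · simp only [if_true, hab] at h ⊢
      rw [h]
      simp [Matrix.one_apply, Prod.ext_iff, hab]
    · have : b.1 ≠ a.1 := fun h => hab h.symm
      simp [Prod.ext_iff, hab, this]⟩

theorem ctrl_apply (V : P → UnitaryOn S) (a b : P × S) :
    ctrl V a b = if a.1 = b.1 then V a.1 a.2 b.2 else 0 := rfl

theorem ctrl_mul (V W : P → UnitaryOn S) : ctrl (fun p => V p * W p) = ctrl V * ctrl W := by
  apply Matrix.UnitaryGroup.ext
  intro a b
  simp only [Matrix.UnitaryGroup.mul_apply, ctrl_apply, Matrix.mul_apply, Fintype.sum_prod_type]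
  rw [Finset.sum_eq_single a.1 (by intro p _ hp; simp [hp.symm]) (by simp)]
  simp only [if_true]
  split_ifs <;> simp

theorem ctrl_inv (V : P → UnitaryOn S) : ctrl (fun p => (V p)⁻¹) = (ctrl V)⁻¹ := by
  apply Matrix.UnitaryGroup.ext
  intro a b
  simp only [ctrl_apply, Matrix.UnitaryGroup.inv_apply, Matrix.star_apply]
  by_cases h : a.1 = b.1
  · simp [h]
  · simp [h, Ne.symm h]

theorem onSecond_eq_ctrl (U : UnitaryOn S) : onSecond P U = ctrl fun _ => U := by
  apply Matrix.UnitaryGroup.ext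
  intro a b
  simp [onSecond, ctrl_apply, Matrix.one_apply]

theorem onSecond_mul (U V : UnitaryOn S) : onSecond P (U * V) = onSecond P U * onSecond P V := by
  simp only [onSecond_eq_ctrl, ← ctrl_mul]

theorem onSecond_inv (U : UnitaryOn S) : onSecond P U⁻¹ = (onSecond P U)⁻¹ := by
  simp only [onSecond_eq_ctrl, ← ctrl_inv]

theorem onSecond_apply (U : UnitaryOn S) (a b : P × S) :
    onSecond P U a b = if a.1 = b.1 then U a.2 b.2 else 0 := by
  rw [onSecond_eq_ctrl, ctrl_apply]

/-- The same operation on a register whose basis states are renamed by a bijection. -/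
def renameGate (e : H ≃ H') (U : UnitaryOn H) : UnitaryOn H' :=
  ⟨Matrix.of fun a b => U (e.symm a) (e.symm b), by
    rw [Matrix.mem_unitaryGroup_iff]
    ext a b
    have h := congrFun (congrFun (Matrix.mem_unitaryGroup_iff.1 U.2) (e.symm a)) (e.symm b)
    rw [Matrix.mul_apply] at h ⊢
    simp only [Matrix.star_apply, Matrix.of_apply] at h ⊢
    rw [e.symm.sum_comp (fun x => U (e.symm a) x * star (U (e.symm b) x)), h]
    simp [Matrix.one_apply]⟩

theorem renameGate_apply (e : H ≃ H') (U : UnitaryOn H) (a b : H') :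
    renameGate e U a b = U (e.symm a) (e.symm b) := rfl

theorem renameGate_mul (e : H ≃ H') (U V : UnitaryOn H) :
    renameGate e (U * V) = renameGate e U * renameGate e V := by
  apply Matrix.UnitaryGroup.ext
  intro a b
  simp only [renameGate_apply, Matrix.UnitaryGroup.mul_apply, Matrix.mul_apply]
  exact (e.symm.sum_comp (fun x => U (e.symm a) x * V x (e.symm b))).symm

theorem renameGate_inv (e : H ≃ H') (U : UnitaryOn H) :
    renameGate e U⁻¹ = (renameGate e U)⁻¹ := by
  apply Matrix.UnitaryGroup.ext
  intro a b
  simp [renameGate_apply, Matrix.star_apply]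

/-- `U ⊗ I`: the operation `U` applied to the first of two registers. -/
def onFirst (T : Type) [Fintype T] [DecidableEq T] (U : UnitaryOn S) : UnitaryOn (S × T) :=
  renameGate (Equiv.prodComm T S) (onSecond T U)

theorem onFirst_apply (U : UnitaryOn S) (a b : S × T) :
    onFirst T U a b = if a.2 = b.2 then U a.1 b.1 else 0 := by
  rw [onFirst, renameGate_apply, onSecond_apply]; rfl

theorem onFirst_mul (U V : UnitaryOn S) : onFirst T (U * V) = onFirst T U * onFirst T V := by
  simp only [onFirst, onSecond_mul, renameGate_mul]

theorem onFirst_inv (U : UnitaryOn S) : onFirst T U⁻¹ = (onFirst T U)⁻¹ := by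
  simp only [onFirst, onSecond_inv, renameGate_inv]

/-- The operation that permutes the basis states. -/
def permGate (σ : Equiv.Perm H) : UnitaryOn H :=
  ⟨Matrix.of fun a b => if a = σ b then 1 else 0, by
    rw [Matrix.mem_unitaryGroup_iff]
    ext a b
    rw [Matrix.mul_apply, Finset.sum_eq_single (σ.symm a)]
    · simp [Matrix.star_apply, Matrix.one_apply, eq_comm]
    · intro x _ hx
      have : a ≠ σ x := fun h => hx (by simp [h])
      simp [this]
    · simp⟩

theorem permGate_apply (σ : Equiv.Perm H) (a b : H) :
    permGate σ a b = if a = σ b then 1 else 0 := rfl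

theorem permGate_mul_apply (σ : Equiv.Perm H) (V : UnitaryOn H) (a b : H) :
    (permGate σ * V) a b = V (σ.symm a) b := by
  rw [Matrix.UnitaryGroup.mul_apply, Matrix.mul_apply, Finset.sum_eq_single (σ.symm a)]
  · simp [permGate_apply]
  · intro x _ hx
    have : a ≠ σ x := fun h => hx (by simp [h])
    simp [permGate_apply, this]
  · simp

theorem mul_permGate_apply (σ : Equiv.Perm H) (V : UnitaryOn H) (a b : H) :
    (V * permGate σ) a b = V a (σ b) := by
  rw [Matrix.UnitaryGroup.mul_apply, Matrix.mul_apply, Finset.sum_eq_single (σ b)]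
  · simp [permGate_apply]
  · intro x _ hx
    simp [permGate_apply, hx]
  · simp

namespace QueryAlgorithm

/-- The same algorithm after renaming the basis states. -/
def rename (e : H ≃ H') : QueryAlgorithm H → QueryAlgorithm H'
  | gate V => gate (renameGate e V)
  | query => query
  | queryInverse => queryInverse
  | andThen first second => andThen (first.rename e) (second.rename e)

theorem queries_rename (e : H ≃ H') (𝒜 : QueryAlgorithm H) :
    (𝒜.rename e).queries = 𝒜.queries := by
  induction 𝒜 with
  | andThen _ _ h₁ h₂ => simp [rename, queries, h₁, h₂]
  | _ => rfl

theorem run_rename (e : H ≃ H') (𝒜 : QueryAlgorithm H) (O : UnitaryOn H) :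
    (𝒜.rename e).run (renameGate e O) = renameGate e (𝒜.run O) := by
  induction 𝒜 with
  | andThen _ _ h₁ h₂ => simp only [rename, run, h₁, h₂, renameGate_mul]
  | queryInverse => simp only [rename, run, renameGate_inv]
  | _ => rfl

/-- The same algorithm in the presence of an idle register. -/
def withIdle (P : Type) [Fintype P] [DecidableEq P] :
    QueryAlgorithm H → QueryAlgorithm (P × H)
  | gate V => gate (onSecond P V)
  | query => query
  | queryInverse => queryInverse
  | andThen first second => andThen (first.withIdle P) (second.withIdle P)

theorem queries_withIdle (𝒜 : QueryAlgorithm H) : (𝒜.withIdle P).queries = 𝒜.queries := by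
  induction 𝒜 with
  | andThen _ _ h₁ h₂ => simp [withIdle, queries, h₁, h₂]
  | _ => rfl

theorem run_withIdle (𝒜 : QueryAlgorithm H) (O : UnitaryOn H) :
    (𝒜.withIdle P).run (onSecond P O) = onSecond P (𝒜.run O) := by
  induction 𝒜 with
  | andThen _ _ h₁ h₂ => simp only [withIdle, run, h₁, h₂, onSecond_mul]
  | queryInverse => simp only [withIdle, run, onSecond_inv]
  | _ => rfl

/-- The algorithm that undoes a given one. -/
def inverse : QueryAlgorithm H → QueryAlgorithm H
  | gate V => gate V⁻¹
  | query => queryInverse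
  | queryInverse => query
  | andThen first second => andThen second.inverse first.inverse

theorem queries_inverse (𝒜 : QueryAlgorithm H) : 𝒜.inverse.queries = 𝒜.queries := by
  induction 𝒜 with
  | andThen _ _ h₁ h₂ => simp [inverse, queries, h₁, h₂, add_comm]
  | _ => rfl

theorem run_inverse (𝒜 : QueryAlgorithm H) (O : UnitaryOn H) :
    𝒜.inverse.run O = (𝒜.run O)⁻¹ := by
  induction 𝒜 with
  | andThen _ _ h₁ h₂ => simp [inverse, run, h₁, h₂]
  | queryInverse => simp [inverse, run]
  | _ => rfl

end QueryAlgorithm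

/-- The family `V` of operations on `H`, depending on the black box, is performed by a query
algorithm with at most `q` queries; the register of the black box is left untouched. -/
def Implements (q : ℕ) (V : UnitaryOn Q → UnitaryOn H) : Prop :=
  ∃ 𝒜 : QueryAlgorithm (H × Q), 𝒜.queries ≤ q ∧ ∀ U, 𝒜.run (onSecond H U) = onFirst Q (V U)

namespace Implements

theorem const (V : UnitaryOn H) : Implements 0 fun _ : UnitaryOn Q => V :=
  ⟨.gate (onFirst Q V), le_rfl, fun _ => rfl⟩

theorem congr {q : ℕ} {V V' : UnitaryOn Q → UnitaryOn H} (h : Implements q V)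
    (hV : ∀ U, V U = V' U) : Implements q V' := by
  rwa [← funext hV]

theorem mul {q q' : ℕ} {V V' : UnitaryOn Q → UnitaryOn H} (h : Implements q V)
    (h' : Implements q' V') : Implements (q + q') fun U => V U * V' U := by
  obtain ⟨𝒜, hq, h⟩ := h
  obtain ⟨𝒜', hq', h'⟩ := h'
  exact ⟨.andThen 𝒜' 𝒜, by simp only [QueryAlgorithm.queries]; omega, fun U => by
    simp only [QueryAlgorithm.run, h, h', onFirst_mul]⟩

theorem inv {q : ℕ} {V : UnitaryOn Q → UnitaryOn H} (h : Implements q V) :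
    Implements q fun U => (V U)⁻¹ := by
  obtain ⟨𝒜, hq, h⟩ := h
  exact ⟨𝒜.inverse, by rwa [QueryAlgorithm.queries_inverse], fun U => by
    rw [QueryAlgorithm.run_inverse, h, onFirst_inv]⟩

theorem rename {q : ℕ} {V : UnitaryOn Q → UnitaryOn H} (h : Implements q V) (e : H ≃ H') :
    Implements q fun U => renameGate e (V U) := by
  obtain ⟨𝒜, hq, h⟩ := h
  refine ⟨𝒜.rename (e.prodCongr (Equiv.refl Q)), by rwa [QueryAlgorithm.queries_rename],
    fun U => ?_⟩
  have h₁ : onSecond H' U = renameGate (e.prodCongr (Equiv.refl Q)) (onSecond H U) := by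
    apply Matrix.UnitaryGroup.ext
    intro a b
    simp [renameGate_apply, onSecond_apply]
  rw [h₁, QueryAlgorithm.run_rename, h]
  apply Matrix.UnitaryGroup.ext
  intro a b
  simp [renameGate_apply, onFirst_apply]

theorem onSecond {q : ℕ} {V : UnitaryOn Q → UnitaryOn H} (h : Implements q V) (P : Type)
    [Fintype P] [DecidableEq P] : Implements q fun U => _root_.onSecond P (V U) := by
  obtain ⟨𝒜, hq, h⟩ := h
  refine ⟨(𝒜.withIdle P).rename (Equiv.prodAssoc P H Q).symm, by
    rwa [QueryAlgorithm.queries_rename, QueryAlgorithm.queries_withIdle], fun U => ?_⟩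
  have h₁ : _root_.onSecond (P × H) U =
      renameGate (Equiv.prodAssoc P H Q).symm (_root_.onSecond P (_root_.onSecond H U)) := by
    apply Matrix.UnitaryGroup.ext
    rintro ⟨⟨_, _⟩, _⟩ ⟨⟨_, _⟩, _⟩
    simp [renameGate_apply, onSecond_apply, ite_and]
  rw [h₁, QueryAlgorithm.run_rename, QueryAlgorithm.run_withIdle, h]
  apply Matrix.UnitaryGroup.ext
  rintro ⟨⟨_, _⟩, _⟩ ⟨⟨_, _⟩, _⟩
  simp only [renameGate_apply, onFirst_apply, onSecond_apply, Equiv.symm_symm,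
    Equiv.prodAssoc_apply]
  split_ifs <;> rfl

/-- A query always hits the black box's own register, so the working register is swapped in before
the call and swapped back after it. -/
theorem blackBox : Implements 1 fun U : UnitaryOn Q => U := by
  refine ⟨.andThen (.gate (permGate (Equiv.prodComm Q Q)))
    (.andThen .query (.gate (permGate (Equiv.prodComm Q Q)))), le_rfl, fun U => ?_⟩
  apply Matrix.UnitaryGroup.ext
  rintro ⟨_, _⟩ ⟨_, _⟩
  simp only [QueryAlgorithm.run]
  rw [mul_permGate_apply, permGate_mul_apply, onFirst_apply, onSecond_apply]
  rfl

end Implements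

/-- The family `V` of controlled operations is performed with at most `q` queries. -/
def CtrlImplements (q : ℕ) (V : UnitaryOn Q → P → UnitaryOn S) : Prop :=
  Implements q fun U => ctrl (V U)

namespace CtrlImplements

theorem const (V : P → UnitaryOn S) : CtrlImplements 0 fun _ : UnitaryOn Q => V :=
  Implements.const _

theorem mul {q q' : ℕ} {V V' : UnitaryOn Q → P → UnitaryOn S} (h : CtrlImplements q V)
    (h' : CtrlImplements q' V') : CtrlImplements (q + q') fun U p => V U p * V' U p := by
  simpa only [CtrlImplements, ctrl_mul] using Implements.mul h h'

theorem inv {q : ℕ} {V : UnitaryOn Q → P → UnitaryOn S} (h : CtrlImplements q V) :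
    CtrlImplements q fun U p => (V U p)⁻¹ := by
  simpa only [CtrlImplements, ctrl_inv] using Implements.inv h

theorem blackBox : CtrlImplements 1 fun (U : UnitaryOn Q) (_ : P) => U := by
  simpa only [CtrlImplements, onSecond_eq_ctrl] using (Implements.blackBox (Q := Q)).onSecond P

theorem onSecond {q : ℕ} {V : UnitaryOn Q → P → UnitaryOn S} (h : CtrlImplements q V) (T : Type)
    [Fintype T] [DecidableEq T] : CtrlImplements q fun U p => _root_.onSecond T (V U p) := by
  let e : T × (P × S) ≃ P × (T × S) :=
    ((Equiv.prodAssoc T P S).symm.trans ((Equiv.prodComm T P).prodCongr (Equiv.refl S))).trans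
      (Equiv.prodAssoc P T S)
  have := (Implements.onSecond h T).rename e
  refine Implements.congr this fun U => ?_
  apply Matrix.UnitaryGroup.ext
  rintro ⟨_, t, _⟩ ⟨_, t', _⟩
  simp only [e, renameGate_apply, onSecond_apply, ctrl_apply]
  simp only [Equiv.symm_trans_apply, Equiv.prodAssoc_symm_apply, Equiv.prodCongr_symm,
    Equiv.prodCongr_apply, Equiv.symm_symm, Equiv.prodAssoc_apply, Prod.map]
  simp only [Equiv.prodComm_symm, Equiv.prodComm_apply, Prod.swap, Equiv.refl_symm,
    Equiv.refl_apply]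
  by_cases ht : t = t'
  · simp only [ht, if_true]
    rfl
  · simp [ht]

theorem onFirst {q : ℕ} {V : UnitaryOn Q → P → UnitaryOn S} (h : CtrlImplements q V) (T : Type)
    [Fintype T] [DecidableEq T] : CtrlImplements q fun U p => _root_.onFirst T (V U p) := by
  have := Implements.rename (h.onSecond T) ((Equiv.refl P).prodCongr (Equiv.prodComm T S))
  refine Implements.congr this fun U => ?_
  apply Matrix.UnitaryGroup.ext
  rintro ⟨_, _, _⟩ ⟨_, _, _⟩
  simp only [renameGate_apply, onSecond_apply, onFirst_apply, ctrl_apply]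
  rfl

/-- Currying: part of the control register becomes part of the target. This lets later stages be
controlled by values that earlier stages produced. -/
theorem ctrl {q : ℕ} {V : UnitaryOn Q → P × T → UnitaryOn S} (h : CtrlImplements q V) :
    CtrlImplements q fun U p => _root_.ctrl fun t => V U (p, t) := by
  have := Implements.rename h (Equiv.prodAssoc P T S)
  refine Implements.congr this fun U => ?_
  apply Matrix.UnitaryGroup.ext
  rintro ⟨_, _, _⟩ ⟨_, _, _⟩
  simp only [renameGate_apply, ctrl_apply, Equiv.prodAssoc_symm_apply, Prod.mk.injEq]
  split_ifs <;> simp_all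

theorem mono {q q' : ℕ} {V : UnitaryOn Q → P → UnitaryOn S} (h : CtrlImplements q V)
    (hq : q ≤ q') : CtrlImplements q' V := by
  obtain ⟨𝒜, h₁, h₂⟩ := h
  exact ⟨𝒜, h₁.trans hq, h₂⟩

end CtrlImplements

end Registers

/-! ### Amplitudes -/

section Amplitudes

variable {P S T H Q : Type} [Fintype P] [DecidableEq P] [Fintype S] [DecidableEq S]
  [Fintype T] [DecidableEq T] [Fintype H] [DecidableEq H] [Fintype Q] [DecidableEq Q]

theorem sum_normSq_mulVec (V : UnitaryOn H) (v : H → ℂ) :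
    ∑ i, ‖∑ j, V i j * v j‖ ^ 2 = ∑ j, ‖v j‖ ^ 2 := by
  have key : ∀ u : H → ℂ, ((∑ i, ‖u i‖ ^ 2 : ℝ) : ℂ) = star u ⬝ᵥ u := by
    intro u
    simp only [dotProduct, Pi.star_apply, Complex.ofReal_sum]
    refine Finset.sum_congr rfl fun i _ => ?_
    rw [Complex.ofReal_pow, ← Complex.conj_mul']
    rfl
  have h : star (V.1.mulVec v) ⬝ᵥ V.1.mulVec v = star v ⬝ᵥ v := by
    rw [Matrix.star_mulVec, Matrix.dotProduct_mulVec, Matrix.vecMul_vecMul,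
      ← Matrix.star_eq_conjTranspose, Matrix.UnitaryGroup.star_mul_self, Matrix.vecMul_one]
  have := (key (V.1.mulVec v)).trans (h.trans (key v).symm)
  exact_mod_cast this

theorem sum_normSq_col (V : UnitaryOn H) (j : H) : ∑ i, ‖V i j‖ ^ 2 = 1 := by
  have := sum_normSq_mulVec V (Pi.single j 1)
  simpa [Pi.single_apply, apply_ite] using this

theorem ctrl_mul_onFirst_apply (V : S → UnitaryOn T) (B : UnitaryOn S) (s s₀ : S) (t t₀ : T) :
    (ctrl V * onFirst T B) (s, t) (s₀, t₀) = B s s₀ * V s t t₀ := by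
  simp [Matrix.mul_apply, ctrl_apply, onFirst_apply,
    Fintype.sum_prod_type, mul_comm]

theorem onFirst_mul_onSecond_apply (A : UnitaryOn S) (B : UnitaryOn T) (s s₀ : S) (t t₀ : T) :
    (onFirst T A * onSecond S B) (s, t) (s₀, t₀) = A s s₀ * B t t₀ := by
  simp [Matrix.mul_apply, onSecond_apply, onFirst_apply,
    Fintype.sum_prod_type]

/-- The diagonal operation with the given phases. -/
noncomputable def phaseGate (φ : S → ℝ) : UnitaryOn S :=
  ⟨Matrix.diagonal fun s => Complex.exp (φ s * Complex.I), by
    rw [Matrix.mem_unitaryGroup_iff, Matrix.star_eq_conjTranspose, Matrix.diagonal_conjTranspose,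
      Matrix.diagonal_mul_diagonal, ← Matrix.diagonal_one]
    congr 1
    funext s
    rw [Pi.star_apply, RCLike.star_def, Complex.mul_conj', Complex.norm_exp_ofReal_mul_I]
    simp⟩

/-- Computing a value, applying a phase that depends on it, and uncomputing the value acts on the
initial state almost as a fixed phase `l` does, if all phases that can occur are close to `l`. -/
theorem sum_normSq_conj_phaseGate_sub (B : UnitaryOn S) (φ : S → ℝ) (l : ℂ) (s₀ : S) {e : ℝ}
    (h : ∀ s, B s s₀ ≠ 0 → ‖Complex.exp (φ s * Complex.I) - l‖ ^ 2 ≤ e) :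
    ∑ s, ‖(B⁻¹ * phaseGate φ * B) s s₀ - (if s = s₀ then l else 0)‖ ^ 2 ≤ e := by
  -- Writing `l` as `B⁻¹ l B` turns the difference into `B⁻¹ (phase - l) B`. The outer `B⁻¹`
  -- preserves norms, so only the phases on the support of column `s₀` of `B` count.
  have h₁ : ∀ s, (B⁻¹ * phaseGate φ * B) s s₀ - (if s = s₀ then l else 0) =
      ∑ j, (B⁻¹) s j * ((Complex.exp (φ j * Complex.I) - l) * B j s₀) := by
    intro s
    have h₂ : (if s = s₀ then l else 0) = l * ∑ j, (B⁻¹) s j * B j s₀ := by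
      have := congrFun (congrFun (congrArg Subtype.val (inv_mul_cancel B)) s) s₀
      rw [Matrix.UnitaryGroup.mul_val, Matrix.mul_apply] at this
      rw [this]
      simp [Matrix.one_apply]
    rw [h₂, Matrix.UnitaryGroup.mul_apply, Matrix.mul_apply, Finset.mul_sum,
      ← Finset.sum_sub_distrib]
    refine Finset.sum_congr rfl fun j _ => ?_
    have h₃ : (B⁻¹ * phaseGate φ) s j = (B⁻¹) s j * Complex.exp (φ j * Complex.I) := by
      rw [Matrix.UnitaryGroup.mul_apply]
      exact Matrix.mul_diagonal _ _ _ _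
    rw [h₃]
    ring
  simp only [h₁]
  rw [sum_normSq_mulVec]
  calc ∑ j, ‖(Complex.exp (φ j * Complex.I) - l) * B j s₀‖ ^ 2
      ≤ ∑ j, e * ‖B j s₀‖ ^ 2 := by
        refine Finset.sum_le_sum fun j _ => ?_
        rw [norm_mul, mul_pow]
        by_cases hj : B j s₀ = 0
        · simp [hj]
        · exact mul_le_mul_of_nonneg_right (h j hj) (by positivity)
    _ = e := by rw [← Finset.mul_sum, sum_normSq_col, mul_one]

theorem exists_unitary_col (v : H → ℂ) (hv : ∑ i, ‖v i‖ ^ 2 = 1) (j₀ : H) :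
    ∃ V : UnitaryOn H, ∀ i, V i j₀ = v i := by
  -- Only the value at `j₀` matters: a single unit vector is orthonormal and extends to a basis
  -- indexed by `H`, whose members become the columns.
  let v' : H → EuclideanSpace ℂ H := fun _ => WithLp.toLp 2 v
  have hn : ‖(WithLp.toLp 2 v : EuclideanSpace ℂ H)‖ = 1 := by
    rw [EuclideanSpace.norm_eq]; simp [hv]
  have ho : Orthonormal ℂ (({j₀} : Set H).domRestrict v') := by
    refine ⟨fun _ => hn, fun a b hab => (hab (Subsingleton.elim _ _)).elim⟩
  obtain ⟨b, hb⟩ := ho.exists_orthonormalBasis_extension_of_card_eq (by simp)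
  refine ⟨⟨Matrix.of fun i j => b j i, ?_⟩, fun i => ?_⟩
  · rw [Matrix.mem_unitaryGroup_iff']
    ext i j
    have := orthonormal_iff_ite.1 b.orthonormal i j
    rw [EuclideanSpace.inner_eq_star_dotProduct] at this
    rw [Matrix.mul_apply, Matrix.one_apply, ← this]
    simp [dotProduct, Matrix.star_apply, mul_comm]
  · exact congrFun (congrArg WithLp.ofLp (hb j₀ rfl)) i

end Amplitudes

/-! ### Relational oracles that never err -/

section Oracles

variable {X Y W : Type} [Fintype X] [DecidableEq X] [Fintype Y] [DecidableEq Y]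
  [Fintype W] [DecidableEq W]

/-- The column has total weight `1`, and with zero error all of it must lie on correct answers; a
wrong answer of nonzero amplitude would leave too little. -/
theorem IsRelationalOracle.mem_of_ne_zero {𝓕 : X → Set Y} {y₀ : Y} {w₀ : W}
    {U : UnitaryOn (X × Y × W)} (hU : IsRelationalOracle 𝓕 0 y₀ w₀ U) {x x' : X} {y : Y} {w : W}
    (h : U (x', y, w) (x, y₀, w₀) ≠ 0) : x' = x ∧ y ∈ 𝓕 x := by
  obtain ⟨α, ψ, hψ, hcol, hsum⟩ := hU
  rw [hcol] at h
  have hx : x' = x := by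
    by_contra hx
    simp [hx] at h
  refine ⟨hx, ?_⟩
  by_contra hy
  rw [if_pos hx] at h
  have hα : α x y ≠ 0 := left_ne_zero_of_mul h
  have h₁ : ∑ y, ‖α x y‖ ^ 2 = 1 := by
    rw [← sum_normSq_col U (x, y₀, w₀), Fintype.sum_prod_type,
      Finset.sum_eq_single x (by intro z _ hz; simp [hcol, hz]) (by simp), Fintype.sum_prod_type]
    refine Finset.sum_congr rfl fun y _ => ?_
    have := EuclideanSpace.norm_sq_eq (ψ x y)
    rw [hψ] at this
    simp only [hcol, if_true, norm_mul, mul_pow, ← Finset.mul_sum, ← this]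
    simp
  have h₂ := hsum x
  have h₃ : ∑ y, (𝓕 x).indicator (fun y => ‖α x y‖ ^ 2) y < ∑ y, ‖α x y‖ ^ 2 := by
    refine Finset.sum_lt_sum (fun z _ => ?_) ⟨y, Finset.mem_univ _, ?_⟩
    · exact Set.indicator_le_self' (fun _ _ => by positivity) z
    · rw [Set.indicator_of_notMem hy]
      positivity
  linarith

/-- Relational oracles require normalized workspace states even for answers of amplitude zero; there
the basis state `w₀` serves as default. -/
theorem exists_smul_unit (v : W → ℂ) (w₀ : W) :
    ∃ (a : ℂ) (ψ : EuclideanSpace ℂ W), ‖ψ‖ = 1 ∧ (∀ w, v w = a * ψ w) ∧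
      ‖a‖ ^ 2 = ∑ w, ‖v w‖ ^ 2 := by
  by_cases hv : (WithLp.toLp 2 v : EuclideanSpace ℂ W) = 0
  · have hv' : ∀ w, v w = 0 := fun w => congrFun (congrArg WithLp.ofLp hv) w
    exact ⟨0, EuclideanSpace.single w₀ 1, by simp, by simp [hv'], by simp [hv']⟩
  · have hn : ‖(WithLp.toLp 2 v : EuclideanSpace ℂ W)‖ ≠ 0 := norm_ne_zero_iff.2 hv
    refine ⟨‖(WithLp.toLp 2 v : EuclideanSpace ℂ W)‖,
      ((‖(WithLp.toLp 2 v : EuclideanSpace ℂ W)‖⁻¹ : ℝ) : ℂ) • WithLp.toLp 2 v, ?_, ?_, ?_⟩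
    · rw [norm_smul, Complex.norm_real, norm_inv, norm_norm, inv_mul_cancel₀ hn]
    · intro w
      simp only [PiLp.smul_apply, smul_eq_mul, Complex.ofReal_inv]
      rw [← mul_assoc, mul_inv_cancel₀ (by exact_mod_cast hn), one_mul]
    · rw [Complex.norm_real, norm_norm, EuclideanSpace.norm_sq_eq]

/-- A controlled family of operations, followed by writing down a function of the outcome, is a
relational oracle if that function is good with the required probability. -/
theorem exists_relationalOracle {A Q : Type} [Fintype A] [DecidableEq A] [Fintype Q]
    [DecidableEq Q] {q : ℕ} {V : UnitaryOn Q → X → UnitaryOn A} (h : CtrlImplements q V)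
    (ans : X → A → Y) (y₀ : Y) (a₀ : A) (m₀ : Q) :
    ∃ 𝒜 : QueryAlgorithm (X × Y × A × Q), 𝒜.queries ≤ q ∧
      ∀ (𝓕 : X → Set Y) (ρ : ℝ) (U : UnitaryOn Q),
        (∀ x, 1 - ρ ≤ ∑ a, {a | ans x a ∈ 𝓕 x}.indicator (fun a => ‖V U x a a₀‖ ^ 2) a) →
        IsRelationalOracle 𝓕 ρ y₀ (a₀, m₀)
          (𝒜.run (onSecond X (onSecond Y (onSecond A U)))) := by
  -- Swapping `y₀` with the answer is an involution, hence reversible, and on the initial state `y₀`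
  -- it writes the answer.
  let σ : X → Equiv.Perm (Y × A) := fun x =>
    { toFun := fun b => (Equiv.swap y₀ (ans x b.2) b.1, b.2)
      invFun := fun b => (Equiv.swap y₀ (ans x b.2) b.1, b.2)
      left_inv := fun b => by simp
      right_inv := fun b => by simp }
  have h' : CtrlImplements (0 + q) fun U x => permGate (σ x) * onSecond Y (V U x) :=
    (CtrlImplements.const fun x => permGate (σ x)).mul (h.onSecond Y)
  obtain ⟨𝒜, hq, h𝒜⟩ := h'
  let e : (X × (Y × A)) × Q ≃ X × Y × A × Q :=
    (Equiv.prodAssoc X (Y × A) Q).trans ((Equiv.refl X).prodCongr (Equiv.prodAssoc Y A Q))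
  refine ⟨𝒜.rename e, by rw [QueryAlgorithm.queries_rename]; omega, fun 𝓕 ρ U hU => ?_⟩
  have h₁ : onSecond X (onSecond Y (onSecond A U)) = renameGate e (onSecond (X × (Y × A)) U) := by
    apply Matrix.UnitaryGroup.ext
    rintro ⟨x, y, a, m⟩ ⟨x', y', a', m'⟩
    rw [renameGate_apply]
    simp only [onSecond_apply]
    have : (((x, (y, a)) : X × (Y × A)) = (x', (y', a'))) ↔ x = x' ∧ y = y' ∧ a = a' := by
      simp [Prod.ext_iff]
    change _ = if ((x, (y, a)) : X × (Y × A)) = (x', (y', a')) then U m m' else 0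
    simp only [this, ite_and]
  rw [h₁, QueryAlgorithm.run_rename, h𝒜]
  have hent : ∀ x x' y a m, renameGate e (onFirst Q (ctrl fun x => permGate (σ x) *
      onSecond Y (V U x))) (x', y, (a, m)) (x, y₀, (a₀, m₀)) =
      if x' = x then (if y = ans x a ∧ m = m₀ then V U x a a₀ else 0) else 0 := by
    intro x x' y a m
    rw [renameGate_apply]
    change onFirst Q _ ((x', (y, a)), m) ((x, (y₀, a₀)), m₀) = _
    rw [onFirst_apply, ctrl_apply]
    by_cases hm : m = m₀
    · by_cases hx : x' = x
      · subst hx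
        simp only [hm, if_true, permGate_mul_apply, onSecond_apply, and_true]
        have : (Equiv.swap y₀ (ans x' a) y = y₀) ↔ y = ans x' a := by
          rw [Equiv.swap_apply_eq_iff, Equiv.swap_apply_left]
        change (if Equiv.swap y₀ (ans x' a) y = y₀ then V U x' a a₀ else 0) = _
        simp only [this]
      · simp [hx]
    · simp [hm]
  choose α ψ hψ hα hn using fun x y => exists_smul_unit
    (fun b : A × Q => if y = ans x b.1 ∧ b.2 = m₀ then V U x b.1 a₀ else 0) (a₀, m₀)
  refine ⟨α, ψ, hψ, ?_, fun x => (hU x).trans (le_of_eq ?_)⟩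
  · rintro x x' y ⟨a, m⟩
    exact (hent x x' y a m).trans (by simp only [← hα])
  · have h₂ : ∀ y, ‖α x y‖ ^ 2 = ∑ a, if y = ans x a then ‖V U x a a₀‖ ^ 2 else 0 := by
      intro y
      rw [hn, Fintype.sum_prod_type]
      refine Finset.sum_congr rfl fun a _ => ?_
      rw [Finset.sum_eq_single m₀ (by intro m _ hm; simp [hm]) (by simp)]
      split_ifs <;> simp_all
    classical
    have h₃ : ∀ y, (𝓕 x).indicator (fun y => ‖α x y‖ ^ 2) y =
        ∑ a, if y = ans x a then (if y ∈ 𝓕 x then ‖V U x a a₀‖ ^ 2 else 0) else 0 := by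
      intro y
      rw [Set.indicator_apply, h₂]
      split_ifs <;> simp
    rw [Finset.sum_congr rfl fun y _ => h₃ y, Finset.sum_comm]
    refine Finset.sum_congr rfl fun a _ => ?_
    rw [Finset.sum_ite_eq' Finset.univ (ans x a), if_pos (Finset.mem_univ _), Set.indicator_apply]
    rfl

/-- Bisection of `[0, w]` with `T` queries. The workspace records all intermediate results. -/
theorem exists_bisection {P : Type} [Fintype P] [DecidableEq P] (x₀ : X) (w₀ : W)
    (query : P → ℝ → X) (accept : P → ℝ → Bool → Prop) {w : ℝ} (hw : 0 ≤ w) (T : ℕ) :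
    ∃ (S : Type) (_ : Fintype S) (_ : DecidableEq S) (s₀ : S)
      (B : UnitaryOn (X × Bool × W) → P → UnitaryOn S) (lo : P → S → ℝ),
      CtrlImplements T B ∧ ∀ (𝓕 : X → Set Bool) (U : UnitaryOn (X × Bool × W)),
        IsRelationalOracle 𝓕 0 false w₀ U → ∀ (p : P) (a b : ℝ), a ≤ w → 0 ≤ b →
        (∀ t, 0 ≤ t → ∀ c ∈ 𝓕 (query p t), (accept p t c → t ≤ b) ∧ (¬ accept p t c → a ≤ t)) →
        ∀ s, B U p s s₀ ≠ 0 → 0 ≤ lo p s ∧ lo p s ≤ b ∧ a ≤ lo p s + w / 2 ^ T := by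
  classical
  induction T with
  | zero =>
    exact ⟨Unit, inferInstance, inferInstance, (), fun _ _ => 1, fun _ _ => 0,
      CtrlImplements.const _, fun 𝓕 U _ p a b ha hb _ s _ => by simp [ha, hb]⟩
  | succ T ih =>
    obtain ⟨S, _, _, s₀, B, lo, hB, hlo⟩ := ih
    let mid : P → S → ℝ := fun p s => lo p s + w / 2 ^ (T + 1)
    -- The midpoint depends only on the recorded history, so it can be loaded into a fresh query
    -- register by a controlled swap with `x₀`.
    let V : UnitaryOn (X × Bool × W) → P × S → UnitaryOn (X × Bool × W) := fun U p =>
      U * permGate ((Equiv.swap x₀ (query p.1 (mid p.1 p.2))).prodCongr (Equiv.refl _))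
    have hV : CtrlImplements (1 + 0) V := CtrlImplements.blackBox.mul (CtrlImplements.const _)
    refine ⟨S × (X × Bool × W), inferInstance, inferInstance, (s₀, (x₀, false, w₀)),
      fun U p => ctrl (fun s => V U (p, s)) * onFirst _ (B U p),
      fun p s => if accept p (mid p s.1) s.2.2.1 then mid p s.1 else lo p s.1,
      (hV.ctrl.mul (hB.onFirst _)).mono (by omega), ?_⟩
    rintro 𝓕 U hU p a b ha hb hab ⟨s, x, c, v⟩ hne
    rw [ctrl_mul_onFirst_apply] at hne
    obtain ⟨h₀, h₁, h₂⟩ := hlo 𝓕 U hU p a b ha hb hab s (left_ne_zero_of_mul hne)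
    have h₃ := right_ne_zero_of_mul hne
    simp only [V, mul_permGate_apply, Equiv.prodCongr_apply, Prod.map, Equiv.swap_apply_left,
      Equiv.refl_apply] at h₃
    have hc := (hU.mem_of_ne_zero h₃).2
    have hm : 0 ≤ mid p s := by positivity
    obtain ⟨h₄, h₅⟩ := hab _ hm c hc
    have hhalf : w / 2 ^ T = 2 * (w / 2 ^ (T + 1)) := by
      rw [pow_succ]; field_simp
    simp only
    split_ifs with hacc
    · exact ⟨hm, h₄ hacc, by simp only [mid]; linarith⟩
    · exact ⟨h₀, h₁, h₅ hacc⟩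

end Oracles

/-! ### Phase estimation with an imperfect phase, and repetition -/

section Estimation

variable {C D S R Q : Type} [Fintype C] [DecidableEq C] [Fintype D] [DecidableEq D]
  [Fintype S] [DecidableEq S] [Fintype R] [DecidableEq R] [Fintype Q] [DecidableEq Q]

/-- Prepare a superposition over `D`, apply the phases `φ` of the computed values, transform. -/
noncomputable def phaseEstimator (F prep : UnitaryOn D) (B : D → UnitaryOn S) (φ : D → S → ℝ) :
    UnitaryOn (D × S) :=
  onFirst S F * (ctrl (fun d => (B d)⁻¹ * phaseGate (φ d) * B d) * onFirst S prep)

/-- The factor `2` pays for computing and uncomputing. -/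
theorem ctrlImplements_phaseEstimator {T : ℕ} {B : UnitaryOn Q → C × D → UnitaryOn S}
    (hB : CtrlImplements T B) (F prep : UnitaryOn D) (φ : C → D → S → ℝ) :
    CtrlImplements (2 * T) fun U c =>
      phaseEstimator F prep (fun d => B U (c, d)) (φ c) := by
  have h₁ : CtrlImplements (T + 0 + T) fun U (p : C × D) =>
      (B U p)⁻¹ * phaseGate (φ p.1 p.2) * B U p :=
    (hB.inv.mul (CtrlImplements.const _)).mul hB
  exact ((CtrlImplements.const fun _ => onFirst S F).mul
    (h₁.ctrl.mul (CtrlImplements.const fun _ => onFirst S prep))).mono (by omega)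

theorem phaseEstimator_apply (F prep : UnitaryOn D) (B : D → UnitaryOn S) (φ : D → S → ℝ)
    (k d₀ : D) (s s₀ : S) : phaseEstimator F prep B φ (k, s) (d₀, s₀) =
      ∑ d, F k d * (prep d d₀ * ((B d)⁻¹ * phaseGate (φ d) * B d) s s₀) := by
  rw [phaseEstimator, Matrix.UnitaryGroup.mul_apply, Matrix.mul_apply, Fintype.sum_prod_type]
  refine Finset.sum_congr rfl fun d _ => ?_
  rw [Finset.sum_eq_single s (by intro t _ ht; simp [onFirst_apply, ht.symm]) (by simp),
    ctrl_mul_onFirst_apply, onFirst_apply, if_pos rfl]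

/-- The outcome splits into the ideal state with phases `l`, whose workspace has returned to `s₀`,
and an error vector. The unitary `F` does not change the norm of the error, which
`sum_normSq_conj_phaseGate_sub` bounds separately for each `d`; both factors `2` come from `‖x + y‖²
≤ 2‖x‖² + 2‖y‖²`. -/
theorem sum_normSq_phaseEstimator_le (F prep : UnitaryOn D) (B : D → UnitaryOn S)
    (φ : D → S → ℝ) (d₀ : D) (s₀ : S) (l : D → ℂ) (e : D → ℝ)
    (h : ∀ d s, B d s s₀ ≠ 0 → ‖Complex.exp (φ d s * Complex.I) - l d‖ ^ 2 ≤ e d)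
    (bad : D → Prop) [DecidablePred bad] :
    ∑ r : D × S, (if bad r.1 then ‖phaseEstimator F prep B φ r (d₀, s₀)‖ ^ 2 else 0) ≤
      2 * (∑ k, if bad k then ‖∑ d, F k d * (prep d d₀ * l d)‖ ^ 2 else 0) +
      2 * ∑ d, ‖prep d d₀‖ ^ 2 * e d := by
  let err : D → S → ℂ := fun d s =>
    ((B d)⁻¹ * phaseGate (φ d) * B d) s s₀ - (if s = s₀ then l d else 0)
  have hsplit : ∀ k s, phaseEstimator F prep B φ (k, s) (d₀, s₀) =
      (if s = s₀ then ∑ d, F k d * (prep d d₀ * l d) else 0) +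
      ∑ d, F k d * (prep d d₀ * err d s) := by
    intro k s
    rw [phaseEstimator_apply]
    split_ifs with hs
    · rw [← Finset.sum_add_distrib]
      refine Finset.sum_congr rfl fun d _ => ?_
      simp only [err, if_pos hs]
      ring
    · simp [err, hs]
  have htwo : ∀ x y : ℂ, ‖x + y‖ ^ 2 ≤ 2 * ‖x‖ ^ 2 + 2 * ‖y‖ ^ 2 := fun x y => by
    nlinarith [norm_add_le x y, norm_nonneg (x + y), sq_nonneg (‖x‖ - ‖y‖)]
  have hpt : ∀ r : D × S, (if bad r.1 then ‖phaseEstimator F prep B φ r (d₀, s₀)‖ ^ 2 else 0) ≤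
      2 * (if r.2 = s₀ then (if bad r.1 then ‖∑ d, F r.1 d * (prep d d₀ * l d)‖ ^ 2 else 0)
        else 0) + 2 * ‖∑ d, F r.1 d * (prep d d₀ * err d r.2)‖ ^ 2 := by
    rintro ⟨k, s⟩
    by_cases hb : bad k
    · simp only [hb, if_true, hsplit]
      refine (htwo _ _).trans (le_of_eq ?_)
      split_ifs <;> simp
    · simp only [hb, if_false]
      split_ifs <;> simp
  refine (Finset.sum_le_sum fun r _ => hpt r).trans ?_
  rw [Finset.sum_add_distrib, ← Finset.mul_sum, ← Finset.mul_sum]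
  refine add_le_add (le_of_eq ?_) ?_
  · congr 1
    rw [Fintype.sum_prod_type]
    simp
  · refine mul_le_mul_of_nonneg_left ?_ zero_le_two
    rw [Fintype.sum_prod_type, Finset.sum_comm]
    simp only [sum_normSq_mulVec]
    rw [Finset.sum_comm]
    refine Finset.sum_le_sum fun d _ => ?_
    simp only [norm_mul, mul_pow, ← Finset.mul_sum]
    exact mul_le_mul_of_nonneg_left
      (sum_normSq_conj_phaseGate_sub (B d) (φ d) (l d) s₀ (h d)) (by positivity)

/-- Independent repetitions of an operation. -/
theorem exists_repeat {q : ℕ} {V : UnitaryOn Q → C → UnitaryOn R}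
    (hV : CtrlImplements q V) (r₀ : R) (k : ℕ) :
    ∃ (R' : Type) (_ : Fintype R') (_ : DecidableEq R') (r₀' : R')
      (V' : UnitaryOn Q → C → UnitaryOn R') (read : R' → Fin k → R),
      CtrlImplements (k * q) V' ∧ ∀ U c (f : R → ℝ),
        ∑ r, ‖V' U c r r₀'‖ ^ 2 * ∏ j, f (read r j) = (∑ r, ‖V U c r r₀‖ ^ 2 * f r) ^ k := by
  induction k with
  | zero =>
    exact ⟨Unit, inferInstance, inferInstance, (), fun _ _ => 1, fun _ => Fin.elim0,
      (CtrlImplements.const _).mono (Nat.zero_le _), fun U c f => by simp⟩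
  | succ k ih =>
    obtain ⟨R', _, _, r₀', V', read, hV', hf⟩ := ih
    refine ⟨R × R', inferInstance, inferInstance, (r₀, r₀'),
      fun U c => onFirst R' (V U c) * onSecond R (V' U c), fun r => Fin.cons r.1 (read r.2),
      ((hV.onFirst R').mul (hV'.onSecond R)).mono (by rw [Nat.succ_mul, add_comm]),
      fun U c f => ?_⟩
    rw [pow_succ', ← hf, Fintype.sum_prod_type, Finset.sum_mul]
    refine Finset.sum_congr rfl fun r _ => ?_
    rw [Finset.mul_sum]
    refine Finset.sum_congr rfl fun r' _ => ?_
    rw [onFirst_mul_onSecond_apply, norm_mul, mul_pow, Fin.prod_univ_succ]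
    simp only [Fin.cons_zero, Fin.cons_succ]
    ring

end Estimation

/-! ### Convex bodies between two balls -/

section Geometry

variable {n : ℕ}

/-- The largest `t` for which `d + t • p` belongs to `K` (a supremum). -/
noncomputable def reach (K : Set (EuclideanSpace ℝ (Fin n))) (p d : EuclideanSpace ℝ (Fin n)) : ℝ :=
  sSup {t : ℝ | d + t • p ∈ K}

variable {K : Set (EuclideanSpace ℝ (Fin n))} {r R : ℝ} {p : EuclideanSpace ℝ (Fin n)}

theorem reach_upper_bound (hR : K ⊆ Metric.closedBall 0 R) (hp : ‖p‖ = 1)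
    {d : EuclideanSpace ℝ (Fin n)} {t : ℝ} (ht : d + t • p ∈ K) : t ≤ R + ‖d‖ := by
  have h₁ : ‖d + t • p‖ ≤ R := by simpa using hR ht
  have h₂ : ‖t • p‖ ≤ ‖d + t • p‖ + ‖d‖ := by
    have := norm_sub_le (d + t • p) d
    rwa [add_sub_cancel_left] at this
  rw [norm_smul, hp, mul_one, Real.norm_eq_abs] at h₂
  linarith [le_abs_self t]

theorem le_reach (hR : K ⊆ Metric.closedBall 0 R) (hp : ‖p‖ = 1) {d : EuclideanSpace ℝ (Fin n)}
    {t : ℝ} (ht : d + t • p ∈ K) : t ≤ reach K p d :=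
  le_csSup ⟨R + ‖d‖, fun _ h => reach_upper_bound hR hp h⟩ ht

theorem reach_nonneg (hr : Metric.closedBall 0 r ⊆ K) (hR : K ⊆ Metric.closedBall 0 R)
    (hp : ‖p‖ = 1) {d : EuclideanSpace ℝ (Fin n)} (hd : ‖d‖ ≤ r) : 0 ≤ reach K p d :=
  le_reach hR hp (hr (by simpa using hd))

theorem reach_le (hr : Metric.closedBall 0 r ⊆ K) (hR : K ⊆ Metric.closedBall 0 R)
    (hp : ‖p‖ = 1) {d : EuclideanSpace ℝ (Fin n)} (hd : ‖d‖ ≤ r) : reach K p d ≤ R + ‖d‖ :=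
  csSup_le ⟨0, hr (by simpa using hd)⟩ fun _ h => reach_upper_bound hR hp h

theorem mem_of_lt_reach (hK : Convex ℝ K) (hr : Metric.closedBall 0 r ⊆ K)
    {d : EuclideanSpace ℝ (Fin n)} (hd : ‖d‖ ≤ r) {t : ℝ} (ht₀ : 0 ≤ t)
    (ht : t < reach K p d) : d + t • p ∈ K := by
  have hdK : d ∈ K := hr (by simpa using hd)
  obtain ⟨t', ht', htt'⟩ := exists_lt_of_lt_csSup ⟨0, by simpa using hdK⟩ ht
  have ht'₀ : 0 < t' := ht₀.trans_lt htt'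
  have := hK.add_smul_mem hdK ht' (t := t / t') ⟨by positivity, (div_le_one ht'₀).2 htt'.le⟩
  rwa [smul_smul, div_mul_cancel₀ _ ht'₀.ne'] at this

/-- A supporting functional at the point where the ray in direction `p` from `d` leaves `K`. -/
theorem exists_support (hK : Convex ℝ K) (hr₀ : 0 < r) (hrR : r ≤ R)
    (hr : Metric.closedBall 0 r ⊆ K) (hR : K ⊆ Metric.closedBall 0 R) (hp : ‖p‖ = 1)
    {d : EuclideanSpace ℝ (Fin n)} (hd : ‖d‖ ≤ r / 3) :
    ∃ g : EuclideanSpace ℝ (Fin n), inner ℝ g p = 1 ∧ ‖g‖ ≤ 2 * R / r ∧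
      ∀ x ∈ K, inner ℝ g x ≤ inner ℝ g d + reach K p d := by
  have hd' : ‖d‖ ≤ r := by linarith
  set q := d + reach K p d • p with hq
  -- Otherwise a slightly longer step along `p` would stay in `K`, beyond the supremum.
  have hqK : q ∉ interior K := by
    intro hqi
    obtain ⟨e, he, hball⟩ := Metric.isOpen_iff.1 isOpen_interior q hqi
    have : d + (reach K p d + e / 2) • p ∈ K := by
      refine interior_subset (hball ?_)
      rw [Metric.mem_ball, dist_eq_norm, hq, add_sub_add_left_eq_sub, ← sub_smul,
        add_sub_cancel_left, norm_smul, hp, mul_one, Real.norm_eq_abs, abs_of_pos (by linarith)]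
      linarith
    linarith [le_reach hR hp this]
  have h0 : (0 : EuclideanSpace ℝ (Fin n)) ∈ interior K :=
    interior_mono (Metric.ball_subset_closedBall.trans hr)
      (by rw [Metric.isOpen_ball.interior_eq]; simpa using hr₀)
  obtain ⟨f, hf⟩ := geometric_hahn_banach_open_point hK.interior isOpen_interior hqK
  have hfK : ∀ x ∈ K, f x ≤ f q := by
    have hcl : IsClosed {x | f x ≤ f q} := isClosed_le f.continuous continuous_const
    intro x hx
    have hx' : x ∈ closure (interior K) := by
      rw [hK.closure_interior_eq_closure_of_nonempty_interior ⟨0, h0⟩]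
      exact subset_closure hx
    exact closure_minimal (fun y hy => (hf y hy).le) hcl hx'
  obtain ⟨w, hw⟩ : ∃ w : EuclideanSpace ℝ (Fin n), ∀ x, f x = inner ℝ w x :=
    ⟨(InnerProductSpace.toDual ℝ _).symm f, fun x => by
      rw [InnerProductSpace.toDual_symm_apply]⟩
  simp only [hw] at hfK hf
  have hw0 : 0 < ‖w‖ := by
    rw [norm_pos_iff]
    rintro rfl
    simpa using hf 0 h0
  have hiq : inner ℝ w q = inner ℝ w d + reach K p d * inner ℝ w p := by
    rw [hq, inner_add_right, inner_smul_right]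
  -- The ball of radius `2r/3` around `d` lies in `K`, so the functional must rise by `(2r/3)‖w‖`
  -- between `d` and the exit point. With `reach ≤ 4R/3` this gives the norm bound `2R/r` after
  -- normalization, and it forces `⟨w, p⟩ > 0`.
  have h₁ : 2 * r / 3 * ‖w‖ ≤ reach K p d * inner ℝ w p := by
    have hmem : d + (2 * r / 3 / ‖w‖) • w ∈ K := by
      refine hr ?_
      rw [mem_closedBall_zero_iff]
      refine (norm_add_le _ _).trans ?_
      rw [norm_smul, Real.norm_eq_abs, abs_of_pos (by positivity), div_mul_cancel₀ _ hw0.ne']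
      linarith
    have := hfK _ hmem
    rw [hiq, inner_add_right, inner_smul_right, real_inner_self_eq_norm_sq] at this
    have h₂ : 2 * r / 3 / ‖w‖ * ‖w‖ ^ 2 = 2 * r / 3 * ‖w‖ := by field_simp
    linarith
  have hre := reach_nonneg hr hR hp hd'
  have hre' : reach K p d ≤ 4 * R / 3 := by linarith [reach_le hr hR hp hd']
  have hwp : 0 < inner ℝ w p := by
    by_contra hneg
    have : reach K p d * inner ℝ w p ≤ 0 := mul_nonpos_of_nonneg_of_nonpos hre (not_lt.1 hneg)
    have : 0 < 2 * r / 3 * ‖w‖ := by positivity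
    linarith
  refine ⟨(inner ℝ w p)⁻¹ • w, ?_, ?_, fun x hx => ?_⟩
  · rw [inner_smul_left]
    simp [hwp.ne']
  · rw [norm_smul, norm_inv, Real.norm_eq_abs, abs_of_pos hwp, inv_mul_le_iff₀ hwp,
      mul_div_assoc', le_div_iff₀ hr₀]
    have := mul_le_mul_of_nonneg_right hre' hwp.le
    linarith
  · have := hfK x hx
    rw [hiq] at this
    simp only [inner_smul_left, RCLike.conj_to_real]
    have h₃ := mul_le_mul_of_nonneg_left this (inv_pos.2 hwp).le
    rw [mul_add, mul_left_comm, inv_mul_cancel₀ hwp.ne', mul_one] at h₃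
    exact h₃

/-- `G` assigns to each point of the small ball a supporting functional as in `exists_support`. -/
def IsSlope (K : Set (EuclideanSpace ℝ (Fin n))) (r R : ℝ) (p : EuclideanSpace ℝ (Fin n))
    (G : EuclideanSpace ℝ (Fin n) → EuclideanSpace ℝ (Fin n)) : Prop :=
  ∀ d, ‖d‖ ≤ r / 3 → inner ℝ (G d) p = 1 ∧ ‖G d‖ ≤ 2 * R / r ∧
    ∀ x ∈ K, inner ℝ (G d) x ≤ inner ℝ (G d) d + reach K p d

theorem exists_isSlope (hK : Convex ℝ K) (hr₀ : 0 < r) (hrR : r ≤ R)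
    (hr : Metric.closedBall 0 r ⊆ K) (hR : K ⊆ Metric.closedBall 0 R) (hp : ‖p‖ = 1) :
    ∃ G, IsSlope K r R p G := by
  choose! G hG using fun d hd => exists_support (d := d) hK hr₀ hrR hr hR hp hd
  exact ⟨G, hG⟩

variable {G : EuclideanSpace ℝ (Fin n) → EuclideanSpace ℝ (Fin n)}

/-- The supergradient inequality for `-G z`: apply the support inequality to `d + t • p ∈ K` and use
`⟨G z, p⟩ = 1`. -/
theorem IsSlope.reach_le (hG : IsSlope K r R p G) (hr : Metric.closedBall 0 r ⊆ K)
    {z d : EuclideanSpace ℝ (Fin n)} (hz : ‖z‖ ≤ r / 3) (hd : ‖d‖ ≤ r) :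
    reach K p d ≤ reach K p z - inner ℝ (G z) (d - z) := by
  obtain ⟨h₁, -, h₃⟩ := hG z hz
  refine csSup_le ⟨0, by simpa using hr (by simpa using hd)⟩ fun t ht => ?_
  have := h₃ _ ht
  rw [inner_add_right, inner_smul_right, h₁] at this
  rw [inner_sub_right]
  linarith

/-- The supergradient inequalities at the two points bound the difference from both sides. -/
theorem IsSlope.abs_reach_sub_le (hG : IsSlope K r R p G) (hr₀ : 0 < r)
    (hr : Metric.closedBall 0 r ⊆ K) {z d : EuclideanSpace ℝ (Fin n)} (hz : ‖z‖ ≤ r / 3)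
    (hd : ‖d‖ ≤ r / 3) : |reach K p d - reach K p z| ≤ 2 * R / r * ‖d - z‖ := by
  have key : ∀ z d : EuclideanSpace ℝ (Fin n), ‖z‖ ≤ r / 3 → ‖d‖ ≤ r / 3 →
      reach K p d - reach K p z ≤ 2 * R / r * ‖d - z‖ := by
    intro z d hz hd
    have h₁ := hG.reach_le hr hz (d := d) (by linarith)
    have h₂ := (abs_le.1 (abs_real_inner_le_norm (G z) (d - z))).1
    have h₃ := mul_le_mul_of_nonneg_right (hG z hz).2.1 (norm_nonneg (d - z))
    linarith
  rw [abs_le]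
  have h₁ := key z d hz hd
  have h₂ := key d z hd hz
  rw [norm_sub_rev] at h₂
  constructor <;> linarith

/-- Moving by `e` changes the supporting functional by at most `2R/r * e`, and along `p` its value
is the height itself. -/
theorem IsSlope.le_of_mem_outerParallel (hG : IsSlope K r R p G)
    {d : EuclideanSpace ℝ (Fin n)} (hd : ‖d‖ ≤ r / 3) {t e : ℝ}
    (h : d + t • p ∈ outerParallel K e) : t ≤ reach K p d + 2 * R / r * e := by
  obtain ⟨x, hx, hxe⟩ := h
  obtain ⟨h₁, h₂, h₃⟩ := hG d hd
  have h₄ := h₃ x hx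
  have h₅ := (abs_le.1 (abs_real_inner_le_norm (G d) (d + t • p - x))).2
  have h₆ : ‖G d‖ * ‖d + t • p - x‖ ≤ 2 * R / r * e :=
    mul_le_mul h₂ hxe (norm_nonneg _) ((norm_nonneg _).trans h₂)
  rw [inner_sub_right, inner_add_right, inner_smul_right, h₁] at h₅
  linarith

/-- By contraposition: well below the exit point, a ball of radius `e` fits into `K`. Its points are
convex combinations of a higher point `d + (t / (1 - l)) • p` of the ray and a point of the ball of
radius `2r/3` around `d`, with weight `l = e / (2r/3)` on the latter. The height lost is `l * reach
≤ 2R/r * e`. -/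
theorem reach_le_of_notMem_innerParallel (hK : Convex ℝ K) (hr₀ : 0 < r) (hrR : r ≤ R)
    (hr : Metric.closedBall 0 r ⊆ K) (hR : K ⊆ Metric.closedBall 0 R) (hp : ‖p‖ = 1)
    {d : EuclideanSpace ℝ (Fin n)} (hd : ‖d‖ ≤ r / 3) {t e : ℝ} (ht : 0 ≤ t) (he : 0 ≤ e)
    (h : d + t • p ∉ innerParallel K e) : reach K p d - 2 * R / r * e ≤ t := by
  by_contra hlt
  rw [not_le] at hlt
  refine h fun v hv => ?_
  have hd' : ‖d‖ ≤ r := by linarith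
  have hre' : reach K p d ≤ 4 * R / 3 := by linarith [reach_le hr hR hp hd']
  have hR₀ : 0 < R := hr₀.trans_le hrR
  set l := e / (2 * r / 3) with hl
  have hl₀ : 0 ≤ l := by positivity
  have hle : 4 * R / 3 * l = 2 * R / r * e := by rw [hl]; field_simp; ring
  have hl₁ : l < 1 := by
    by_contra hl₁
    have := mul_le_mul_of_nonneg_left (not_lt.1 hl₁) (show (0 : ℝ) ≤ 4 * R / 3 by positivity)
    linarith
  set u := v - (d + t • p) with hu
  have hue : ‖u‖ ≤ e := by rw [hu, ← dist_eq_norm]; exact hv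
  -- For `l = 0` the inverse is the junk value `0`, but then `e = 0` and `u = 0`.
  have hlu : l • l⁻¹ • u = u := by
    by_cases hl0 : l = 0
    · have he0 : e = 0 := by
        have : l * (2 * r / 3) = e := by rw [hl]; field_simp
        rw [← this, hl0, zero_mul]
      have : u = 0 := norm_le_zero_iff.1 (he0 ▸ hue)
      simp [this]
    · rw [smul_smul, mul_inv_cancel₀ hl0, one_smul]
  have h₁ : d + (t / (1 - l)) • p ∈ K := by
    refine mem_of_lt_reach hK hr hd' (div_nonneg ht (by linarith)) ?_
    rw [div_lt_iff₀ (by linarith)]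
    have := mul_le_mul_of_nonneg_right hre' hl₀
    linarith
  have h₂ : d + l⁻¹ • u ∈ K := by
    refine hr ?_
    rw [mem_closedBall_zero_iff]
    refine (norm_add_le _ _).trans ?_
    rw [norm_smul, norm_inv, Real.norm_eq_abs, abs_of_nonneg hl₀]
    have : l⁻¹ * ‖u‖ ≤ 2 * r / 3 := by
      refine (mul_le_mul_of_nonneg_left hue (inv_nonneg.2 hl₀)).trans ?_
      by_cases he0 : e = 0
      · rw [he0, mul_zero]; positivity
      · rw [hl, inv_div, div_mul_cancel₀ _ he0]
    linarith
  have := hK h₁ h₂ (sub_nonneg.2 hl₁.le) hl₀ (by ring)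
  have hv' : (1 - l) • (d + (t / (1 - l)) • p) + l • (d + l⁻¹ • u) = v := by
    rw [smul_add, smul_add, hlu, smul_smul, mul_div_cancel₀ _ (by linarith), hu]
    module
  rwa [hv'] at this

theorem mem_outerParallel_add {x y : EuclideanSpace ℝ (Fin n)} {e s : ℝ}
    (hx : x ∈ outerParallel K e) (h : ‖y - x‖ ≤ s) : y ∈ outerParallel K (e + s) := by
  obtain ⟨z, hz, hxz⟩ := hx
  refine ⟨z, hz, ?_⟩
  calc ‖y - z‖ = ‖(y - x) + (x - z)‖ := by rw [sub_add_sub_cancel]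
    _ ≤ s + e := (norm_add_le _ _).trans (add_le_add h hxz)
    _ = e + s := add_comm _ _

theorem notMem_innerParallel_add {x y : EuclideanSpace ℝ (Fin n)} {e s : ℝ}
    (hx : x ∉ innerParallel K e) (h : ‖y - x‖ ≤ s) : y ∉ innerParallel K (e + s) := by
  refine fun hy => hx ((Metric.closedBall_subset_closedBall' ?_).trans hy)
  rw [dist_comm, dist_eq_norm]
  linarith

theorem outerParallel_mono {e s : ℝ} (h : e ≤ s) : outerParallel K e ⊆ outerParallel K s :=
  fun _ ⟨y, hy, hxy⟩ => ⟨y, hy, hxy.trans h⟩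

theorem innerParallel_anti {e s : ℝ} (h : e ≤ s) : innerParallel K s ⊆ innerParallel K e :=
  fun _ hx => (Metric.closedBall_subset_closedBall h).trans hx

/-- A vector close to a supporting functional near the origin separates. -/
theorem IsSlope.separates (hG : IsSlope K r R p G) (hK : Convex ℝ K) (hr₀ : 0 < r) (hrR : r ≤ R)
    (hr : Metric.closedBall 0 r ⊆ K) (hR : K ⊆ Metric.closedBall 0 R) (hp : ‖p‖ = 1)
    {y : EuclideanSpace ℝ (Fin n)} (hy : y = ‖y‖ • p) (hyR : ‖y‖ ≤ R) {e η : ℝ} (he : 0 ≤ e)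
    (hη : 0 < η) (hye : y ∉ innerParallel K e) {z : EuclideanSpace ℝ (Fin n)} (hz : ‖z‖ ≤ r / 3)
    {v : EuclideanSpace ℝ (Fin n)}
    (hv : 2 * R / r * e + 2 * (2 * R / r) * ‖z‖ + (2 * R + η) * ‖v - G z‖ ≤ 2 * η * ‖G z‖)
    {x : EuclideanSpace ℝ (Fin n)} (hx : x ∈ innerParallel K η) :
    inner ℝ v x ≤ inner ℝ v y + η * ‖v‖ := by
  obtain ⟨h₁, h₂, h₃⟩ := hG z hz
  have hg0 : 0 < ‖G z‖ := by
    rw [norm_pos_iff]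
    intro h
    simp [h] at h₁
  have hxK : x ∈ K := hx (Metric.mem_closedBall_self hη.le)
  have hxR : ‖x‖ ≤ R := by simpa using hR hxK
  -- Depth `η` of `x` gains `η‖G z‖` in the support inequality. The slack allowed in the conclusion
  -- gains nearly as much again, whence the `2 * η * ‖G z‖` in `hv`.
  have h₄ : inner ℝ (G z) x + η * ‖G z‖ ≤ inner ℝ (G z) z + reach K p z := by
    have hmem : x + (η / ‖G z‖) • G z ∈ K := by
      refine hx ?_
      rw [Metric.mem_closedBall, dist_eq_norm, add_sub_cancel_left, norm_smul, Real.norm_eq_abs,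
        abs_of_pos (by positivity), div_mul_cancel₀ _ hg0.ne']
    have := h₃ _ hmem
    rw [inner_add_right, inner_smul_right, real_inner_self_eq_norm_sq] at this
    have h₅ : η / ‖G z‖ * ‖G z‖ ^ 2 = η * ‖G z‖ := by field_simp
    linarith
  have h0 : ‖(0 : EuclideanSpace ℝ (Fin n))‖ ≤ r / 3 := by rw [norm_zero]; positivity
  have h₅ := (abs_le.1 (hG.abs_reach_sub_le hr₀ hr h0 hz)).2
  rw [sub_zero] at h₅
  have h₆ : reach K p 0 - 2 * R / r * e ≤ ‖y‖ := by
    refine reach_le_of_notMem_innerParallel hK hr₀ hrR hr hR hp h0 (norm_nonneg _) he ?_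
    rwa [zero_add, ← hy]
  have h₇ : inner ℝ (G z) y = ‖y‖ := by
    conv_lhs => rw [hy]
    rw [inner_smul_right, h₁, mul_one]
  have h₈ : inner ℝ (G z) z ≤ 2 * R / r * ‖z‖ :=
    (real_inner_le_norm _ _).trans (mul_le_mul_of_nonneg_right h₂ (norm_nonneg _))
  have h₉ : inner ℝ v x - inner ℝ v y =
      inner ℝ (G z) x - inner ℝ (G z) y + inner ℝ (v - G z) (x - y) := by
    simp only [inner_sub_left, inner_sub_right]
    ring
  have h₁₀ : inner ℝ (v - G z) (x - y) ≤ ‖v - G z‖ * (2 * R) :=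
    (real_inner_le_norm _ _).trans (mul_le_mul_of_nonneg_left
      ((norm_sub_le _ _).trans (by linarith)) (norm_nonneg _))
  have h₁₁ : ‖G z‖ - ‖v - G z‖ ≤ ‖v‖ := by
    have := norm_sub_norm_le (G z) v
    rw [norm_sub_rev] at this
    linarith
  have h₁₂ := mul_le_mul_of_nonneg_left h₁₁ hη.le
  nlinarith

end Geometry

/-! ### Averages of second differences over a grid -/

section Grid

variable {n : ℕ}

/-- The integer points of a cube with side `N`. -/
noncomputable abbrev gridBox (n N : ℕ) : Finset (Fin n → ℤ) := Fintype.piFinset fun _ => Finset.Ico 0 (N : ℤ)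

theorem card_gridBox (n N : ℕ) : (gridBox n N).card = N ^ n := by
  simp [gridBox, Fintype.card_piFinset]

/-- A point of the first box outside the second lies in one of `n` slabs, where coordinate `i` is in
`a i \ b i`; sum over the slabs. The factor `N` on the left avoids the exponent `n - 1`. -/
theorem card_piFinset_sdiff_mul_le (a b : Fin n → Finset ℤ) (N : ℕ) (ha : ∀ i, (a i).card = N) :
    (Fintype.piFinset a \ Fintype.piFinset b).card * N ≤ (∑ i, (a i \ b i).card) * N ^ n := by
  have hsub : Fintype.piFinset a \ Fintype.piFinset b ⊆
      Finset.univ.biUnion fun i => Fintype.piFinset (Function.update a i (a i \ b i)) := by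
    intro w hw
    simp only [Finset.mem_sdiff, Fintype.mem_piFinset, not_forall] at hw
    obtain ⟨hwa, i, hi⟩ := hw
    simp only [Finset.mem_biUnion, Finset.mem_univ, true_and, Fintype.mem_piFinset]
    refine ⟨i, fun j => ?_⟩
    by_cases hj : j = i
    · subst hj
      simp [hwa, hi]
    · simp [hj, hwa]
  have hcard : ∀ i, (Fintype.piFinset (Function.update a i (a i \ b i))).card * N =
      (a i \ b i).card * N ^ n := by
    intro i
    rw [Fintype.card_piFinset, ← Finset.mul_prod_erase _ _ (Finset.mem_univ i)]
    rw [Finset.prod_congr rfl (g := fun _ => N) (by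
      intro j hj
      rw [Function.update_of_ne (Finset.ne_of_mem_erase hj), ha]), Finset.prod_const,
      Function.update_self, Finset.card_erase_of_mem (Finset.mem_univ _), Finset.card_univ,
      Fintype.card_fin, mul_assoc, ← pow_succ, Nat.sub_add_cancel (Fin.pos i)]
  calc _ ≤ (∑ i, (Fintype.piFinset (Function.update a i (a i \ b i))).card) * N :=
        Nat.mul_le_mul_right _ ((Finset.card_le_card hsub).trans Finset.card_biUnion_le)
    _ = _ := by
        rw [Finset.sum_mul, Finset.sum_mul]
        exact Finset.sum_congr rfl fun i _ => hcard i

theorem card_Ico_sdiff_Ico_add_le (c d N : ℤ) :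
    (Finset.Ico c (c + N) \ Finset.Ico (c + d) (c + d + N)).card ≤ d.natAbs := by
  have : Finset.Ico c (c + N) \ Finset.Ico (c + d) (c + d + N) ⊆
      if 0 ≤ d then Finset.Ico c (c + d) else Finset.Ico (c + N + d) (c + N) := by
    intro x hx
    simp only [Finset.mem_sdiff, Finset.mem_Ico] at hx
    split_ifs <;> simp only [Finset.mem_Ico] <;> omega
  refine (Finset.card_le_card this).trans ?_
  split_ifs <;> simp only [Int.card_Ico] <;> omega

/-- Second differences average out over a cube, up to boundary terms. -/
theorem sum_second_difference_le (N : ℕ) (F : (Fin n → ℤ) → ℝ) (u : Fin n → ℤ) {B : ℝ}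
    (hB₀ : 0 ≤ B) (hB : ∀ w ∈ gridBox n N, |F (w + u) - F w| ≤ B)
    (hB' : ∀ w ∈ gridBox n N, |F w - F (w - u)| ≤ B) :
    (∑ w ∈ gridBox n N, (2 * F w - F (w + u) - F (w - u))) * N ≤
      2 * B * (∑ i, |(u i : ℝ)|) * N ^ n := by
  let h : (Fin n → ℤ) → ℝ := fun w => F (w + u) - F w
  let Z' : Finset (Fin n → ℤ) := Fintype.piFinset fun i => Finset.Ico (0 + -u i) (0 + -u i + N)
  have hZ : gridBox n N = Fintype.piFinset fun _ => Finset.Ico (0 : ℤ) (0 + N) := by simp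
  have hmem : ∀ w, w ∈ Z' ↔ w + u ∈ gridBox n N := by
    intro w
    simp only [Z', gridBox, Fintype.mem_piFinset, Finset.mem_Ico, Pi.add_apply]
    exact forall_congr' fun i => by omega
  have h₁ : ∑ w ∈ gridBox n N, h (w - u) = ∑ w ∈ Z', h w := by
    refine Finset.sum_bij' (fun w _ => w - u) (fun w _ => w + u) ?_ ?_ ?_ ?_ ?_
    · intro w hw; rw [hmem]; simpa using hw
    · intro w hw; exact (hmem w).1 hw
    · intro w _; simp
    · intro w _; simp
    · intro w _; rfl
  -- A second difference is `h (w - u) - h w` for the first difference `h`, so the sum compares `h`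
  -- on two translates of the cube. Only their symmetric difference survives.
  have h₂ : ∑ w ∈ gridBox n N, (2 * F w - F (w + u) - F (w - u)) =
      ∑ w ∈ Z', h w - ∑ w ∈ gridBox n N, h w := by
    rw [← h₁, ← Finset.sum_sub_distrib]
    refine Finset.sum_congr rfl fun w _ => ?_
    simp only [h, sub_add_cancel]
    ring
  have h₃ : ∑ w ∈ Z' \ gridBox n N, h w ≤ B * (Z' \ gridBox n N).card := by
    rw [mul_comm, ← nsmul_eq_mul]
    refine Finset.sum_le_card_nsmul _ _ _ fun w hw => ?_
    have := hB' (w + u) ((hmem w).1 (Finset.mem_sdiff.1 hw).1)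
    rw [add_sub_cancel_right] at this
    exact (abs_le.1 this).2
  have h₄ : -∑ w ∈ gridBox n N \ Z', h w ≤ B * (gridBox n N \ Z').card := by
    rw [← Finset.sum_neg_distrib, mul_comm, ← nsmul_eq_mul]
    refine Finset.sum_le_card_nsmul _ _ _ fun w hw => ?_
    have := hB w (Finset.mem_sdiff.1 hw).1
    linarith [(abs_le.1 this).1]
  have h₅ : ∑ w ∈ Z', h w - ∑ w ∈ gridBox n N, h w =
      ∑ w ∈ Z' \ gridBox n N, h w - ∑ w ∈ gridBox n N \ Z', h w :=
    (Finset.sum_sdiff_sub_sum_sdiff (f := h)).symm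
  have hu : ∀ i, |(u i : ℝ)| = ((u i).natAbs : ℝ) := fun i => by
    rw [Nat.cast_natAbs, Int.cast_abs]
  have h₆ : ((Z' \ gridBox n N).card : ℝ) * N ≤ (∑ i, |(u i : ℝ)|) * N ^ n := by
    simp only [hu]
    have := card_piFinset_sdiff_mul_le (fun i => Finset.Ico (0 + -u i) (0 + -u i + N))
      (fun _ => Finset.Ico (0 : ℤ) (N : ℤ)) N (by simp)
    have h' : ∀ i, (Finset.Ico (0 + -u i) (0 + -u i + N) \ Finset.Ico (0 : ℤ) (N : ℤ)).card ≤
        (u i).natAbs := by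
      intro i
      have := card_Ico_sdiff_Ico_add_le (0 + -u i) (u i) N
      simpa using this
    have h'' := this.trans (Nat.mul_le_mul_right _ (Finset.sum_le_sum fun i _ => h' i))
    exact_mod_cast h''
  have h₇ : ((gridBox n N \ Z').card : ℝ) * N ≤ (∑ i, |(u i : ℝ)|) * N ^ n := by
    simp only [hu]
    have := card_piFinset_sdiff_mul_le (fun _ => Finset.Ico (0 : ℤ) (0 + (N : ℤ)))
      (fun i => Finset.Ico (0 + -u i) (0 + -u i + N)) N (by simp)
    have h' : ∀ i, (Finset.Ico (0 : ℤ) (0 + (N : ℤ)) \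
        Finset.Ico (0 + -u i) (0 + -u i + N)).card ≤ (u i).natAbs := by
      intro i
      have := card_Ico_sdiff_Ico_add_le 0 (-u i) N
      simpa using this
    have h'' := this.trans (Nat.mul_le_mul_right _ (Finset.sum_le_sum fun i _ => h' i))
    rw [hZ]
    exact_mod_cast h''
  rw [h₂, h₅]
  have h₈ := mul_le_mul_of_nonneg_left h₆ hB₀
  have h₉ := mul_le_mul_of_nonneg_left h₇ hB₀
  have h₁₀ : (∑ w ∈ Z' \ gridBox n N, h w - ∑ w ∈ gridBox n N \ Z', h w) * (N : ℝ) ≤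
      (B * (Z' \ gridBox n N).card + B * (gridBox n N \ Z').card) * N :=
    mul_le_mul_of_nonneg_right (by linarith) (Nat.cast_nonneg _)
  linarith

end Grid

/-! ### Medians and repetition -/

/-- Take the largest entry with at most half of the entries below it. More than half lie below the
next larger value, so fewer than half exceed the chosen one. -/
theorem exists_median {k : ℕ} (hk : 0 < k) (v : Fin k → ℝ) :
    ∃ m : ℝ, 2 * (Finset.univ.filter fun j => v j < m).card ≤ k ∧
      2 * (Finset.univ.filter fun j => m < v j).card ≤ k := by
  have : Nonempty (Fin k) := ⟨⟨0, hk⟩⟩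
  let A := Finset.univ.filter fun i => 2 * (Finset.univ.filter fun j => v j < v i).card ≤ k
  have hA : A.Nonempty := by
    obtain ⟨i, _, hi⟩ := Finset.exists_min_image Finset.univ v Finset.univ_nonempty
    refine ⟨i, ?_⟩
    have : (Finset.univ.filter fun j => v j < v i) = ∅ :=
      Finset.filter_eq_empty_iff.2 fun j hj => not_lt.2 (hi j hj)
    simp [A, this]
  obtain ⟨i, hiA, hi⟩ := Finset.exists_max_image A v hA
  refine ⟨v i, (Finset.mem_filter.1 hiA).2, ?_⟩
  by_cases hB : (Finset.univ.filter fun j => v i < v j).Nonempty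
  · obtain ⟨l, hl, hlmin⟩ := Finset.exists_min_image _ v hB
    have hl' : v i < v l := (Finset.mem_filter.1 hl).2
    have hlA : l ∉ A := fun h => (hi l h).not_gt hl'
    have h₁ : k < 2 * (Finset.univ.filter fun j => v j < v l).card := by
      simpa [A] using hlA
    have h₂ : Disjoint (Finset.univ.filter fun j => v j < v l)
        (Finset.univ.filter fun j => v i < v j) := by
      rw [Finset.disjoint_left]
      intro j hj hj'
      exact (hlmin j hj').not_gt (Finset.mem_filter.1 hj).2
    have h₃ := Finset.card_le_univ ((Finset.univ.filter fun j => v j < v l).disjUnion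
        (Finset.univ.filter fun j => v i < v j) h₂)
    rw [Finset.card_disjUnion, Fintype.card_fin] at h₃
    omega
  · rw [Finset.not_nonempty_iff_eq_empty] at hB
    simp [hB]

/-- A median lies in every interval that contains a strict majority of the entries; it is chosen
without knowing the interval. -/
theorem exists_robust_center (k : ℕ) : ∃ med : (Fin k → ℝ) → ℝ, ∀ (v : Fin k → ℝ) (g b : ℝ),
    2 * (Finset.univ.filter fun j => ¬ |v j - g| ≤ b).card < k → |med v - g| ≤ b := by
  rcases Nat.eq_zero_or_pos k with rfl | hk
  · exact ⟨fun _ => 0, fun v g b h => by simp at h⟩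
  choose med h₁ h₂ using fun v => exists_median hk v
  refine ⟨med, fun v g b h => ?_⟩
  have hsplit := Finset.card_filter_add_card_filter_not (s := (Finset.univ : Finset (Fin k)))
    (fun j => |v j - g| ≤ b)
  rw [Finset.card_univ, Fintype.card_fin] at hsplit
  rw [abs_le]
  constructor
  · by_contra hlt
    have : (Finset.univ.filter fun j => |v j - g| ≤ b).card ≤
        (Finset.univ.filter fun j => med v < v j).card :=
      Finset.card_le_card fun j hj => by
        simp only [Finset.mem_filter, Finset.mem_univ, true_and, abs_le] at hj ⊢
        linarith
    have := h₂ v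
    omega
  · by_contra hlt
    have : (Finset.univ.filter fun j => |v j - g| ≤ b).card ≤
        (Finset.univ.filter fun j => v j < med v).card :=
      Finset.card_le_card fun j hj => by
        simp only [Finset.mem_filter, Finset.mem_univ, true_and, abs_le] at hj ⊢
        linarith
    have := h₁ v
    omega

/-- Chernoff bound: a majority of `k` independent trials fails with probability at most
`((1 + 3 p) / 2) ^ k`, where `p` is the failure probability of one trial. -/
theorem sum_majority_bad_le {R R' : Type} [Fintype R] [Fintype R'] {k : ℕ} (P : R → ℝ)
    (P' : R' → ℝ) (read : R' → Fin k → R) (hP' : ∀ r, 0 ≤ P' r)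
    (h : ∀ f : R → ℝ, ∑ r, P' r * ∏ j, f (read r j) = (∑ r, P r * f r) ^ k) (hP : ∑ r, P r = 1)
    (bad : R → Prop) [DecidablePred bad] :
    ∑ r, (if k ≤ 2 * (Finset.univ.filter fun j => bad (read r j)).card then P' r else 0) ≤
      ((1 + 3 * ∑ r, if bad r then P r else 0) / 2) ^ k := by
  -- The exponential moment: with `c` bad trials the product is `4 ^ c / 2 ^ k`, which is at least
  -- `1` exactly when `k ≤ 2 * c`.
  have h₁ := h fun r => (if bad r then 4 else 1) / 2
  have h₂ : ∑ r, P r * ((if bad r then 4 else 1) / 2) =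
      (1 + 3 * ∑ r, if bad r then P r else 0) / 2 := by
    have h₃ : ∑ r, P r * ((if bad r then 4 else 1) / 2) =
        (∑ r, P r + 3 * ∑ r, if bad r then P r else 0) / 2 := by
      rw [Finset.mul_sum, ← Finset.sum_add_distrib, Finset.sum_div]
      refine Finset.sum_congr rfl fun r _ => ?_
      split_ifs <;> ring
    rw [h₃, hP]
  rw [h₂] at h₁
  rw [← h₁]
  refine Finset.sum_le_sum fun r _ => ?_
  set c := (Finset.univ.filter fun j => bad (read r j)).card with hc
  have h₃ : ∏ j, ((if bad (read r j) then (4 : ℝ) else 1) / 2) = 4 ^ c / 2 ^ k := by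
    rw [Finset.prod_div_distrib, Finset.prod_const, Finset.card_univ, Fintype.card_fin,
      ← Finset.prod_filter, Finset.prod_const]
  rw [h₃]
  split_ifs with hk
  · refine le_mul_of_one_le_right (hP' r) ?_
    rw [one_le_div (by positivity)]
    calc (2 : ℝ) ^ k ≤ 2 ^ (2 * c) := pow_le_pow_right₀ one_le_two hk
      _ = 4 ^ c := by rw [pow_mul]; norm_num
  · have := hP' r
    positivity

/-! ### The Fourier transform and phase estimation with a triangular window -/

section Fourier

variable {n N : ℕ} [NeZero N]

/-- The inverse Fourier transform on `(ℤ / N) ^ n`. -/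
noncomputable def fourierGate (n N : ℕ) [NeZero N] : UnitaryOn (Fin n → ZMod N) :=
  ⟨Matrix.of fun k d => ∏ i, (((√(N : ℝ))⁻¹ : ℝ) : ℂ) * ZMod.stdAddChar (-(d i * k i)), by
    rw [Matrix.mem_unitaryGroup_iff]
    ext k k'
    rw [Matrix.mul_apply]
    simp only [Matrix.star_apply, Matrix.of_apply, ← starRingEnd_apply, map_prod, map_mul,
      Complex.conj_ofReal, ← AddChar.map_neg_eq_conj, neg_neg, ← Finset.prod_mul_distrib]
    have h₁ : ∀ i, ∑ x : ZMod N, ((((√(N : ℝ))⁻¹ : ℝ) : ℂ) * ZMod.stdAddChar (-(x * k i))) *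
        ((((√(N : ℝ))⁻¹ : ℝ) : ℂ) * ZMod.stdAddChar (x * k' i)) =
        if k i = k' i then 1 else 0 := by
      intro i
      have hN : ((((√(N : ℝ))⁻¹ : ℝ) : ℂ)) * (((√(N : ℝ))⁻¹ : ℝ) : ℂ) = (N : ℂ)⁻¹ := by
        rw [← Complex.ofReal_mul, ← mul_inv, Real.mul_self_sqrt (Nat.cast_nonneg _)]
        simp
      have h₂ : ∀ x : ZMod N, ((((√(N : ℝ))⁻¹ : ℝ) : ℂ) * ZMod.stdAddChar (-(x * k i))) *
          ((((√(N : ℝ))⁻¹ : ℝ) : ℂ) * ZMod.stdAddChar (x * k' i)) =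
          (N : ℂ)⁻¹ * ZMod.stdAddChar (x * (k' i - k i)) := by
        intro x
        rw [mul_mul_mul_comm, hN, ← AddChar.map_add_eq_mul]
        congr 2
        ring
      simp only [h₂]
      rw [← Finset.mul_sum, AddChar.sum_mulShift _ (ZMod.isPrimitive_stdAddChar N), ZMod.card]
      by_cases hk : k i = k' i
      · have : (N : ℂ) ≠ 0 := Nat.cast_ne_zero.2 (NeZero.ne N)
        simp [hk, this]
      · simp [hk, sub_eq_zero, Ne.symm hk]
    rw [← Fintype.piFinset_univ, ← Finset.prod_univ_sum (fun _ => Finset.univ)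
      (fun i x => ((((√(N : ℝ))⁻¹ : ℝ) : ℂ) * ZMod.stdAddChar (-(x * k i))) *
        ((((√(N : ℝ))⁻¹ : ℝ) : ℂ) * ZMod.stdAddChar (x * k' i)))]
    simp only [h₁, Finset.prod_ite_zero, Finset.prod_const_one, Matrix.one_apply,
      Finset.mem_univ, true_implies, funext_iff]⟩

theorem fourierGate_apply (k d : Fin n → ZMod N) : fourierGate n N k d =
    ∏ i, (((√(N : ℝ))⁻¹ : ℝ) : ℂ) * ZMod.stdAddChar (-(d i * k i)) := rfl

/-- A shift becomes multiplication by a character. Hence the deviation of a measured frequency is,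
by Parseval, the norm of a difference operator applied to the state. -/
theorem fourierGate_apply_sub_single (k d : Fin n → ZMod N) (i : Fin n) :
    fourierGate n N k (d - Pi.single i 1) = ZMod.stdAddChar (k i) * fourierGate n N k d := by
  simp only [fourierGate_apply]
  rw [← Finset.mul_prod_erase _ _ (Finset.mem_univ i),
    ← Finset.mul_prod_erase _ _ (Finset.mem_univ i), ← mul_assoc]
  congr 1
  · rw [mul_left_comm, ← AddChar.map_add_eq_mul]
    congr 2
    simp only [Pi.sub_apply, Pi.single_eq_same]
    ring
  · refine Finset.prod_congr rfl fun j hj => ?_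
    simp [Pi.single_eq_of_ne (Finset.ne_of_mem_erase hj)]

/-- The mean square deviation of the measured frequency from `w` in one coordinate. -/
theorem sum_normSq_fourierGate (ψ : (Fin n → ZMod N) → ℂ) (i : Fin n) (w : ℂ) :
    ∑ k : Fin n → ZMod N, ‖ZMod.stdAddChar (k i) - w‖ ^ 2 *
      ‖∑ d, fourierGate n N k d * ψ d‖ ^ 2 = ∑ d, ‖ψ (d + Pi.single i 1) - w * ψ d‖ ^ 2 := by
  rw [← sum_normSq_mulVec (fourierGate n N)]
  refine Finset.sum_congr rfl fun k _ => ?_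
  rw [← mul_pow, ← norm_mul]
  congr 2
  simp only [mul_sub, Finset.sum_sub_distrib, sub_mul]
  congr 1
  · rw [Finset.mul_sum]
    refine Eq.trans ?_ (Equiv.sum_comp (Equiv.subRight (Pi.single i (1 : ZMod N)))
      (fun d => fourierGate n N k d * ψ (d + Pi.single i 1)))
    refine Finset.sum_congr rfl fun d _ => ?_
    rw [Equiv.subRight_apply, sub_add_cancel, fourierGate_apply_sub_single, mul_assoc]
  · rw [Finset.mul_sum]
    exact Finset.sum_congr rfl fun d _ => by ring

/-- The product state with window `a` and linear phase with frequencies `φ`, measured in the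
Fourier basis, gives a good estimate of each frequency. -/
theorem sum_bad_fourierGate_le (a : ZMod N → ℝ) (ha₀ : a 0 = 0) (ha : ∑ x, a x ^ 2 = 1)
    (θ : ℝ) (φ : Fin n → ℝ) (i : Fin n) {b : ℝ} (hb : 0 < b) :
    (∑ k : Fin n → ZMod N,
      if b < ‖ZMod.stdAddChar (k i) - Complex.exp (φ i * Complex.I)‖ then
        ‖∑ d, fourierGate n N k d * ((∏ j, (a (d j) : ℂ)) *
          Complex.exp ((θ + ∑ j, φ j * ((d j).val : ℝ) : ℝ) * Complex.I))‖ ^ 2 else 0) ≤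
      (∑ x, (a (x + 1) - a x) ^ 2) / b ^ 2 := by
  set ψ : (Fin n → ZMod N) → ℂ := fun d => (∏ j, (a (d j) : ℂ)) *
          Complex.exp ((θ + ∑ j, φ j * ((d j).val : ℝ) : ℝ) * Complex.I) with hψ
  set w := Complex.exp (φ i * Complex.I) with hw
  have h₁ := sum_normSq_fourierGate ψ i w
  let β : Fin n → ZMod N → ℂ := fun j x => a x * Complex.exp ((φ j * (x.val : ℝ) : ℝ) * Complex.I)
  have hβψ : ∀ d, ψ d = Complex.exp (θ * Complex.I) * ∏ j, β j (d j) := by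
    intro d
    simp only [hψ, β, Finset.prod_mul_distrib, ← Complex.exp_sum, ← Finset.sum_mul]
    rw [mul_left_comm, ← Complex.exp_add, ← add_mul]
    push_cast
    rfl
  have hβ : ∀ j x, ‖β j x‖ ^ 2 = a x ^ 2 := by
    intro j x
    simp only [β, norm_mul, Complex.norm_exp_ofReal_mul_I, mul_one, Complex.norm_real,
      Real.norm_eq_abs, sq_abs]
  -- The frequency need not be a multiple of `1 / N`, so the phase jumps at the wraparound `x + 1 =
  -- 0`; this is harmless because the window vanishes at `0`.
  have hβ' : ∀ x, ‖β i (x + 1) - w * β i x‖ ^ 2 = (a (x + 1) - a x) ^ 2 := by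
    intro x
    by_cases hx : x + 1 = 0
    · simp only [hx]
      have h₀ : β i 0 = 0 := by simp [β, ha₀]
      rw [h₀, zero_sub, norm_neg, norm_mul, mul_pow, hβ, ha₀, hw, Complex.norm_exp_ofReal_mul_I]
      ring
    · have hval : (x + 1).val = x.val + 1 := by
        have hlt : x.val + 1 < N := by
          have h₂ := ZMod.val_lt x
          refine lt_of_le_of_ne h₂ fun h => hx ?_
          rw [← ZMod.natCast_zmod_val x, ← Nat.cast_one, ← Nat.cast_add, h]
          exact ZMod.natCast_self N
        conv_lhs => rw [← ZMod.natCast_zmod_val x, ← Nat.cast_one, ← Nat.cast_add]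
        rw [ZMod.val_natCast, Nat.mod_eq_of_lt hlt]
      have h₂ : β i (x + 1) - w * β i x = ((a (x + 1) - a x : ℝ) : ℂ) *
          Complex.exp ((φ i * ((x.val + 1 : ℕ) : ℝ) : ℝ) * Complex.I) := by
        have h₃ : Complex.exp ((φ i * ((x.val + 1 : ℕ) : ℝ) : ℝ) * Complex.I) =
            w * Complex.exp ((φ i * (x.val : ℝ) : ℝ) * Complex.I) := by
          rw [hw, ← Complex.exp_add]
          congr 1
          push_cast
          ring
        simp only [β, hval]
        rw [h₃]
        push_cast
        ring
      rw [h₂, norm_mul, Complex.norm_exp_ofReal_mul_I, mul_one, Complex.norm_real,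
        Real.norm_eq_abs, sq_abs]
  have h₂ : ∀ d, ‖ψ (d + Pi.single i 1) - w * ψ d‖ ^ 2 =
      ∏ j, if j = i then (a (d j + 1) - a (d j)) ^ 2 else a (d j) ^ 2 := by
    intro d
    rw [hβψ, hβψ, mul_left_comm, ← mul_sub, norm_mul, Complex.norm_exp_ofReal_mul_I, one_mul]
    rw [← Finset.mul_prod_erase _ _ (Finset.mem_univ i),
      ← Finset.mul_prod_erase _ _ (Finset.mem_univ i),
      ← Finset.mul_prod_erase _ _ (Finset.mem_univ i), if_pos rfl, ← hβ']
    rw [Finset.prod_congr rfl (g := fun j => β j (d j)) (by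
      intro j hj
      simp [Pi.single_eq_of_ne (Finset.ne_of_mem_erase hj)])]
    rw [Finset.prod_congr rfl (g := fun j => ‖β j (d j)‖ ^ 2) (by
      intro j hj
      rw [if_neg (Finset.ne_of_mem_erase hj), hβ])]
    rw [Finset.prod_pow, ← norm_prod, ← mul_pow, ← norm_mul]
    simp only [Pi.add_apply, Pi.single_eq_same]
    congr 2
    ring
  have h₃ : ∑ d, ‖ψ (d + Pi.single i 1) - w * ψ d‖ ^ 2 = ∑ x, (a (x + 1) - a x) ^ 2 := by
    simp only [h₂]
    rw [← Fintype.piFinset_univ, ← Finset.prod_univ_sum (fun _ => Finset.univ)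
      (fun j x => if j = i then (a (x + 1) - a x) ^ 2 else a x ^ 2),
      ← Finset.mul_prod_erase _ _ (Finset.mem_univ i)]
    rw [Finset.prod_congr rfl (g := fun _ => (1 : ℝ)) (by
      intro j hj
      simp only [if_neg (Finset.ne_of_mem_erase hj), ha])]
    simp
  -- Chebyshev's inequality.
  rw [le_div_iff₀ (by positivity), ← h₃, ← h₁, Finset.sum_mul]
  refine Finset.sum_le_sum fun k _ => ?_
  split_ifs with hk
  · rw [mul_comm]
    exact mul_le_mul_of_nonneg_right (pow_le_pow_left₀ hb.le hk.le 2) (by positivity)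
  · rw [zero_mul]
    positivity

theorem sum_prod_sq_eq_one (a : ZMod N → ℝ) (ha : ∑ x, a x ^ 2 = 1) :
    ∑ d : Fin n → ZMod N, ‖∏ j, (a (d j) : ℂ)‖ ^ 2 = 1 := by
  have : ∀ d : Fin n → ZMod N, ‖∏ j, (a (d j) : ℂ)‖ ^ 2 = ∏ j, a (d j) ^ 2 := by
    intro d
    rw [norm_prod, ← Finset.prod_pow]
    simp
  simp only [this]
  rw [← Fintype.piFinset_univ, ← Finset.prod_univ_sum (fun _ => Finset.univ)
    (fun _ x => a x ^ 2)]
  simp [ha]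

/-- The triangular window. -/
theorem exists_window (M : ℕ) (hM : 0 < M) [NeZero (2 * M)] : ∃ a : ZMod (2 * M) → ℝ,
    a 0 = 0 ∧ ∑ x, a x ^ 2 = 1 ∧ ∑ x, (a (x + 1) - a x) ^ 2 ≤ 3 / (M : ℝ) ^ 2 := by
  let A : ZMod (2 * M) → ℝ := fun x => min (x.val : ℝ) (2 * M - x.val)
  have hM' : (0 : ℝ) < M := by exact_mod_cast hM
  have hstep : ∀ x, (A (x + 1) - A x) ^ 2 ≤ 1 := by
    intro x
    rw [sq_le_one_iff_abs_le_one]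
    have hv := ZMod.val_lt x
    by_cases hx : x.val + 1 < 2 * M
    · have hval : (x + 1).val = x.val + 1 := by
        conv_lhs => rw [← ZMod.natCast_zmod_val x, ← Nat.cast_one, ← Nat.cast_add]
        rw [ZMod.val_natCast, Nat.mod_eq_of_lt hx]
      simp only [A, hval]
      push_cast
      refine (abs_min_sub_min_le_max _ _ _ _).trans ?_
      rw [add_sub_cancel_left, sub_sub_sub_cancel_left]
      simp
    · have hx' : x.val + 1 = 2 * M := by omega
      have h0 : x + 1 = 0 := by
        rw [← ZMod.natCast_zmod_val x, ← Nat.cast_one, ← Nat.cast_add, hx']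
        exact ZMod.natCast_self _
      have hx'' : (x.val : ℝ) = 2 * M - 1 := by
        rw [eq_sub_iff_add_eq]; exact_mod_cast hx'
      have hM1 : (1 : ℝ) ≤ M := by exact_mod_cast hM
      simp only [A, h0, ZMod.val_zero, hx'']
      rw [min_eq_left (by simp), min_eq_right (by linarith)]
      norm_num
  -- The exact sum is `(2M³ + M) / 3`. The `2M` increments have size at most `1`, so the normalized
  -- energy is at most `2M / (2M³/3) = 3/M²`.
  have hsum : 2 * (M : ℝ) ^ 3 / 3 ≤ ∑ x, A x ^ 2 := by
    have h₁ : ∑ x, A x ^ 2 = ∑ j ∈ Finset.range (2 * M), (min (j : ℝ) (2 * M - j)) ^ 2 := by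
      refine Finset.sum_bij (fun x _ => x.val) ?_ ?_ ?_ ?_
      · intro x _; exact Finset.mem_range.2 (ZMod.val_lt x)
      · intro x _ y _ h; exact ZMod.val_injective _ h
      · intro j hj
        exact ⟨(j : ZMod (2 * M)), Finset.mem_univ _, by
          rw [ZMod.val_natCast, Nat.mod_eq_of_lt (Finset.mem_range.1 hj)]⟩
      · intro x _; rfl
    have h₂ : ∀ m : ℕ, ∑ j ∈ Finset.range m, (j : ℝ) ^ 2 = m * (m - 1) * (2 * m - 1) / 6 := by
      intro m
      induction m with
      | zero => simp
      | succ m ih => rw [Finset.sum_range_succ, ih]; push_cast; ring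
    have h₃ : ∑ j ∈ Finset.range M, (min (j : ℝ) (2 * M - j)) ^ 2 =
        M * (M - 1) * (2 * M - 1) / 6 := by
      rw [← h₂]
      refine Finset.sum_congr rfl fun j hj => ?_
      have : (j : ℝ) < M := by exact_mod_cast Finset.mem_range.1 hj
      rw [min_eq_left (by linarith)]
    have h₄ : ∑ j ∈ Finset.range M, (min ((M + j : ℕ) : ℝ) (2 * M - (M + j : ℕ))) ^ 2 =
        M * (M - 1) * (2 * M - 1) / 6 + (M : ℝ) ^ 2 := by
      rw [← h₂, ← Finset.sum_range_succ, Finset.sum_range_succ']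
      rw [← Finset.sum_range_reflect]
      simp only [Nat.cast_zero, ne_eq, OfNat.ofNat_ne_zero, not_false_eq_true, zero_pow, add_zero]
      refine Finset.sum_congr rfl fun j hj => ?_
      have hj' := Finset.mem_range.1 hj
      have h₅ : ((M - 1 - j : ℕ) : ℝ) = M - 1 - j := by
        rw [Nat.cast_sub (by omega), Nat.cast_sub (by omega)]
        simp
      have h₆ : (0 : ℝ) ≤ M - 1 - j := by rw [← h₅]; positivity
      push_cast
      rw [h₅, min_eq_right (by linarith)]
      ring
    have h₅ := Finset.sum_range_add (fun j : ℕ => (min (j : ℝ) (2 * M - j)) ^ 2) M M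
    rw [← two_mul, h₃, h₄] at h₅
    rw [h₁, h₅]
    nlinarith
  have hpos : 0 < ∑ x, A x ^ 2 := lt_of_lt_of_le (by positivity) hsum
  refine ⟨fun x => (√(∑ x, A x ^ 2))⁻¹ * A x, ?_, ?_, ?_⟩
  · simp [A]
  · simp only [mul_pow, ← Finset.mul_sum, inv_pow, Real.sq_sqrt hpos.le]
    exact inv_mul_cancel₀ hpos.ne'
  · simp only [← mul_sub, mul_pow, ← Finset.mul_sum, inv_pow, Real.sq_sqrt hpos.le]
    have h₁ : ∑ x, (A (x + 1) - A x) ^ 2 ≤ 2 * M := by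
      refine (Finset.sum_le_sum fun x _ => hstep x).trans ?_
      simp [ZMod.card]
    calc (∑ x, A x ^ 2)⁻¹ * ∑ x, (A (x + 1) - A x) ^ 2
        ≤ (2 * (M : ℝ) ^ 3 / 3)⁻¹ * (2 * M) :=
          mul_le_mul (inv_anti₀ (by positivity) hsum) h₁
            (Finset.sum_nonneg fun _ _ => sq_nonneg _) (by positivity)
      _ = 3 / (M : ℝ) ^ 2 := by field_simp

/-- A frequency in the middle half of the period is determined by its point on the circle. -/
theorem abs_valMinAbs_div_sub_le {M : ℕ} (hM : 16 ≤ M) [NeZero (2 * M)] (k : ZMod (2 * M))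
    {φ : ℝ} (hφ : |φ| ≤ 1 / 4)
    (h : ‖ZMod.stdAddChar k - Complex.exp ((2 * Real.pi * φ : ℝ) * Complex.I)‖ ≤ 8 / M) :
    |(k.valMinAbs : ℝ) / (2 * M) - φ| ≤ 2 / M := by
  have hM' : (16 : ℝ) ≤ M := by exact_mod_cast hM
  set y := (k.valMinAbs : ℝ) / (2 * M) - φ with hy
  have hk : |(k.valMinAbs : ℝ) / (2 * M)| ≤ 1 / 2 := by
    have h₁ : (k.valMinAbs.natAbs : ℝ) ≤ M := by
      have := ZMod.natAbs_valMinAbs_le k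
      rw [Nat.mul_div_cancel_left _ two_pos] at this
      exact_mod_cast this
    rw [Nat.cast_natAbs, Int.cast_abs] at h₁
    rw [abs_div, abs_of_pos (show (0 : ℝ) < 2 * M by linarith), div_le_iff₀ (by linarith)]
    linarith
  have hy34 : |y| ≤ 3 / 4 := by
    have := abs_sub ((k.valMinAbs : ℝ) / (2 * M)) φ
    linarith
  have h₁ : ‖ZMod.stdAddChar k - Complex.exp ((2 * Real.pi * φ : ℝ) * Complex.I)‖ =
      2 * |Real.sin (Real.pi * y)| := by
    have h₂ : (ZMod.stdAddChar k : ℂ) =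
        Complex.exp ((2 * Real.pi * φ : ℝ) * Complex.I) *
          Complex.exp (Complex.I * (2 * Real.pi * y : ℝ)) := by
      rw [← Complex.exp_add, ← ZMod.coe_valMinAbs k, ZMod.stdAddChar_coe]
      congr 1
      rw [hy]
      have : (M : ℂ) ≠ 0 := by
        have : (M : ℝ) ≠ 0 := by linarith
        exact_mod_cast this
      push_cast
      field_simp
      ring
    rw [h₂, ← mul_sub_one, norm_mul, Complex.norm_exp_ofReal_mul_I, one_mul,
      Complex.norm_exp_I_mul_ofReal_sub_one, norm_mul, Real.norm_eq_abs, Real.norm_eq_abs, abs_two]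
    congr 3
    ring
  rw [h₁] at h
  have hpi := Real.pi_pos
  have hjordan : ∀ x : ℝ, |x| ≤ 1 / 2 → 2 * |x| ≤ |Real.sin (Real.pi * x)| := by
    intro x hx
    have h₃ : |Real.pi * x| ≤ Real.pi / 2 := by
      rw [abs_mul, abs_of_pos hpi]
      nlinarith
    have := Real.mul_abs_le_abs_sin h₃
    rw [abs_mul, abs_of_pos hpi] at this
    have h₄ : 2 / Real.pi * (Real.pi * |x|) = 2 * |x| := by field_simp
    linarith
  by_cases hy2 : |y| ≤ 1 / 2
  · have := hjordan y hy2
    have h₅ : (8 : ℝ) / M = 4 * (2 / M) := by ring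
    linarith
  -- Aliasing is excluded here: `1/2 < |y| ≤ 3/4` makes the chord at least `1`, whereas `8 / M ≤
  -- 1/2`.
  · have h₆ : ∀ x : ℝ, |Real.sin (Real.pi * x)| = |Real.sin (Real.pi * (1 - |x|))| := by
      intro x
      rw [mul_sub, mul_one, Real.sin_pi_sub]
      rcases abs_choice x with h | h <;> simp [h]
    have h₇ := hjordan (1 - |y|) (by rw [abs_le]; constructor <;> linarith)
    rw [← h₆, abs_of_nonneg (by linarith)] at h₇
    have h₈ : (8 : ℝ) / M ≤ 1 / 2 := by
      rw [div_le_div_iff₀ (by linarith) (by norm_num)]; linarith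
    linarith

end Fourier

/-! ### Gradient estimation -/

section Points

variable {n : ℕ}

theorem norm_le_sqrt_mul {v : EuclideanSpace ℝ (Fin n)} {b : ℝ} (hb : 0 ≤ b)
    (h : ∀ i, |v i| ≤ b) : ‖v‖ ≤ √(n : ℝ) * b := by
  rw [EuclideanSpace.norm_eq]
  refine Real.sqrt_le_iff.2 ⟨by positivity, ?_⟩
  rw [mul_pow, Real.sq_sqrt (Nat.cast_nonneg _)]
  calc ∑ i, ‖v i‖ ^ 2 ≤ ∑ _i : Fin n, b ^ 2 :=
        Finset.sum_le_sum fun i _ => pow_le_pow_left₀ (norm_nonneg _) (h i) 2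
    _ = n * b ^ 2 := by simp

/-- The point of the lattice with spacing `s` that has integer coordinates `w` relative to a corner
of a cube with side `N * s` centred at the origin. -/
noncomputable def gridPoint (s : ℝ) (N : ℕ) (w : Fin n → ℤ) : EuclideanSpace ℝ (Fin n) :=
  WithLp.toLp 2 fun i => s * ((w i : ℝ) - N / 2)

/-- The integer displacement that is encoded by an index of the phase estimation register. -/
def displacement {M : ℕ} (d : Fin n → ZMod (2 * M)) : Fin n → ℤ := fun i => ((d i).val : ℤ) - M

theorem abs_displacement_le {M : ℕ} [NeZero (2 * M)] (d : Fin n → ZMod (2 * M)) (i : Fin n) :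
    |(displacement d i : ℝ)| ≤ M := by
  have h := ZMod.val_lt (d i)
  have : |displacement d i| ≤ (M : ℤ) := by
    simp only [displacement, abs_le]
    omega
  exact_mod_cast this

theorem norm_gridPoint_add_le {s : ℝ} (hs : 0 ≤ s) {N M : ℕ} {w u : Fin n → ℤ}
    (hw : w ∈ gridBox n N) (hu : ∀ i, |(u i : ℝ)| ≤ M) :
    ‖gridPoint s N (w + u)‖ ≤ √(n : ℝ) * (s * (N / 2 + M)) := by
  refine norm_le_sqrt_mul (by positivity) fun i => ?_
  have h := Finset.mem_Ico.1 (Fintype.mem_piFinset.1 hw i)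
  have h₁ : (0 : ℝ) ≤ w i := by exact_mod_cast h.1
  have h₂ : (w i : ℝ) ≤ N := by exact_mod_cast h.2.le
  have h₃ := abs_le.1 (hu i)
  simp only [gridPoint, Pi.add_apply]
  rw [abs_mul, abs_of_nonneg hs]
  refine mul_le_mul_of_nonneg_left ?_ hs
  push_cast
  rw [abs_le]
  constructor <;> linarith

theorem norm_gridPoint_le {s : ℝ} (hs : 0 ≤ s) {N : ℕ} {w : Fin n → ℤ}
    (hw : w ∈ gridBox n N) : ‖gridPoint s N w‖ ≤ √(n : ℝ) * (s * (N / 2)) := by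
  have := norm_gridPoint_add_le hs hw (M := 0) (u := 0) (by simp)
  simpa using this

theorem gridPoint_add_sub (s : ℝ) (N : ℕ) (w u : Fin n → ℤ) :
    gridPoint s N (w + u) - gridPoint s N w = WithLp.toLp 2 fun i => s * (u i : ℝ) := by
  ext i
  simp only [gridPoint, PiLp.sub_apply, Pi.add_apply]
  push_cast
  ring

theorem norm_gridPoint_add_sub_le {s : ℝ} (hs : 0 ≤ s) (N : ℕ) {M : ℕ} (w : Fin n → ℤ)
    {u : Fin n → ℤ} (hu : ∀ i, |(u i : ℝ)| ≤ M) :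
    ‖gridPoint s N (w + u) - gridPoint s N w‖ ≤ √(n : ℝ) * (s * M) := by
  rw [gridPoint_add_sub]
  refine norm_le_sqrt_mul (by positivity) fun i => ?_
  simp only
  rw [abs_mul, abs_of_nonneg hs]
  exact mul_le_mul_of_nonneg_left (hu i) hs

/-- The deviation of the reach function from its linearization. -/
noncomputable def linearizationGap (K : Set (EuclideanSpace ℝ (Fin n)))
    (p : EuclideanSpace ℝ (Fin n)) (G : EuclideanSpace ℝ (Fin n) → EuclideanSpace ℝ (Fin n))
    (z d : EuclideanSpace ℝ (Fin n)) : ℝ :=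
  reach K p z - inner ℝ (G z) (d - z) - reach K p d

variable {K : Set (EuclideanSpace ℝ (Fin n))} {r R : ℝ} {p : EuclideanSpace ℝ (Fin n)}
  {G : EuclideanSpace ℝ (Fin n) → EuclideanSpace ℝ (Fin n)}

theorem IsSlope.gap_nonneg (hG : IsSlope K r R p G) (hr₀ : 0 < r)
    (hr : Metric.closedBall 0 r ⊆ K) {z d : EuclideanSpace ℝ (Fin n)} (hz : ‖z‖ ≤ r / 3)
    (hd : ‖d‖ ≤ r / 3) : 0 ≤ linearizationGap K p G z d := by
  have := hG.reach_le hr hz (d := d) (by linarith)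
  rw [linearizationGap]
  linarith

/-- On average over a cube, the reach function is almost linear at small distances. -/
theorem IsSlope.sum_gap_le (hG : IsSlope K r R p G) (hr₀ : 0 < r) (hR₀ : 0 ≤ R)
    (hr : Metric.closedBall 0 r ⊆ K) {s : ℝ} (hs : 0 ≤ s) {N M : ℕ} (hN : 0 < N)
    (hdom : √(n : ℝ) * (s * (N / 2 + M)) ≤ r / 3) {u : Fin n → ℤ} (hu : ∀ i, |(u i : ℝ)| ≤ M) :
    (∑ w ∈ gridBox n N, linearizationGap K p G (gridPoint s N w) (gridPoint s N (w + u))) /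
      (N : ℝ) ^ n ≤ 2 * (2 * R / r * (√(n : ℝ) * (s * M))) * (n * M) / N := by
  have hN' : (0 : ℝ) < N := by exact_mod_cast hN
  have hneg : ∀ i, |(((-u : Fin n → ℤ)) i : ℝ)| ≤ M := fun i => by simpa using hu i
  have h0 : ∀ w ∈ gridBox n N, ‖gridPoint s N w‖ ≤ r / 3 := fun w hw => by
    have := norm_gridPoint_add_le hs hw (M := M) (u := 0) (by simp)
    rw [add_zero] at this
    exact this.trans hdom
  have hp : ∀ w ∈ gridBox n N, ‖gridPoint s N (w + u)‖ ≤ r / 3 := fun w hw =>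
    (norm_gridPoint_add_le hs hw hu).trans hdom
  have hm : ∀ w ∈ gridBox n N, ‖gridPoint s N (w - u)‖ ≤ r / 3 := fun w hw => by
    rw [sub_eq_add_neg]
    exact (norm_gridPoint_add_le hs hw hneg).trans hdom
  have hL : 0 ≤ 2 * R / r := by positivity
  have hsec := sum_second_difference_le N (fun w => reach K p (gridPoint s N w)) u
    (B := 2 * R / r * (√(n : ℝ) * (s * M))) (by positivity)
    (fun w hw => (hG.abs_reach_sub_le hr₀ hr (h0 w hw) (hp w hw)).trans
      (mul_le_mul_of_nonneg_left (norm_gridPoint_add_sub_le hs N w hu) hL))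
    (fun w hw => by
      rw [abs_sub_comm]
      refine (hG.abs_reach_sub_le hr₀ hr (h0 w hw) (hm w hw)).trans
        (mul_le_mul_of_nonneg_left ?_ hL)
      rw [sub_eq_add_neg w]
      exact norm_gridPoint_add_sub_le hs N w hneg)
  -- The gaps at `u` and `-u` add up to the second difference, as the linear terms cancel; the gap
  -- at `-u` is nonnegative and can be added for free.
  have hle : ∑ w ∈ gridBox n N, linearizationGap K p G (gridPoint s N w) (gridPoint s N (w + u)) ≤
      ∑ w ∈ gridBox n N, (2 * reach K p (gridPoint s N w) - reach K p (gridPoint s N (w + u)) -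
        reach K p (gridPoint s N (w - u))) := by
    refine Finset.sum_le_sum fun w hw => ?_
    have h₁ := hG.gap_nonneg hr₀ hr (h0 w hw) (hm w hw)
    have h₂ : gridPoint s N (w - u) - gridPoint s N w =
        -(gridPoint s N (w + u) - gridPoint s N w) := by
      rw [gridPoint_add_sub, sub_eq_add_neg w, gridPoint_add_sub]
      ext i
      simp
    rw [linearizationGap, h₂, inner_neg_right] at h₁
    rw [linearizationGap]
    linarith
  have hsum : ∑ i, |(u i : ℝ)| ≤ n * M := by
    refine (Finset.sum_le_sum fun i _ => hu i).trans ?_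
    simp
  rw [div_le_div_iff₀ (by positivity) hN']
  refine (mul_le_mul_of_nonneg_right hle hN'.le).trans (hsec.trans ?_)
  gcongr

end Points

/-! ### Phase estimation with an approximately linear phase -/

section Estimator

/-- `A` will be the evaluation error, uniformly small, and `B` the linearization gap, small only on
average. The bound must be linear in `B` to survive averaging; it comes from `4 sin²(B/2) ≤ 4
|sin(B/2)| ≤ 2B`. -/
theorem normSq_exp_sub_exp_le {x y A B : ℝ} (h : x - y = A + B) (hB : 0 ≤ B) :
    ‖Complex.exp (x * Complex.I) - Complex.exp (y * Complex.I)‖ ^ 2 ≤ 2 * A ^ 2 + 4 * B := by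
  have h₁ : Complex.exp (x * Complex.I) - Complex.exp (y * Complex.I) =
      Complex.exp (y * Complex.I) * ((Complex.exp (Complex.I * A) - 1) * Complex.exp (Complex.I * B)
        + (Complex.exp (Complex.I * B) - 1)) := by
    have hx : x = y + A + B := by linarith
    have : Complex.exp (x * Complex.I) =
        Complex.exp (y * Complex.I) * (Complex.exp (Complex.I * A) * Complex.exp (Complex.I * B)) := by
      rw [← Complex.exp_add, ← Complex.exp_add, hx]
      congr 1
      push_cast
      ring
    rw [this]
    ring
  have h₂ : ‖Complex.exp (Complex.I * A) - 1‖ ≤ |A| := Real.norm_exp_I_mul_ofReal_sub_one_le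
  have h₃ : ‖Complex.exp (Complex.I * B) - 1‖ ^ 2 ≤ 2 * B := by
    rw [Complex.norm_exp_I_mul_ofReal_sub_one, norm_mul, Real.norm_eq_abs, Real.norm_eq_abs,
      abs_two, mul_pow]
    have h₄ := Real.abs_sin_le_one (B / 2)
    have h₅ : |Real.sin (B / 2)| ≤ |B / 2| := Real.abs_sin_le_abs
    rw [abs_of_nonneg (show 0 ≤ B / 2 by positivity)] at h₅
    nlinarith [abs_nonneg (Real.sin (B / 2))]
  have h₄ : ‖Complex.exp (x * Complex.I) - Complex.exp (y * Complex.I)‖ ≤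
      |A| + ‖Complex.exp (Complex.I * B) - 1‖ := by
    rw [h₁, norm_mul, Complex.norm_exp_ofReal_mul_I, one_mul]
    refine (norm_add_le _ _).trans (add_le_add ?_ le_rfl)
    rw [norm_mul, Complex.norm_exp_I_mul_ofReal, mul_one]
    exact h₂
  have h₅ := pow_le_pow_left₀ (norm_nonneg _) h₄ 2
  nlinarith [sq_abs A, sq_nonneg (|A| - ‖Complex.exp (Complex.I * B) - 1‖)]

variable {n M : ℕ} [NeZero (2 * M)] {S : Type} [Fintype S] [DecidableEq S]

/-- Failure probability of one coordinate in phase estimation with an imperfect linear phase. -/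
theorem sum_bad_phaseEstimator_le (hM : 0 < M) {a : ZMod (2 * M) → ℝ} (ha₀ : a 0 = 0)
    (ha : ∑ x, a x ^ 2 = 1) (ha' : ∑ x, (a (x + 1) - a x) ^ 2 ≤ 3 / (M : ℝ) ^ 2)
    (prep : UnitaryOn (Fin n → ZMod (2 * M))) (d₀ : Fin n → ZMod (2 * M))
    (hprep : ∀ d, prep d d₀ = ∏ j, (a (d j) : ℂ))
    (B : (Fin n → ZMod (2 * M)) → UnitaryOn S) (φ : (Fin n → ZMod (2 * M)) → S → ℝ) (s₀ : S)
    (θ : ℝ) (freq : Fin n → ℝ) (e : (Fin n → ZMod (2 * M)) → ℝ)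
    (h : ∀ d s, B d s s₀ ≠ 0 → ‖Complex.exp (φ d s * Complex.I) -
      Complex.exp ((θ + ∑ j, freq j * ((d j).val : ℝ) : ℝ) * Complex.I)‖ ^ 2 ≤ e d) (i : Fin n) :
    (∑ r : (Fin n → ZMod (2 * M)) × S,
      if 8 / (M : ℝ) < ‖ZMod.stdAddChar (r.1 i) - Complex.exp (freq i * Complex.I)‖ then
        ‖phaseEstimator (fourierGate n (2 * M)) prep B φ r (d₀, s₀)‖ ^ 2 else 0) ≤
      6 / 64 + 2 * ∑ d, ‖prep d d₀‖ ^ 2 * e d := by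
  have hM' : (0 : ℝ) < M := by exact_mod_cast hM
  refine (sum_normSq_phaseEstimator_le (fourierGate n (2 * M)) prep B φ d₀ s₀ _ e h
    (fun d => 8 / (M : ℝ) < ‖ZMod.stdAddChar (d i) - Complex.exp (freq i * Complex.I)‖)).trans
    (add_le_add ?_ le_rfl)
  have h₁ := sum_bad_fourierGate_le a ha₀ ha θ freq i (b := 8 / (M : ℝ)) (by positivity)
  simp only [hprep]
  have h₂ : (∑ x, (a (x + 1) - a x) ^ 2) / (8 / (M : ℝ)) ^ 2 ≤ 3 / 64 := by
    rw [div_le_iff₀ (by positivity)]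
    refine ha'.trans (le_of_eq ?_)
    field_simp
    norm_num
  linarith

end Estimator

/-! ### From membership queries to an approximate subgradient -/

section Gradient

variable {n : ℕ}

/-- Each coordinate is rounded down to a multiple of the step, except at the upper end of the range.
-/
theorem FixedPointFormat.exists_decode_near (F : FixedPointFormat) {R : ℝ}
    (hF : 2 * R ≤ 2 ^ F.bits * F.step) {x : EuclideanSpace ℝ (Fin n)} (hx : ‖x‖ ≤ R) :
    ∃ v : F.Vec n, ‖F.decode v - x‖ ≤ √(n : ℝ) * F.step := by
  have hs := F.step_pos
  have hcoord : ∀ t : ℝ, |t| ≤ R → ∃ j : Fin (2 ^ F.bits),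
      |F.step * (((j : ℕ) : ℝ) - 2 ^ F.bits / 2) - t| ≤ F.step := by
    intro t ht
    obtain ⟨ht₁, ht₂⟩ := abs_le.1 ht
    set y := t / F.step + 2 ^ F.bits / 2 with hy
    have hty : t = F.step * (y - 2 ^ F.bits / 2) := by rw [hy]; field_simp; ring
    have hy₀ : 0 ≤ y := by
      have : -(2 ^ F.bits / 2) ≤ t / F.step := by rw [le_div_iff₀ hs]; linarith
      linarith
    have hy₁ : y ≤ 2 ^ F.bits := by
      have : t / F.step ≤ 2 ^ F.bits / 2 := by rw [div_le_iff₀ hs]; linarith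
      linarith
    have hpos : 0 < 2 ^ F.bits := Nat.two_pow_pos F.bits
    have key : ∀ j : ℕ, |(j : ℝ) - y| ≤ 1 → |F.step * ((j : ℝ) - 2 ^ F.bits / 2) - t| ≤ F.step := by
      intro j hj
      rw [hty, ← mul_sub, sub_sub_sub_cancel_right, abs_mul, abs_of_pos hs]
      exact mul_le_of_le_one_right hs.le hj
    by_cases hlt : ⌊y⌋₊ < 2 ^ F.bits
    · refine ⟨⟨⌊y⌋₊, hlt⟩, key _ ?_⟩
      have h₁ := Nat.floor_le hy₀
      have h₂ := Nat.lt_floor_add_one y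
      rw [abs_le]
      constructor <;> linarith
    -- The largest pattern is `2 ^ bits - 1`, one step short of the end of the covered interval.
    · have h₁ : ((2 ^ F.bits : ℕ) : ℝ) ≤ y := (Nat.le_floor_iff hy₀).1 (not_lt.1 hlt)
      push_cast at h₁
      refine ⟨⟨2 ^ F.bits - 1, by omega⟩, key _ ?_⟩
      have h₂ : ((2 ^ F.bits - 1 : ℕ) : ℝ) = 2 ^ F.bits - 1 := by
        rw [Nat.cast_sub hpos]
        simp
      rw [h₂, abs_le]
      constructor <;> linarith
  choose! j hj using hcoord
  refine ⟨fun i => j (x i), norm_le_sqrt_mul hs.le fun i => ?_⟩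
  exact hj (x i) ((PiLp.norm_apply_le x i).trans hx)

/-- A rounding map into the format. -/
theorem FixedPointFormat.exists_rounding (F : FixedPointFormat) {R : ℝ}
    (hF : 2 * R ≤ 2 ^ F.bits * F.step) (n : ℕ) :
    ∃ f : EuclideanSpace ℝ (Fin n) → F.Vec n,
      ∀ x, ‖x‖ ≤ R → ‖F.decode (f x) - x‖ ≤ √(n : ℝ) * F.step := by
  classical
  refine ⟨fun x => if h : ‖x‖ ≤ R then (F.exists_decode_near hF h).choose else F.zeroBits n,
    fun x hx => ?_⟩
  simp only [hx, dif_pos]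
  exact (F.exists_decode_near hF hx).choose_spec

/-- Membership answers on rounded points on a ray locate the point where the ray leaves `K`. -/
theorem membership_on_ray (F : FixedPointFormat) {K : Set (EuclideanSpace ℝ (Fin n))} {r R ε : ℝ}
    {p : EuclideanSpace ℝ (Fin n)} {G : EuclideanSpace ℝ (Fin n) → EuclideanSpace ℝ (Fin n)}
    (hK : Convex ℝ K) (hr₀ : 0 < r) (hrR : r ≤ R) (hr : Metric.closedBall 0 r ⊆ K)
    (hR : K ⊆ Metric.closedBall 0 R) (hε : 0 ≤ ε) (hp : ‖p‖ = 1) (hG : IsSlope K r R p G)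
    {round : EuclideanSpace ℝ (Fin n) → F.Vec n}
    (hround : ∀ x, ‖x‖ ≤ R → ‖F.decode (round x) - x‖ ≤ √(n : ℝ) * F.step)
    {d : EuclideanSpace ℝ (Fin n)} (hd : ‖d‖ ≤ r / 3) {t : ℝ} (ht : 0 ≤ t) {c : Bool}
    (hc : c ∈ memAnswers K ε (F.decode (round (d + t • p)))) :
    ((c = true ∧ ‖d + t • p‖ ≤ R) →
      t ≤ reach K p d + 2 * R / r * (ε + √(n : ℝ) * F.step)) ∧
    (¬ (c = true ∧ ‖d + t • p‖ ≤ R) →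
      reach K p d - 2 * R / r * (ε + √(n : ℝ) * F.step) ≤ t) := by
  have hs := F.step_pos
  have he : 0 ≤ ε + √(n : ℝ) * F.step := by positivity
  constructor
  · rintro ⟨hct, hq⟩
    rcases hc with ⟨-, hc⟩ | ⟨hcf, -⟩
    · refine hG.le_of_mem_outerParallel hd (mem_outerParallel_add hc ?_)
      rw [norm_sub_rev]
      exact hround _ hq
    · simp [hct] at hcf
  · intro hacc
    refine reach_le_of_notMem_innerParallel hK hr₀ hrR hr hR hp hd ht he ?_
    by_cases hq : ‖d + t • p‖ ≤ R
    · rcases hc with ⟨hct, -⟩ | ⟨-, hc⟩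
      · exact (hacc ⟨hct, hq⟩).elim
      · refine notMem_innerParallel_add hc ?_
        rw [norm_sub_rev]
        exact hround _ hq
    -- Rounding is accurate only up to norm `R`. Points beyond are rejected whatever the oracle
    -- says, rightly so because `K` lies in the ball.
    · intro hmem
      exact hq (by simpa using hR (hmem (Metric.mem_closedBall_self he)))

open scoped Classical in
/-- Repeated phase estimation at a grid point, with its failure probability. -/
theorem exists_repeated_estimation {X W : Type} [Fintype X] [DecidableEq X] [Fintype W]
    [DecidableEq W] (dir : X → EuclideanSpace ℝ (Fin n)) (F : FixedPointFormat) (w₀ : W)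
    {r R ε s δ S : ℝ} {M N T : ℕ} [NeZero (2 * M)] (k : ℕ) (hr₀ : 0 < r) (hrR : r ≤ R)
    (hε : 0 ≤ ε) (hF : 2 * R ≤ 2 ^ F.bits * F.step) (hM : 0 < M) (hs : 0 ≤ s) (hS : 0 < S)
    (hdom : √(n : ℝ) * (s * (N / 2 + M)) ≤ r / 3)
    (hδ : 2 * R / r * (ε + √(n : ℝ) * F.step) + 2 * R / 2 ^ T ≤ δ)
    (hphase : 4 * (2 * Real.pi * S * δ) ^ 2 ≤ 17 / 250) :
    ∃ (A : Type) (_ : Fintype A) (_ : DecidableEq A) (a₀ : A)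
      (V : UnitaryOn (F.Vec n × Bool × W) → X × gridBox n N → UnitaryOn A)
      (read : A → Fin k → Fin n → ZMod (2 * M)) (wgt : (Fin n → ZMod (2 * M)) → ℝ),
      CtrlImplements (k * (2 * T)) V ∧ (∀ d, 0 ≤ wgt d) ∧ ∑ d, wgt d = 1 ∧
      ∀ (K : Set (EuclideanSpace ℝ (Fin n))), Convex ℝ K → Metric.closedBall 0 r ⊆ K →
        K ⊆ Metric.closedBall 0 R → ∀ U, IsMEM F w₀ K ε 0 U → ∀ x, ‖dir x‖ = 1 →
        ∀ G, IsSlope K r R (dir x) G → ∀ z : gridBox n N,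
        (∑ a, if ∃ i, k ≤ 2 * (Finset.univ.filter fun j =>
            8 / (M : ℝ) < ‖ZMod.stdAddChar (read a j i) -
              Complex.exp ((2 * Real.pi * (S * s * G (gridPoint s N z.1) i) : ℝ) *
                Complex.I)‖).card then
          ‖V U (x, z) a a₀‖ ^ 2 else 0) ≤
        16 * Real.pi * S / (17 / 125) * (∑ d, wgt d * linearizationGap K (dir x) G
          (gridPoint s N z.1) (gridPoint s N (z.1 + displacement d))) + n * (19 / 20) ^ k := by
  have hR₀ : 0 < R := hr₀.trans_le hrR
  have hpi := Real.pi_pos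
  obtain ⟨a, ha₀, ha, ha'⟩ := exists_window M hM
  obtain ⟨round, hround⟩ := F.exists_rounding hF n
  let d₀ : Fin n → ZMod (2 * M) := 0
  obtain ⟨prep, hprep⟩ := exists_unitary_col (fun d : Fin n → ZMod (2 * M) => ∏ j, (a (d j) : ℂ))
    (sum_prod_sq_eq_one a ha) d₀
  let pt : (X × gridBox n N) × (Fin n → ZMod (2 * M)) → EuclideanSpace ℝ (Fin n) :=
    fun p => gridPoint s N (p.1.2.1 + displacement p.2)
  obtain ⟨Sl, _, _, s₀, B, lo, hB, hlo⟩ := exists_bisection (X := F.Vec n) (F.zeroBits n) w₀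
    (fun p t => round (pt p + t • dir p.1.1))
    (fun p t c => c = true ∧ ‖pt p + t • dir p.1.1‖ ≤ R) (w := 2 * R) (by positivity) T
  -- The sign makes the frequencies `+S s G(z)`, since the slope of the reach function is `-G(z)`.
  let φ : X × gridBox n N → (Fin n → ZMod (2 * M)) → Sl → ℝ :=
    fun c d t => -(2 * Real.pi * S * lo (c, d) t)
  have hV := ctrlImplements_phaseEstimator hB (fourierGate n (2 * M)) prep φ
  obtain ⟨A, _, _, a₀, V, read, hV', hrep⟩ := exists_repeat hV (d₀, s₀) k
  refine ⟨A, inferInstance, inferInstance, a₀, V, fun b j => (read b j).1,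
    fun d => ‖prep d d₀‖ ^ 2, hV', fun d => by positivity, sum_normSq_col prep d₀, ?_⟩
  intro K hK hr hR U hU x hx G hG z
  set g := G (gridPoint s N z.1) with hg
  let gap : (Fin n → ZMod (2 * M)) → ℝ := fun d => linearizationGap K (dir x) G
    (gridPoint s N z.1) (gridPoint s N (z.1 + displacement d))
  have hpt : ∀ d, ‖gridPoint s N (z.1 + displacement d)‖ ≤ r / 3 := fun d =>
    (norm_gridPoint_add_le hs z.2 (abs_displacement_le d)).trans hdom
  have hz : ‖gridPoint s N z.1‖ ≤ r / 3 := by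
    have := norm_gridPoint_add_le hs z.2 (M := M) (u := 0) (by simp)
    rw [add_zero] at this
    exact this.trans hdom
  have hgap : ∀ d, 0 ≤ gap d := fun d => hG.gap_nonneg hr₀ hr hz (hpt d)
  set E := ∑ d, ‖prep d d₀‖ ^ 2 * gap d with hE
  have hE₀ : 0 ≤ E := Finset.sum_nonneg fun d _ => mul_nonneg (by positivity) (hgap d)
  let bad : Fin n → (Fin n → ZMod (2 * M)) × Sl → Prop := fun i b =>
    8 / (M : ℝ) < ‖ZMod.stdAddChar (b.1 i) -
      Complex.exp ((2 * Real.pi * (S * s * g i) : ℝ) * Complex.I)‖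
  have hle_one : (∑ b, if ∃ i, k ≤ 2 * (Finset.univ.filter fun j => bad i (read b j)).card then
      ‖V U (x, z) b a₀‖ ^ 2 else 0) ≤ 1 := by
    rw [← sum_normSq_col (V U (x, z)) a₀]
    refine Finset.sum_le_sum fun b _ => ?_
    split_ifs
    · exact le_rfl
    · positivity
  change (∑ b, if ∃ i, k ≤ 2 * (Finset.univ.filter fun j => bad i (read b j)).card then
      ‖V U (x, z) b a₀‖ ^ 2 else 0) ≤ 16 * Real.pi * S / (17 / 125) * E + n * (19 / 20) ^ k
  -- If the mean gap `E` is large, the claimed bound exceeds `1`. Otherwise one coordinate fails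
  -- with probability at most `6/64 + 17/250 + 17/125 < 3/10`, and `(1 + 3 * (3/10)) / 2 = 19/20` is
  -- the Chernoff base.
  by_cases hEc : 17 / 125 < 16 * Real.pi * S * E
  · have : 1 ≤ 16 * Real.pi * S / (17 / 125) * E := by
      rw [div_mul_eq_mul_div, one_le_div (by norm_num)]
      exact hEc.le
    have : (0 : ℝ) ≤ n * (19 / 20) ^ k := by positivity
    linarith
  have hcoord : ∀ i, (∑ b, if bad i b then
      ‖phaseEstimator (fourierGate n (2 * M)) prep (fun d => B U ((x, z), d)) (φ (x, z)) b
        (d₀, s₀)‖ ^ 2 else 0) ≤ 3 / 10 := by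
    intro i
    -- The last sum accounts for `displacement` being centred by `-M`.
    let θ : ℝ := -(2 * Real.pi * S * reach K (dir x) (gridPoint s N z.1)) -
      ∑ j, 2 * Real.pi * (S * s * g j) * M
    have hlin : ∀ d : Fin n → ZMod (2 * M),
        θ + ∑ j, 2 * Real.pi * (S * s * g j) * ((d j).val : ℝ) =
        2 * Real.pi * S * (-reach K (dir x) (gridPoint s N z.1) +
          inner ℝ g (gridPoint s N (z.1 + displacement d) - gridPoint s N z.1)) := by
      intro d
      rw [gridPoint_add_sub, EuclideanSpace.inner_eq_star_dotProduct]
      simp only [θ, dotProduct, Pi.star_apply, star_trivial, displacement]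
      rw [sub_add, ← Finset.sum_sub_distrib, mul_add, Finset.mul_sum, ← sub_neg_eq_add _ (∑ _, _),
        ← Finset.sum_neg_distrib, mul_neg]
      congr 1
      refine Finset.sum_congr rfl fun j _ => ?_
      push_cast
      ring
    have hmain := sum_bad_phaseEstimator_le hM ha₀ ha ha' prep d₀ hprep
      (fun d => B U ((x, z), d)) (φ (x, z)) s₀ θ (fun j => 2 * Real.pi * (S * s * g j))
      (fun d => 2 * (2 * Real.pi * S * δ) ^ 2 + 4 * (2 * Real.pi * S * gap d)) (by
        intro d t ht
        rw [hlin]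
        set q := gridPoint s N (z.1 + displacement d) with hq
        have hreach : reach K (dir x) q ≤ 4 * R / 3 := by
          have h₁ := hpt d
          have := reach_le hr hR hx (d := q) (h₁.trans (by linarith))
          linarith
        have hreach₀ : 0 ≤ reach K (dir x) q :=
          reach_nonneg hr hR hx ((hpt d).trans (by linarith))
        have hstep := F.step_pos
        have hL : 0 ≤ 2 * R / r * (ε + √(n : ℝ) * F.step) := by positivity
        obtain ⟨-, h₁, h₂⟩ := hlo _ U hU ((x, z), d)
          (reach K (dir x) q - 2 * R / r * (ε + √(n : ℝ) * F.step))
          (reach K (dir x) q + 2 * R / r * (ε + √(n : ℝ) * F.step)) (by linarith) (by linarith)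
          (fun τ hτ c hc => membership_on_ray F hK hr₀ hrR hr hR hε hx hG hround (hpt d) hτ hc)
          t ht
        have hlo' : |reach K (dir x) q - lo ((x, z), d) t| ≤ δ := by
          have : 0 ≤ 2 * R / 2 ^ T := by positivity
          rw [abs_le]
          constructor <;> linarith
        refine (normSq_exp_sub_exp_le (A := 2 * Real.pi * S * (reach K (dir x) q -
          lo ((x, z), d) t)) (B := 2 * Real.pi * S * gap d) ?_
          (mul_nonneg (by positivity) (hgap d))).trans ?_
        · simp only [φ, gap, linearizationGap]
          ring
        · have h₃ : (2 * Real.pi * S * (reach K (dir x) q - lo ((x, z), d) t)) ^ 2 ≤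
              (2 * Real.pi * S * δ) ^ 2 := by
            rw [mul_pow, mul_pow _ δ]
            refine mul_le_mul_of_nonneg_left ?_ (by positivity)
            exact sq_le_sq' (abs_le.1 hlo').1 (abs_le.1 hlo').2
          linarith) i
    refine hmain.trans ?_
    have hsum : ∑ d, ‖prep d d₀‖ ^ 2 *
        (2 * (2 * Real.pi * S * δ) ^ 2 + 4 * (2 * Real.pi * S * gap d)) =
        2 * (2 * Real.pi * S * δ) ^ 2 + 8 * Real.pi * S * E := by
      simp only [mul_add, Finset.sum_add_distrib, ← Finset.sum_mul, sum_normSq_col, one_mul]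
      rw [hE, Finset.mul_sum]
      congr 1
      exact Finset.sum_congr rfl fun d _ => by ring
    rw [hsum]
    linarith
  have hunion : (∑ b, if ∃ i, k ≤ 2 * (Finset.univ.filter fun j => bad i (read b j)).card then
      ‖V U (x, z) b a₀‖ ^ 2 else 0) ≤ ∑ i, ∑ b,
      if k ≤ 2 * (Finset.univ.filter fun j => bad i (read b j)).card then
        ‖V U (x, z) b a₀‖ ^ 2 else 0 := by
    rw [Finset.sum_comm]
    refine Finset.sum_le_sum fun b _ => ?_
    have hnn : ∀ i, 0 ≤ if k ≤ 2 * (Finset.univ.filter fun j => bad i (read b j)).card then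
        ‖V U (x, z) b a₀‖ ^ 2 else 0 := fun i => by split_ifs <;> positivity
    split_ifs with h
    · obtain ⟨i, hi⟩ := h
      refine le_trans (le_of_eq ?_)
        (Finset.single_le_sum (fun i _ => hnn i) (Finset.mem_univ i))
      rw [if_pos hi]
    · exact Finset.sum_nonneg fun i _ => hnn i
  refine hunion.trans ?_
  have hi : ∀ i, (∑ b, if k ≤ 2 * (Finset.univ.filter fun j => bad i (read b j)).card then
        ‖V U (x, z) b a₀‖ ^ 2 else 0) ≤ (19 / 20) ^ k := by
    intro i
    have h₁ := sum_majority_bad_le (fun b => ‖phaseEstimator (fourierGate n (2 * M)) prep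
      (fun d => B U ((x, z), d)) (φ (x, z)) b (d₀, s₀)‖ ^ 2) (fun b => ‖V U (x, z) b a₀‖ ^ 2) read
      (fun b => by positivity) (hrep U (x, z)) (sum_normSq_col _ _) (bad i)
    refine h₁.trans (pow_le_pow_left₀ ?_ ?_ k)
    · have : 0 ≤ ∑ b, if bad i b then ‖phaseEstimator (fourierGate n (2 * M)) prep
          (fun d => B U ((x, z), d)) (φ (x, z)) b (d₀, s₀)‖ ^ 2 else 0 :=
        Finset.sum_nonneg fun b _ => by split_ifs <;> positivity
      linarith
    · have := hcoord i
      linarith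
  have h₂ : ∑ _i : Fin n, ((19 / 20 : ℝ)) ^ k = n * (19 / 20) ^ k := by simp
  have h₃ : 0 ≤ 16 * Real.pi * S / (17 / 125) * E := by positivity
  have h₄ := Finset.sum_le_sum fun i (_ : i ∈ Finset.univ) => hi i
  linarith

end Gradient

/-! ### Averaging over the base point -/

section Average

variable {n : ℕ}

open scoped Classical in
/-- With high probability, the outcome is close to a supporting functional at some point near the
origin. -/
theorem exists_gradient_estimation {X W : Type} [Fintype X] [DecidableEq X] [Fintype W]
    [DecidableEq W] (dir : X → EuclideanSpace ℝ (Fin n)) (F : FixedPointFormat) (w₀ : W)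
    {r R ε s δ S ρ : ℝ} {M N T k : ℕ} (hr₀ : 0 < r) (hrR : r ≤ R)
    (hε : 0 ≤ ε) (hF : 2 * R ≤ 2 ^ F.bits * F.step) (hM : 16 ≤ M) (hN : 0 < N) (hs : 0 < s)
    (hS : 0 < S) (hdom : √(n : ℝ) * (s * (N / 2 + M)) ≤ r / 3)
    (hδ : 2 * R / r * (ε + √(n : ℝ) * F.step) + 2 * R / 2 ^ T ≤ δ)
    (hphase : 4 * (2 * Real.pi * S * δ) ^ 2 ≤ 17 / 250)
    (hwrap : S * s * (2 * R / r) ≤ 1 / 4)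
    (hgap : 16 * Real.pi * S / (17 / 125) *
      (2 * (2 * R / r * (√(n : ℝ) * (s * M))) * (n * M) / N) ≤ ρ / 2)
    (hk : n * (19 / 20 : ℝ) ^ k ≤ ρ / 2) :
    ∃ (A : Type) (_ : Fintype A) (_ : DecidableEq A) (a₀ : A)
      (V : UnitaryOn (F.Vec n × Bool × W) → X → UnitaryOn A)
      (out : A → EuclideanSpace ℝ (Fin n)), CtrlImplements (k * (2 * T)) V ∧
      ∀ (K : Set (EuclideanSpace ℝ (Fin n))), Convex ℝ K → Metric.closedBall 0 r ⊆ K →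
        K ⊆ Metric.closedBall 0 R → ∀ U, IsMEM F w₀ K ε 0 U → ∀ x, ‖dir x‖ = 1 →
        ∀ G, IsSlope K r R (dir x) G →
        1 - ρ ≤ ∑ a, if ∃ z, ‖z‖ ≤ √(n : ℝ) * (s * (N / 2)) ∧
          ‖out a - G z‖ ≤ √(n : ℝ) * (2 / (M * (S * s))) then ‖V U x a a₀‖ ^ 2 else 0 := by
  have hM₀ : 0 < M := by omega
  have hM' : (0 : ℝ) < M := by exact_mod_cast hM₀
  have : NeZero (2 * M) := ⟨by omega⟩
  obtain ⟨A, _, _, a₀, V, read, wgt, hV, hwgt, hwgt₁, hfail⟩ := exists_repeated_estimation dir F w₀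
    k hr₀ hrR hε hF hM₀ hs.le hS hdom hδ hphase
  obtain ⟨med, hmed⟩ := exists_robust_center k
  have hNn : (0 : ℝ) < (N : ℝ) ^ n := by positivity
  have hcard : Fintype.card (gridBox n N) = N ^ n := by
    rw [Fintype.card_coe, card_gridBox]
  let z₀ : gridBox n N := ⟨0, by
    rw [Fintype.mem_piFinset]
    intro i
    simpa using hN⟩
  -- The uniform superposition over base points. It controls all `k` repetitions, so they estimate
  -- the same `G z` and their median is meaningful.
  obtain ⟨prep, hprep⟩ := exists_unitary_col
    (fun _ : gridBox n N => (((√((N : ℝ) ^ n))⁻¹ : ℝ) : ℂ)) (by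
      simp only [Complex.norm_real, norm_inv, inv_pow, Real.norm_eq_abs, sq_abs,
        Real.sq_sqrt hNn.le, Finset.sum_const, Finset.card_univ, hcard]
      rw [nsmul_eq_mul, Nat.cast_pow, mul_inv_cancel₀ hNn.ne']) z₀
  have hprep' : ∀ z, ‖prep z z₀‖ ^ 2 = ((N : ℝ) ^ n)⁻¹ := by
    intro z
    rw [hprep, Complex.norm_real, norm_inv, inv_pow, Real.norm_eq_abs, sq_abs,
      Real.sq_sqrt hNn.le]
  let val : ZMod (2 * M) → ℝ := fun c => (c.valMinAbs : ℝ) / (2 * M) / (S * s)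
  refine ⟨gridBox n N × A, inferInstance, inferInstance, (z₀, a₀),
    fun U x => ctrl (fun z => V U (x, z)) * onFirst A prep,
    fun b => WithLp.toLp 2 fun i => med fun j => val (read b.2 j i),
    (hV.ctrl.mul (CtrlImplements.const _)).mono le_rfl, ?_⟩
  intro K hK hr hR U hU x hx G hG
  let bad : gridBox n N → A → Prop := fun z a => ∃ i, k ≤ 2 * (Finset.univ.filter fun j =>
    8 / (M : ℝ) < ‖ZMod.stdAddChar (read a j i) - Complex.exp
      ((2 * Real.pi * (S * s * G (gridPoint s N z.1) i) : ℝ) * Complex.I)‖).card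
  have hgood : ∀ z a, ¬ bad z a →
      ‖(WithLp.toLp 2 fun i => med fun j => val (read a j i) : EuclideanSpace ℝ (Fin n)) -
        G (gridPoint s N z.1)‖ ≤ √(n : ℝ) * (2 / (M * (S * s))) := by
    intro z a hza
    refine norm_le_sqrt_mul (by positivity) fun i => ?_
    refine hmed _ (G (gridPoint s N z.1) i) _ ?_
    have h₁ : ¬ k ≤ 2 * (Finset.univ.filter fun j =>
        8 / (M : ℝ) < ‖ZMod.stdAddChar (read a j i) - Complex.exp
          ((2 * Real.pi * (S * s * G (gridPoint s N z.1) i) : ℝ) * Complex.I)‖).card :=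
      fun h => hza ⟨i, h⟩
    refine lt_of_le_of_lt ?_ (not_le.1 h₁)
    refine Nat.mul_le_mul_left 2 (Finset.card_le_card fun j hj => ?_)
    simp only [Finset.mem_filter, Finset.mem_univ, true_and] at hj ⊢
    by_contra hlt
    refine hj ?_
    have hz : ‖gridPoint s N z.1‖ ≤ r / 3 := by
      have := norm_gridPoint_add_le hs.le z.2 (M := M) (u := 0) (by simp)
      rw [add_zero] at this
      exact this.trans hdom
    have hgi : |G (gridPoint s N z.1) i| ≤ 2 * R / r :=
      (PiLp.norm_apply_le (G (gridPoint s N z.1)) i).trans (hG _ hz).2.1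
    have hSs : 0 < S * s := by positivity
    have hφ : |S * s * G (gridPoint s N z.1) i| ≤ 1 / 4 := by
      rw [abs_mul, abs_of_pos hSs]
      exact (mul_le_mul_of_nonneg_left hgi hSs.le).trans hwrap
    have h₂ := abs_valMinAbs_div_sub_le hM (read a j i) hφ (not_lt.1 hlt)
    have h₃ : val (read a j i) - G (gridPoint s N z.1) i =
        (((read a j i).valMinAbs : ℝ) / (2 * M) - S * s * G (gridPoint s N z.1) i) / (S * s) := by
      simp only [val]
      field_simp
    rw [h₃, abs_div, abs_of_pos hSs, div_le_iff₀ hSs]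
    refine h₂.trans (le_of_eq ?_)
    field_simp
  have hzdom : ∀ z : gridBox n N, ‖gridPoint s N z.1‖ ≤ √(n : ℝ) * (s * (N / 2)) := fun z =>
    norm_gridPoint_le hs.le z.2
  have hent : ∀ z a, ‖(ctrl (fun z => V U (x, z)) * onFirst A prep) (z, a) (z₀, a₀)‖ ^ 2 =
      ((N : ℝ) ^ n)⁻¹ * ‖V U (x, z) a a₀‖ ^ 2 := by
    intro z a
    rw [ctrl_mul_onFirst_apply, norm_mul, mul_pow, hprep']
  have hbadsum : ∑ z, ((N : ℝ) ^ n)⁻¹ * ∑ a, (if bad z a then ‖V U (x, z) a a₀‖ ^ 2 else 0) ≤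
      ρ := by
    have h₁ := fun z => hfail K hK hr hR U hU x hx G hG z
    -- The weights of the displacements do not depend on `z`, so the sums can be exchanged and the
    -- gap averaged over `z` for each displacement.
    have h₂ : ∑ z : gridBox n N, ((N : ℝ) ^ n)⁻¹ * (16 * Real.pi * S / (17 / 125) *
        (∑ d, wgt d * linearizationGap K (dir x) G (gridPoint s N z.1)
          (gridPoint s N (z.1 + displacement d))) + n * (19 / 20) ^ k) ≤ ρ := by
      rw [← Finset.mul_sum, Finset.sum_add_distrib, ← Finset.mul_sum, Finset.sum_const,
        Finset.card_univ, hcard, Finset.sum_comm]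
      simp only [← Finset.mul_sum]
      have h₃ : ∀ d : Fin n → ZMod (2 * M), (∑ z : gridBox n N, linearizationGap K (dir x) G
          (gridPoint s N z.1) (gridPoint s N (z.1 + displacement d))) ≤
          2 * (2 * R / r * (√(n : ℝ) * (s * M))) * (n * M) / N * (N : ℝ) ^ n := by
        intro d
        have := hG.sum_gap_le hr₀ (hr₀.le.trans hrR) hr hs.le hN hdom (abs_displacement_le d)
        rw [div_le_iff₀ hNn] at this
        refine le_trans (le_of_eq ?_) this
        exact Finset.sum_coe_sort (gridBox n N) (fun w => linearizationGap K (dir x) G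
          (gridPoint s N w) (gridPoint s N (w + displacement d)))
      have h₄ : ∑ d, wgt d * (∑ z : gridBox n N, linearizationGap K (dir x) G
          (gridPoint s N z.1) (gridPoint s N (z.1 + displacement d))) ≤
          2 * (2 * R / r * (√(n : ℝ) * (s * M))) * (n * M) / N * (N : ℝ) ^ n := by
        refine (Finset.sum_le_sum fun d _ =>
          mul_le_mul_of_nonneg_left (h₃ d) (hwgt d)).trans (le_of_eq ?_)
        rw [← Finset.sum_mul, hwgt₁, one_mul]
      have hC : 0 ≤ 16 * Real.pi * S / (17 / 125) := by positivity
      have h₅ := mul_le_mul_of_nonneg_left h₄ hC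
      rw [inv_mul_le_iff₀ hNn, nsmul_eq_mul, Nat.cast_pow]
      have h₆ := mul_le_mul_of_nonneg_right hgap hNn.le
      have h₇ := mul_le_mul_of_nonneg_right hk hNn.le
      linarith
    refine le_trans (Finset.sum_le_sum fun z _ => ?_) h₂
    exact mul_le_mul_of_nonneg_left (h₁ z) (by positivity)
  have htot : ∑ z : gridBox n N, ((N : ℝ) ^ n)⁻¹ * ∑ a, ‖V U (x, z) a a₀‖ ^ 2 = 1 := by
    simp only [sum_normSq_col, mul_one, Finset.sum_const, Finset.card_univ, hcard]
    rw [nsmul_eq_mul, Nat.cast_pow, mul_inv_cancel₀ hNn.ne']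
  have hsub : 1 - ρ ≤ ∑ z : gridBox n N, ((N : ℝ) ^ n)⁻¹ *
      ∑ a, (if bad z a then 0 else ‖V U (x, z) a a₀‖ ^ 2) := by
    have : ∀ z, ∑ a, (if bad z a then 0 else ‖V U (x, z) a a₀‖ ^ 2) =
        ∑ a, ‖V U (x, z) a a₀‖ ^ 2 - ∑ a, (if bad z a then ‖V U (x, z) a a₀‖ ^ 2 else 0) := by
      intro z
      rw [← Finset.sum_sub_distrib]
      exact Finset.sum_congr rfl fun a _ => by split_ifs <;> simp
    simp only [this, mul_sub, Finset.sum_sub_distrib]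
    rw [htot]
    linarith
  refine hsub.trans ?_
  rw [Fintype.sum_prod_type]
  refine Finset.sum_le_sum fun z _ => ?_
  rw [Finset.mul_sum]
  refine Finset.sum_le_sum fun a _ => ?_
  rw [hent]
  by_cases hza : bad z a
  · rw [if_pos hza, mul_zero]
    split_ifs <;> positivity
  · rw [if_neg hza, if_pos ⟨gridPoint s N z.1, hzdom z, hgood z a hza⟩]

end Average

/-! ### The separation algorithm -/

section Separation

variable {n : ℕ}

theorem inner_normalize_le {v h x y : EuclideanSpace ℝ (Fin n)} {c η : ℝ} (hc : 0 < c)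
    (hv : v = c • h) (hh : h ≠ 0) (hle : inner ℝ h x ≤ inner ℝ h y + η * ‖h‖) :
    inner ℝ (‖v‖⁻¹ • v) x ≤ inner ℝ (‖v‖⁻¹ • v) y + η := by
  have hn : 0 < ‖h‖ := norm_pos_iff.2 hh
  have h₁ : ‖v‖⁻¹ • v = ‖h‖⁻¹ • h := by
    rw [hv, norm_smul, Real.norm_eq_abs, abs_of_pos hc, smul_smul]
    congr 1
    field_simp
  rw [h₁, real_inner_smul_left, real_inner_smul_left]
  calc ‖h‖⁻¹ * inner ℝ h x ≤ ‖h‖⁻¹ * (inner ℝ h y + η * ‖h‖) :=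
        mul_le_mul_of_nonneg_left hle (by positivity)
    _ = ‖h‖⁻¹ * inner ℝ h y + η := by
        rw [mul_add, mul_left_comm, inv_mul_cancel₀ hn.ne', mul_one]

/-- A rounded approximate supporting functional yields a correct separation answer. -/
theorem IsSlope.rounded_separates {K : Set (EuclideanSpace ℝ (Fin n))} {r R e η : ℝ}
    {p : EuclideanSpace ℝ (Fin n)} {G : EuclideanSpace ℝ (Fin n) → EuclideanSpace ℝ (Fin n)}
    (hG : IsSlope K r R p G) (hK : Convex ℝ K) (hr₀ : 0 < r) (hrR : r ≤ R)
    (hr : Metric.closedBall 0 r ⊆ K) (hR : K ⊆ Metric.closedBall 0 R) (hp : ‖p‖ = 1)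
    {y : EuclideanSpace ℝ (Fin n)} (hy : y = ‖y‖ • p) (hyR : ‖y‖ ≤ R) (he : 0 ≤ e)
    (hη : 0 < η) (hηR : η ≤ R) (hye : y ∉ innerParallel K e) {z : EuclideanSpace ℝ (Fin n)}
    (hz : ‖z‖ ≤ r / 3) (hez : 2 * R / r * e + 2 * (2 * R / r) * ‖z‖ ≤ 7 / 10 * η)
    {u v : EuclideanSpace ℝ (Fin n)} (hu : ‖u - G z‖ ≤ 2 / 5 * (η / R))
    (hv : ‖v - (R / (2 * ‖u‖)) • u‖ ≤ η / 100) :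
    ‖‖v‖⁻¹ • v‖ = 1 ∧
      ∀ x ∈ innerParallel K η, inner ℝ (‖v‖⁻¹ • v) x ≤ inner ℝ (‖v‖⁻¹ • v) y + η := by
  have hR₀ : 0 < R := hr₀.trans_le hrR
  obtain ⟨h₁, -, -⟩ := hG z hz
  -- This turns absolute errors into relative ones.
  have hg1 : 1 ≤ ‖G z‖ := by
    have := real_inner_le_norm (G z) p
    rwa [h₁, hp, mul_one] at this
  have hηR' : η / R ≤ 1 := (div_le_one hR₀).2 hηR
  have hu1 : ‖u‖ ≤ ‖G z‖ + 2 / 5 * (η / R) := by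
    have := norm_sub_norm_le u (G z)
    linarith
  have hu0 : 3 / 5 ≤ ‖u‖ := by
    have := norm_sub_norm_le (G z) u
    rw [norm_sub_rev] at this
    linarith
  have hu0' : 0 < ‖u‖ := by linarith
  set c := R / (2 * ‖u‖) with hc
  have hc0 : 0 < c := by positivity
  set h := c⁻¹ • v with hh
  have hvh : v = c • h := by rw [hh, smul_smul, mul_inv_cancel₀ hc0.ne', one_smul]
  have hhu : ‖h - u‖ ≤ (η / 100) * (2 * ‖u‖ / R) := by
    have h₂ : h - u = c⁻¹ • (v - c • u) := by
      rw [smul_sub, smul_smul, inv_mul_cancel₀ hc0.ne', one_smul]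
    rw [h₂, norm_smul, norm_inv, Real.norm_eq_abs, abs_of_pos hc0, hc, inv_div, mul_comm]
    exact mul_le_mul_of_nonneg_right hv (by positivity)
  have hhu' : ‖h - u‖ ≤ 1 / 50 * (η / R) * ‖u‖ := by
    refine hhu.trans (le_of_eq ?_)
    ring
  have hηR₀ : 0 ≤ η / R := by positivity
  have hh0 : h ≠ 0 := by
    intro h0
    rw [h0, zero_sub, norm_neg] at hhu'
    nlinarith
  have hv0 : v ≠ 0 := by
    rw [hvh]
    exact smul_ne_zero hc0.ne' hh0
  refine ⟨?_, fun x hx => inner_normalize_le hc0 hvh hh0 ?_⟩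
  · rw [norm_smul, norm_inv, norm_norm, inv_mul_cancel₀ (norm_ne_zero_iff.2 hv0)]
  refine hG.separates hK hr₀ hrR hr hR hp hy hyR he hη hye hz ?_ hx
  have h₂ : ‖h - G z‖ ≤ (η / R) * (2 / 5 + 1 / 50 * (7 / 5 * ‖G z‖)) := by
    have h₃ : h - G z = (h - u) + (u - G z) := by abel
    have h₄ : ‖u‖ ≤ 7 / 5 * ‖G z‖ := by linarith
    rw [h₃]
    refine (norm_add_le _ _).trans ?_
    have := mul_le_mul_of_nonneg_left h₄ (show 0 ≤ 1 / 50 * (η / R) by positivity)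
    linarith
  -- Together with the offset `7/10 * η` this is at most `(1.9 + 0.084 * ‖G z‖) * η`, which is below
  -- `2 * η * ‖G z‖` as `‖G z‖ ≥ 1`.
  have h₃ : (2 * R + η) * ‖h - G z‖ ≤ 3 * η * (2 / 5 + 1 / 50 * (7 / 5 * ‖G z‖)) := by
    calc (2 * R + η) * ‖h - G z‖
        ≤ (3 * R) * ((η / R) * (2 / 5 + 1 / 50 * (7 / 5 * ‖G z‖))) :=
          mul_le_mul (by linarith) h₂ (norm_nonneg _) (by positivity)
      _ = _ := by field_simp
  nlinarith

/-- The separation algorithm, for parameters that satisfy the requirements of its analysis. -/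
theorem exists_separation_algorithm (F H : FixedPointFormat) {W : Type} [Fintype W]
    [DecidableEq W] (w₀ : W) {r R ε η s δ S ρ : ℝ} {M N T k : ℕ} (hr₀ : 0 < r) (hrR : r ≤ R)
    (hη : 0 < η) (hηR : η ≤ R) (hε : 0 ≤ ε) (hρ : 0 ≤ ρ) (hF : 2 * R ≤ 2 ^ F.bits * F.step)
    (hH : 2 * R ≤ 2 ^ H.bits * H.step) (hH' : √(n : ℝ) * H.step ≤ η / 100)
    (hM : 16 ≤ M) (hN : 0 < N) (hs : 0 < s) (hS : 0 < S)
    (hdom : √(n : ℝ) * (s * (N / 2 + M)) ≤ r / 3)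
    (hδ : 2 * R / r * (ε + √(n : ℝ) * F.step) + 2 * R / 2 ^ T ≤ δ)
    (hphase : 4 * (2 * Real.pi * S * δ) ^ 2 ≤ 17 / 250)
    (hwrap : S * s * (2 * R / r) ≤ 1 / 4)
    (hgap : 16 * Real.pi * S / (17 / 125) *
      (2 * (2 * R / r * (√(n : ℝ) * (s * M))) * (n * M) / N) ≤ ρ / 2)
    (hk : n * (19 / 20 : ℝ) ^ k ≤ ρ / 2)
    (hacc : √(n : ℝ) * (2 / (M * (S * s))) ≤ 2 / 5 * (η / R))
    (hεr : ε + √(n : ℝ) * F.step ≤ r) (hεη : ε + √(n : ℝ) * F.step ≤ η)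
    (hoff : 2 * R / r * (ε + √(n : ℝ) * F.step) +
      2 * (2 * R / r) * (√(n : ℝ) * (s * (N / 2))) ≤ 7 / 10 * η) :
    ∃ (A : Type) (_ : Fintype A) (_ : DecidableEq A) (a₀ : A)
      (𝒜 : QueryAlgorithm (H.Vec n × (Bool × H.Vec n) × A × (F.Vec n × Bool × W))),
      𝒜.queries ≤ 1 + k * (2 * T) ∧ ∀ K : Set (EuclideanSpace ℝ (Fin n)), Convex ℝ K →
        Metric.closedBall 0 r ⊆ K → K ⊆ Metric.closedBall 0 R →
        ∀ U : Matrix.unitaryGroup (F.Vec n × Bool × W) ℂ, IsMEM F w₀ K ε 0 U →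
          IsSEP H (a₀, (F.zeroBits n, false, w₀)) K η ρ
            (𝒜.run (onSecond (H.Vec n) (onSecond (Bool × H.Vec n) (onSecond A U)))) := by
  classical
  have hR₀ : 0 < R := hr₀.trans_le hrR
  have hstep := F.step_pos
  obtain ⟨roundF, hroundF⟩ := F.exists_rounding hF n
  obtain ⟨roundH, hroundH⟩ := H.exists_rounding hH n
  obtain ⟨A, _, _, a₀, V, out, hV, hout⟩ := exists_gradient_estimation
    (fun x : H.Vec n => ‖H.decode x‖⁻¹ • H.decode x) F w₀ hr₀ hrR hε hF hM hN hs hS hdom hδ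
    hphase hwrap hgap hk
  let ask : UnitaryOn (F.Vec n × Bool × W) → H.Vec n → UnitaryOn (F.Vec n × Bool × W) :=
    fun U x => U * permGate ((Equiv.swap (F.zeroBits n) (roundF (H.decode x))).prodCongr
      (Equiv.refl _))
  have hask : CtrlImplements (1 + 0) ask := CtrlImplements.blackBox.mul (CtrlImplements.const _)
  have hall := (hask.onFirst A).mul (hV.onSecond (F.Vec n × Bool × W))
  -- Outside the ball the query is its own normal. The estimated normal is rescaled to length `R /
  -- 2`, so that it fits the format and loses little by rounding.
  let ans : H.Vec n → (F.Vec n × Bool × W) × A → Bool × H.Vec n := fun x b =>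
    if R < ‖H.decode x‖ then (false, x)
    else if b.1.2.1 = true then (true, H.zeroBits n)
    else (false, roundH ((R / (2 * ‖out b.2‖)) • out b.2))
  obtain ⟨𝒜, hq, h𝒜⟩ := exists_relationalOracle hall ans (false, H.zeroBits n)
    ((F.zeroBits n, false, w₀), a₀) (F.zeroBits n, false, w₀)
  refine ⟨_, inferInstance, inferInstance, _, 𝒜, hq, fun K hK hr hR U hU => h𝒜 _ ρ U fun x => ?_⟩
  set y := H.decode x with hy
  set m₀ : F.Vec n × Bool × W := (F.zeroBits n, false, w₀) with hm₀
  by_cases hyR : R < ‖y‖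
  · have hgood : ∀ b : (F.Vec n × Bool × W) × A, ans x b ∈ sepAnswers H K η y := by
      intro b
      have hans : ans x b = (false, x) := if_pos hyR
      rw [hans]
      have hy0 : y ≠ 0 := by
        rintro h
        rw [h, norm_zero] at hyR
        linarith
      refine Or.inr ⟨rfl, fun h => ?_, _, rfl, ?_, fun z hz => ?_⟩
      · have : ‖y‖ ≤ R := by simpa using hR (h (Metric.mem_closedBall_self hη.le))
        linarith
      · rw [norm_smul, norm_inv, norm_norm, inv_mul_cancel₀ (norm_ne_zero_iff.2 hy0)]
      · refine inner_normalize_le one_pos (one_smul _ _).symm hy0 ?_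
        have hzR : ‖z‖ ≤ R := by simpa using hR (hz (Metric.mem_closedBall_self hη.le))
        have h₁ := real_inner_le_norm y z
        change inner ℝ y z ≤ inner ℝ y y + η * ‖y‖
        rw [real_inner_self_eq_norm_sq]
        nlinarith [norm_nonneg y]
    have h₁ := sum_normSq_col (onFirst A (ask U x) * onSecond (F.Vec n × Bool × W) (V U x))
      (m₀, a₀)
    have h₂ : ∀ b, {b | ans x b ∈ sepAnswers H K η y}.indicator (fun b =>
        ‖(onFirst A (ask U x) * onSecond (F.Vec n × Bool × W) (V U x)) b (m₀, a₀)‖ ^ 2) b =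
        ‖(onFirst A (ask U x) * onSecond (F.Vec n × Bool × W) (V U x)) b (m₀, a₀)‖ ^ 2 :=
      fun b => Set.indicator_of_mem (s := {b | ans x b ∈ sepAnswers H K η y}) (hgood b) _
    rw [Finset.sum_congr rfl fun b _ => h₂ b, h₁]
    linarith
  rw [not_lt] at hyR
  have hask_ne : ∀ m, ask U x m m₀ ≠ 0 → m.2.1 ∈ memAnswers K ε (F.decode (roundF y)) := by
    rintro ⟨q, c, w⟩ hne
    simp only [ask, hm₀, mul_permGate_apply, Equiv.prodCongr_apply, Prod.map,
      Equiv.swap_apply_left, Equiv.refl_apply] at hne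
    exact (hU.mem_of_ne_zero hne).2
  have hnear : ‖y - F.decode (roundF y)‖ ≤ √(n : ℝ) * F.step := by
    rw [norm_sub_rev]
    exact hroundF y hyR
  have he : 0 ≤ ε + √(n : ℝ) * F.step := by positivity
  obtain ⟨good, hgood₁, hgood₂⟩ : ∃ good : A → Prop,
      (1 - ρ ≤ ∑ a, if good a then ‖V U x a a₀‖ ^ 2 else 0) ∧
      ∀ a, good a → y ∉ innerParallel K (ε + √(n : ℝ) * F.step) →
        (false, roundH ((R / (2 * ‖out a‖)) • out a)) ∈ sepAnswers H K η y := by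
    -- Deep inside `K` the answer `false` has amplitude zero, so nothing is required of the
    -- estimate. This case covers `y = 0`, where there is no direction.
    by_cases hyin : y ∈ innerParallel K (ε + √(n : ℝ) * F.step)
    · refine ⟨fun _ => True, ?_, fun a _ h => (h hyin).elim⟩
      simp only [if_true, sum_normSq_col]
      linarith
    · have hy0 : y ≠ 0 := by
        intro h
        refine hyin ?_
        rw [h]
        exact (Metric.closedBall_subset_closedBall hεr).trans hr
      have hyn : ‖y‖ ≠ 0 := norm_ne_zero_iff.2 hy0
      have hp : ‖‖y‖⁻¹ • y‖ = 1 := by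
        rw [norm_smul, norm_inv, norm_norm, inv_mul_cancel₀ hyn]
      obtain ⟨G, hG⟩ := exists_isSlope hK hr₀ hrR hr hR hp
      refine ⟨_, hout K hK hr hR U hU x hp G hG, ?_⟩
      rintro a ⟨z, hz, hza⟩ -
      have hzr : ‖z‖ ≤ r / 3 := by
        refine hz.trans (le_trans ?_ hdom)
        have : (0 : ℝ) ≤ M := Nat.cast_nonneg _
        gcongr
        linarith
      have hza' := hza.trans hacc
      have hround : ‖H.decode (roundH ((R / (2 * ‖out a‖)) • out a)) -
          (R / (2 * ‖out a‖)) • out a‖ ≤ η / 100 := by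
        refine (hroundH _ ?_).trans hH'
        rw [norm_smul, Real.norm_eq_abs, abs_of_nonneg (by positivity)]
        by_cases h0 : ‖out a‖ = 0
        · rw [h0, mul_zero]; exact hR₀.le
        · have : R / (2 * ‖out a‖) * ‖out a‖ = R / 2 := by field_simp
          linarith
      have hez : 2 * R / r * (ε + √(n : ℝ) * F.step) + 2 * (2 * R / r) * ‖z‖ ≤ 7 / 10 * η := by
        refine le_trans ?_ hoff
        gcongr
      obtain ⟨h₁, h₂⟩ := hG.rounded_separates hK hr₀ hrR hr hR hp (y := y)
        (by rw [smul_smul, mul_inv_cancel₀ hyn, one_smul]) hyR he hη hηR hyin hzr hez hza' hround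
      exact Or.inr ⟨rfl, fun h => hyin (innerParallel_anti hεη h), _, rfl, h₁, h₂⟩
  have hfinal : ∀ b : (F.Vec n × Bool × W) × A,
      ‖ask U x b.1 m₀‖ ^ 2 * (if good b.2 then ‖V U x b.2 a₀‖ ^ 2 else 0) ≤
      {b | ans x b ∈ sepAnswers H K η y}.indicator (fun b =>
        ‖(onFirst A (ask U x) * onSecond (F.Vec n × Bool × W) (V U x)) b (m₀, a₀)‖ ^ 2) b := by
    rintro ⟨m, a⟩
    by_cases hm : ask U x m m₀ = 0
    · simp only [hm, norm_zero]
      rw [zero_pow two_ne_zero, zero_mul]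
      exact Set.indicator_nonneg (fun _ _ => by positivity) _
    by_cases ha : good a
    · have hmem : ((m, a) : (F.Vec n × Bool × W) × A) ∈ {b | ans x b ∈ sepAnswers H K η y} := by
        change ans x (m, a) ∈ sepAnswers H K η y
        simp only [ans]
        rw [if_neg (not_lt.2 hyR)]
        have hc := hask_ne m hm
        by_cases hmt : m.2.1 = true
        · rw [if_pos hmt]
          rcases hc with ⟨-, hc⟩ | ⟨hc, -⟩
          · exact Or.inl ⟨rfl, outerParallel_mono hεη (mem_outerParallel_add hc hnear)⟩
          · simp [hmt] at hc
        · rw [if_neg hmt]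
          rcases hc with ⟨hc, -⟩ | ⟨-, hc⟩
          · exact (hmt hc).elim
          · exact hgood₂ a ha (notMem_innerParallel_add hc hnear)
      rw [Set.indicator_of_mem hmem, onFirst_mul_onSecond_apply, norm_mul, mul_pow, if_pos ha]
    · rw [if_neg ha, mul_zero]
      exact Set.indicator_nonneg (fun _ _ => by positivity) _
  refine le_trans ?_ (Finset.sum_le_sum fun b _ => hfinal b)
  rw [Fintype.sum_prod_type]
  simp only [← Finset.mul_sum, ← Finset.sum_mul, sum_normSq_col, one_mul]
  exact hgood₁

end Separation

/-! ### Choice of the parameters -/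

section Parameters

/-- Here `q` stands for `√n`. The half-side `c` of the base cube is limited by the offset of `z`
allowed in `IsSlope.separates`, and the displacement range `b = s * M` by the mean gap relative to
`c`. The required accuracy then fixes `S * b = 5 * R * q / η`, hence `S`, and `M` is taken large
enough that frequencies stay within a quarter period. -/
theorem exists_grid_parameters {q r R η ρ S : ℝ} (hq : 1 ≤ q) (hr₀ : 0 < r) (hrR : r ≤ R)
    (hη : 0 < η) (hηR : η ≤ R) (hρ : 0 < ρ) (hρ₁ : ρ ≤ 1)
    (hS : S = 250000 * R ^ 4 * q ^ 6 / (ρ * η ^ 3 * r ^ 2)) :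
    ∃ (s : ℝ) (M N : ℕ), 0 < s ∧ 16 ≤ M ∧ 0 < N ∧ q * (s * (N / 2 + M)) ≤ r / 3 ∧
      S * s * (2 * R / r) ≤ 1 / 4 ∧
      16 * Real.pi * S / (17 / 125) * (2 * (2 * R / r * (q * (s * M))) * (q ^ 2 * M) / N) ≤ ρ / 2 ∧
      q * (2 / (M * (S * s))) ≤ 2 / 5 * (η / R) ∧
      2 * (2 * R / r) * (q * (s * (N / 2))) ≤ 61 / 100 * η := by
  have hR₀ : 0 < R := hr₀.trans_le hrR
  have hq₀ : 0 < q := one_pos.trans_le hq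
  have hS₀ : 0 < S := by rw [hS]; positivity
  obtain ⟨b, hb⟩ : ∃ b, b = ρ * η ^ 2 * r ^ 2 / (50000 * R ^ 3 * q ^ 5) := ⟨_, rfl⟩
  obtain ⟨c, hc⟩ : ∃ c, c = 3 / 20 * η * r / (R * q) := ⟨_, rfl⟩
  have hb₀ : 0 < b := by rw [hb]; positivity
  have hc₀ : 0 < c := by rw [hc]; positivity
  obtain ⟨M, hM⟩ := exists_nat_ge (40 * R ^ 2 * q / (η * r))
  have hM40 : 40 ≤ (M : ℝ) := by
    refine le_trans ?_ hM
    rw [le_div_iff₀ (by positivity)]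
    have h₁ : η * r ≤ R ^ 2 := by rw [sq]; exact mul_le_mul hηR hrR hr₀.le hR₀.le
    have h₂ : R ^ 2 ≤ R ^ 2 * q := le_mul_of_one_le_right (by positivity) hq
    linarith
  have hM₀ : (0 : ℝ) < M := by linarith
  obtain ⟨s, hs⟩ : ∃ s, s = b / M := ⟨_, rfl⟩
  have hs₀ : 0 < s := by rw [hs]; positivity
  have hsM : s * M = b := by rw [hs]; field_simp
  have hsb : s ≤ b := by
    rw [hs]
    exact div_le_self hb₀.le (by linarith)
  obtain ⟨N, hN⟩ : ∃ N : ℕ, N = ⌈2 * c / s⌉₊ := ⟨_, rfl⟩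
  have hN₁ : 2 * c ≤ s * N := by
    have := Nat.le_ceil (2 * c / s)
    rw [← hN, div_le_iff₀ hs₀] at this
    linarith
  have hN₂ : s * N ≤ 2 * c + b := by
    have := (Nat.ceil_lt_add_one (show 0 ≤ 2 * c / s by positivity)).le
    rw [← hN] at this
    have h₁ := mul_le_mul_of_nonneg_left this hs₀.le
    rw [mul_add, mul_div_cancel₀ _ hs₀.ne'] at h₁
    linarith
  have hN₀ : (0 : ℝ) < N := by
    have : 0 < s * N := by linarith
    exact pos_of_mul_pos_right this hs₀.le
  have hqc : q * c = 3 / 20 * (η / R) * r := by rw [hc]; field_simp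
  have hqc' : q * c ≤ 3 / 20 * r := by
    rw [hqc]
    have : η / R ≤ 1 := (div_le_one hR₀).2 hηR
    nlinarith
  have hRb : R / r * (q * b) ≤ η / 50000 := by
    have h₁ : R / r * (q * b) = ρ * (η / R) * (r / R) / q ^ 4 * (η / 50000) := by
      rw [hb]; field_simp
    rw [h₁]
    refine mul_le_of_le_one_left (by positivity) ?_
    rw [div_le_one (by positivity)]
    calc ρ * (η / R) * (r / R) ≤ 1 * 1 * 1 := by
          gcongr
          · exact (div_le_one hR₀).2 hηR
          · exact (div_le_one hR₀).2 hrR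
      _ ≤ q ^ 4 := by rw [one_mul, one_mul]; exact one_le_pow₀ hq
  have hqb : q * b ≤ r / 50000 := by
    have h₁ : q * b = r / R * (R / r * (q * b)) := by field_simp
    rw [h₁]
    calc r / R * (R / r * (q * b)) ≤ r / R * (R / 50000) := by
          refine mul_le_mul_of_nonneg_left (hRb.trans ?_) (by positivity)
          linarith
      _ = r / 50000 := by field_simp
  refine ⟨s, M, N, hs₀, ?_, by exact_mod_cast hN₀, ?_, ?_, ?_, ?_, ?_⟩
  · have : (16 : ℝ) ≤ M := by linarith
    exact_mod_cast this
  · have h₁ : s * ((N : ℝ) / 2 + M) ≤ c + 3 / 2 * b := by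
      rw [mul_add, hsM]; linarith
    have h₂ := mul_le_mul_of_nonneg_left h₁ hq₀.le
    nlinarith
  · have h₁ : S * s * (2 * R / r) = 10 * R ^ 2 * q / (η * r) / M := by
      rw [hS, hs, hb]; field_simp; norm_num
    rw [h₁, div_le_iff₀ hM₀]
    have h₂ : 10 * R ^ 2 * q / (η * r) = 40 * R ^ 2 * q / (η * r) / 4 := by ring
    linarith
  · have h₁ : (M : ℝ) / N ≤ b / (2 * c) := by
      rw [div_le_div_iff₀ hN₀ (by positivity)]
      calc (M : ℝ) * (2 * c) ≤ M * (s * N) := mul_le_mul_of_nonneg_left hN₁ hM₀.le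
        _ = b * N := by rw [← hsM]; ring
    have h₂ : 16 * Real.pi * S / (17 / 125) *
        (2 * (2 * R / r * (q * (s * M))) * (q ^ 2 * M) / N) =
        16 * Real.pi * S / (17 / 125) * (4 * R / r * q ^ 3 * b) * (M / N) := by
      rw [hsM]; ring
    have h₃ : 16 * Real.pi * S / (17 / 125) * (4 * R / r * q ^ 3 * b) * (b / (2 * c)) =
        8 / 51 * Real.pi * ρ := by
      rw [hS, hb, hc]; field_simp; norm_num
    rw [h₂]
    refine (mul_le_mul_of_nonneg_left h₁ (by positivity)).trans ?_
    rw [h₃]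
    have := Real.pi_lt_d2
    nlinarith
  · have h₁ : q * (2 / (M * (S * s))) = 2 / 5 * (η / R) := by
      rw [hS, hs, hb]; field_simp; norm_num
    exact h₁.le
  · have h₁ : 2 * (2 * R / r) * (q * (s * (N / 2))) = R / r * q * 2 * (s * N) := by ring
    rw [h₁]
    refine (mul_le_mul_of_nonneg_left hN₂ (by positivity)).trans ?_
    have h₂ : R / r * q * 2 * (2 * c + b) = 4 * (R / r * (q * c)) + 2 * (R / r * (q * b)) := by ring
    have h₃ : R / r * (q * c) = 3 / 20 * η := by rw [hqc]; field_simp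
    rw [h₂, h₃]
    linarith

/-- The analysis needs only the factor `n⁻³`; the constant survives because `58 ^ 4 * 7.5 >
80000000` and `√58 > 7.5`. -/
theorem precision_factor_le {n : ℕ} (hn : 1 ≤ n) :
    (58 * (n : ℝ)) ^ (-(9 / 2) : ℝ) ≤ 1 / (80000000 * √(n : ℝ) ^ 6) := by
  have hn' : (1 : ℝ) ≤ n := by exact_mod_cast hn
  have h₀ : (0 : ℝ) < 58 * n := by positivity
  have h₁ : (58 * (n : ℝ)) ^ (9 / 2 : ℝ) = (58 * (n : ℝ)) ^ 4 * √(58 * (n : ℝ)) := by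
    rw [Real.sqrt_eq_rpow, ← Real.rpow_natCast, ← Real.rpow_add h₀]
    norm_num
  have h₂ : (7.5 : ℝ) ≤ √(58 * (n : ℝ)) := by
    refine Real.le_sqrt_of_sq_le ?_
    norm_num
    linarith
  have h₃ : √(n : ℝ) ^ 6 = (n : ℝ) ^ 3 := by
    rw [show 6 = 2 * 3 from rfl, pow_mul, Real.sq_sqrt (by positivity)]
  rw [Real.rpow_neg h₀.le, h₁, h₃, one_div]
  refine inv_anti₀ (by positivity) ?_
  calc 80000000 * (n : ℝ) ^ 3 ≤ 58 ^ 4 * 7.5 * (n : ℝ) ^ 3 := by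
        refine mul_le_mul_of_nonneg_right (by norm_num) (by positivity)
    _ ≤ 58 ^ 4 * 7.5 * (n : ℝ) ^ 4 :=
        mul_le_mul_of_nonneg_left (pow_le_pow_right₀ hn' (by norm_num)) (by norm_num)
    _ = (58 * (n : ℝ)) ^ 4 * 7.5 := by ring
    _ ≤ (58 * (n : ℝ)) ^ 4 * √(58 * (n : ℝ)) := mul_le_mul_of_nonneg_left h₂ (by positivity)

theorem exists_repetition_count {n : ℕ} {ρ : ℝ} (hn : 1 ≤ n) (hρ : 0 < ρ) (hρ₁ : ρ ≤ 1 / 3) :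
    ∃ k : ℕ, n * (19 / 20 : ℝ) ^ k ≤ ρ / 2 ∧ (k : ℝ) ≤ 35 * Real.log (n / ρ) := by
  have hn' : (1 : ℝ) ≤ n := by exact_mod_cast hn
  have h3 : 3 ≤ (n : ℝ) / ρ := by
    rw [le_div_iff₀ hρ]; linarith
  have hpos : 0 < (n : ℝ) / ρ := by linarith
  have hlog1 : 1 ≤ Real.log (n / ρ) := by
    rw [Real.le_log_iff_exp_le hpos]
    exact (Real.exp_one_lt_d9.le.trans (by norm_num)).trans h3
  have hlog2 : Real.log (2 * (n / ρ)) ≤ 0.7 + Real.log (n / ρ) := by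
    rw [Real.log_mul two_ne_zero hpos.ne']
    have := Real.log_two_lt_d9
    linarith
  -- Chosen because `19/20 ≤ exp(-1/20)`.
  refine ⟨⌈20 * Real.log (2 * (n / ρ))⌉₊, ?_, ?_⟩
  · have h₁ := Nat.le_ceil (20 * Real.log (2 * (n / ρ)))
    set k := ⌈20 * Real.log (2 * (n / ρ))⌉₊
    have h₂ : (19 / 20 : ℝ) ^ k ≤ Real.exp (-(k / 20 : ℝ)) := by
      have h₃ : (19 / 20 : ℝ) ≤ Real.exp (-(1 / 20)) := by
        have := Real.add_one_le_exp (-(1 / 20) : ℝ)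
        linarith
      calc (19 / 20 : ℝ) ^ k ≤ Real.exp (-(1 / 20)) ^ k :=
            pow_le_pow_left₀ (by norm_num) h₃ k
        _ = Real.exp (-(k / 20 : ℝ)) := by
            rw [← Real.exp_nat_mul]; congr 1; ring
    have h₄ : Real.exp (-(k / 20 : ℝ)) ≤ (2 * (n / ρ))⁻¹ := by
      rw [← Real.exp_log (show 0 < 2 * ((n : ℝ) / ρ) by positivity), ← Real.exp_neg,
        Real.exp_le_exp]
      linarith
    calc n * (19 / 20 : ℝ) ^ k ≤ n * (2 * (n / ρ))⁻¹ :=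
          mul_le_mul_of_nonneg_left (h₂.trans h₄) (by positivity)
      _ = ρ / 2 := by field_simp
  · have h₁ := (Nat.ceil_lt_add_one (show 0 ≤ 20 * Real.log (2 * (n / ρ)) from
      mul_nonneg (by norm_num) (Real.log_nonneg (by linarith)))).le
    linarith

theorem exists_bisection_depth {n : ℕ} {r R η ρ δ : ℝ} (hn : 1 ≤ n) (hr₀ : 0 < r) (hrR : r ≤ R)
    (hη : 0 < η) (hηR : η ≤ R) (hρ : 0 < ρ) (hρ₁ : ρ ≤ 1 / 3)
    (hδ : δ = ρ * η ^ 3 * r ^ 2 / (12500000 * R ^ 4 * √(n : ℝ) ^ 6)) :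
    ∃ T : ℕ, 2 * R / 2 ^ T ≤ δ / 2 ∧
      (T : ℝ) ≤ 45 * Real.log (n / ρ * (R / η) * (R / r)) := by
  have hR₀ : 0 < R := hr₀.trans_le hrR
  have hn' : (1 : ℝ) ≤ n := by exact_mod_cast hn
  have hsq : √(n : ℝ) ^ 6 = (n : ℝ) ^ 3 := by
    rw [show 6 = 2 * 3 from rfl, pow_mul, Real.sq_sqrt (by positivity)]
  have hδ₀ : 0 < δ := by rw [hδ, hsq]; positivity
  set Q := n / ρ * (R / η) * (R / r) with hQ
  have hη1 : 1 ≤ R / η := (one_le_div hη).2 hηR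
  have hr1 : 1 ≤ R / r := (one_le_div hr₀).2 hrR
  have h3 : 3 ≤ (n : ℝ) / ρ := by
    rw [le_div_iff₀ hρ]; linarith
  have hQ3 : 3 ≤ Q := by
    calc (3 : ℝ) = 3 * 1 * 1 := by norm_num
      _ ≤ Q := by rw [hQ]; gcongr
  have hQ₀ : 0 < Q := by linarith
  have hlog1 : 1 ≤ Real.log Q := by
    rw [Real.le_log_iff_exp_le hQ₀]
    exact (Real.exp_one_lt_d9.le.trans (by norm_num)).trans hQ3
  have hratio : 4 * R / δ ≤ 50000000 * Q ^ 3 := by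
    have h₁ : 4 * R / δ = 50000000 * Q ^ 3 * (ρ ^ 2 * (r / R)) := by
      rw [hδ, hsq, hQ]; field_simp; norm_num
    rw [h₁]
    refine mul_le_of_le_one_right (by positivity) ?_
    have h₂ : r / R ≤ 1 := (div_le_one hR₀).2 hrR
    have h₃ : ρ ^ 2 ≤ 1 := pow_le_one₀ hρ.le (by linarith)
    have h₄ : 0 ≤ r / R := by positivity
    nlinarith
  -- The factor `2` suffices since `log 2 > 1/2`, and `50000000 ≤ 2 ^ 26` absorbs the constant into
  -- the logarithm.
  refine ⟨⌈2 * Real.log (50000000 * Q ^ 3)⌉₊, ?_, ?_⟩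
  · have h₁ := Nat.le_ceil (2 * Real.log (50000000 * Q ^ 3))
    set T := ⌈2 * Real.log (50000000 * Q ^ 3)⌉₊
    have h₂ : 50000000 * Q ^ 3 ≤ (2 : ℝ) ^ T := by
      rw [← Real.log_le_log_iff (by positivity) (by positivity), Real.log_pow]
      have := Real.log_two_gt_d9
      have h₃ : (0 : ℝ) ≤ T := Nat.cast_nonneg _
      nlinarith
    rw [div_le_div_iff₀ (by positivity) two_pos]
    have h₃ := hratio.trans h₂
    rw [div_le_iff₀ hδ₀] at h₃
    linarith
  · have h₁ : Real.log (50000000 * Q ^ 3) ≤ 26 * Real.log 2 + 3 * Real.log Q := by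
      rw [Real.log_mul (by norm_num) (by positivity), Real.log_pow]
      have : Real.log 50000000 ≤ Real.log (2 ^ 26) :=
        Real.log_le_log (by norm_num) (by norm_num)
      rw [Real.log_pow] at this
      push_cast at this ⊢
      linarith
    have h₂ : 0 ≤ Real.log (50000000 * Q ^ 3) := by
      refine Real.log_nonneg ?_
      have := one_le_pow₀ (n := 3) (show 1 ≤ Q by linarith)
      linarith
    have h₃ := (Nat.ceil_lt_add_one (show 0 ≤ 2 * Real.log (50000000 * Q ^ 3) by linarith)).le
    have := Real.log_two_lt_d9
    linarith

theorem one_le_log_div {n : ℕ} {ρ : ℝ} (hn : 1 ≤ n) (hρ : 0 < ρ) (hρ₁ : ρ ≤ 1 / 3) :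
    1 ≤ Real.log (n / ρ) := by
  have hn' : (1 : ℝ) ≤ n := by exact_mod_cast hn
  have h3 : 3 ≤ (n : ℝ) / ρ := by
    rw [le_div_iff₀ hρ]; linarith
  rw [Real.le_log_iff_exp_le (by linarith)]
  exact (Real.exp_one_lt_d9.le.trans (by norm_num)).trans h3

end Parameters

theorem exists_separation_parameters {n : ℕ} {r R η ρ ε ε₀ : ℝ} (hn : 1 ≤ n) (hr₀ : 0 < r)
    (hrR : r ≤ R) (hη : 0 < η) (hηR : η ≤ R) (hρ : 0 < ρ) (hρ₁ : ρ ≤ 1 / 3)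
    (hε₀' : ε₀ = η * (58 * (n : ℝ)) ^ (-(9 / 2) : ℝ) * (r / R) ^ 3 * (η / R) ^ 2 * ρ)
    (hε₀ : ε ≤ ε₀) {F : FixedPointFormat} (hF : √(n : ℝ) * F.step ≤ ε₀ / 100) :
    ∃ (s δ S : ℝ) (M N T k : ℕ), 16 ≤ M ∧ 0 < N ∧ 0 < s ∧ 0 < S ∧
      √(n : ℝ) * (s * (N / 2 + M)) ≤ r / 3 ∧
      2 * R / r * (ε + √(n : ℝ) * F.step) + 2 * R / 2 ^ T ≤ δ ∧
      4 * (2 * Real.pi * S * δ) ^ 2 ≤ 17 / 250 ∧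
      S * s * (2 * R / r) ≤ 1 / 4 ∧
      16 * Real.pi * S / (17 / 125) *
        (2 * (2 * R / r * (√(n : ℝ) * (s * M))) * (n * M) / N) ≤ ρ / 2 ∧
      n * (19 / 20 : ℝ) ^ k ≤ ρ / 2 ∧
      √(n : ℝ) * (2 / (M * (S * s))) ≤ 2 / 5 * (η / R) ∧
      ε + √(n : ℝ) * F.step ≤ r ∧ ε + √(n : ℝ) * F.step ≤ η ∧
      2 * R / r * (ε + √(n : ℝ) * F.step) +
        2 * (2 * R / r) * (√(n : ℝ) * (s * (N / 2))) ≤ 7 / 10 * η ∧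
      (k : ℝ) ≤ 35 * Real.log (n / ρ) ∧
      (T : ℝ) ≤ 45 * Real.log (n / ρ * (R / η) * (R / r)) := by
  have hR₀ : 0 < R := hr₀.trans_le hrR
  have hn' : (1 : ℝ) ≤ n := by exact_mod_cast hn
  obtain ⟨q, hqn⟩ : ∃ q, q = √(n : ℝ) := ⟨_, rfl⟩
  have hq : 1 ≤ q := by rw [hqn]; exact Real.one_le_sqrt.2 hn'
  have hq₀ : 0 < q := one_pos.trans_le hq
  have hqsq : (n : ℝ) = q ^ 2 := by rw [hqn, Real.sq_sqrt (by positivity)]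
  obtain ⟨S, hS⟩ : ∃ S, S = 250000 * R ^ 4 * q ^ 6 / (ρ * η ^ 3 * r ^ 2) := ⟨_, rfl⟩
  obtain ⟨δ, hδ⟩ : ∃ δ, δ = ρ * η ^ 3 * r ^ 2 / (12500000 * R ^ 4 * √(n : ℝ) ^ 6) := ⟨_, rfl⟩
  obtain ⟨s, M, N, hs, hM, hN, hdom, hwrap, hgap, hacc, hoff⟩ :=
    exists_grid_parameters hq hr₀ hrR hη hηR hρ (by linarith) hS
  obtain ⟨k, hk, hkl⟩ := exists_repetition_count hn hρ hρ₁
  obtain ⟨T, hT, hTl⟩ := exists_bisection_depth hn hr₀ hrR hη hηR hρ hρ₁ hδ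
  -- The phase error from evaluation is then `2π/50`, small enough for its share `17/250` of the
  -- failure probability. Half of `δ` is for bisection, half for the oracle's error and rounding.
  have hSδ : S * δ = 1 / 50 := by
    rw [hS, hδ, ← hqn]; field_simp; norm_num
  have hS₀ : 0 < S := by rw [hS]; positivity
  have hprec : ε₀ ≤ η * (1 / (80000000 * q ^ 6)) * (r / R) ^ 3 * (η / R) ^ 2 * ρ := by
    have := precision_factor_le hn
    rw [← hqn] at this
    rw [hε₀']
    gcongr
  rw [← hqn] at hF ⊢
  have hε₁ : ε + q * F.step ≤ 101 / 100 * ε₀ := by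
    linarith
  have hslope : 2 * R / r * (ε + q * F.step) ≤ δ / 2 := by
    calc 2 * R / r * (ε + q * F.step) ≤ 2 * R / r * (101 / 100 *
          (η * (1 / (80000000 * q ^ 6)) * (r / R) ^ 3 * (η / R) ^ 2 * ρ)) :=
        mul_le_mul_of_nonneg_left (by linarith) (by positivity)
      _ = 101 / 160 * (δ / 2) := by rw [hδ, ← hqn]; field_simp; norm_num
      _ ≤ δ / 2 := by
        have : 0 < δ := by rw [hδ, ← hqn]; positivity
        linarith
  have hratio : ε + q * F.step ≤ r * (η / R) / 100 := by
    have h₁ : (r / R) ^ 2 ≤ 1 := pow_le_one₀ (by positivity) ((div_le_one hR₀).2 hrR)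
    have h₂ : (η / R) ^ 2 ≤ 1 := pow_le_one₀ (by positivity) ((div_le_one hR₀).2 hηR)
    have h₃ : 1 / (80000000 * q ^ 6) ≤ 1 / 1000 :=
      one_div_le_one_div_of_le (by norm_num) (by
        have := one_le_pow₀ (n := 6) hq
        linarith)
    have h₄ : ε₀ ≤ r * (η / R) * (1 / 1000) * 1 * 1 * 1 := by
      calc ε₀ ≤ η * (1 / (80000000 * q ^ 6)) * (r / R) ^ 3 * (η / R) ^ 2 * ρ := hprec
        _ = r * (η / R) * (1 / (80000000 * q ^ 6)) * (r / R) ^ 2 * (η / R) ^ 2 * ρ := by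
          field_simp
        _ ≤ _ := by gcongr; linarith
    have : 0 < r * (η / R) := by positivity
    linarith
  have hηR' : η / R ≤ 1 := (div_le_one hR₀).2 hηR
  refine ⟨s, δ, S, M, N, T, k, hM, hN, hs, hS₀, hdom, by linarith, ?_, hwrap,
    by rw [hqsq]; exact hgap, hk, hacc, ?_, ?_, ?_, hkl, hTl⟩
  · rw [show 2 * Real.pi * S * δ = 2 * Real.pi * (S * δ) by ring, hSδ]
    have h₁ := Real.pi_lt_d2
    have h₂ := pow_le_pow_left₀ (by positivity)
      (show 2 * Real.pi * (1 / 50) ≤ 63 / 500 by linarith) 2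
    linarith
  · have h₁ : r * (η / R) ≤ r := mul_le_of_le_one_right hr₀.le hηR'
    linarith
  · have : r * (η / R) ≤ η := by
      rw [mul_div_assoc', div_le_iff₀ hR₀, mul_comm]
      exact mul_le_mul_of_nonneg_left hrR hη.le
    have : 0 < r * (η / R) := by positivity
    linarith
  · have : 2 * R / r * (ε + q * F.step) ≤ 2 * R / r * (r * (η / R) / 100) :=
      mul_le_mul_of_nonneg_left hratio (by positivity)
    have h₂ : 2 * R / r * (r * (η / R) / 100) = η / 50 := by field_simp; norm_num
    linarith

theorem FixedPointFormat.Resolves.sqrt_mul_step_le {F : FixedPointFormat} {n : ℕ} {r R e : ℝ}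
    (h : F.Resolves 100 n r R e) (hn : 1 ≤ n) (hr₀ : 0 < r) (hrR : r ≤ R) (he : 0 ≤ e) :
    √(n : ℝ) * F.step ≤ e / 100 := by
  have hR₀ : 0 < R := hr₀.trans_le hrR
  have hn' : (1 : ℝ) ≤ n := by exact_mod_cast hn
  obtain ⟨q, hqn⟩ : ∃ q, q = √(n : ℝ) := ⟨_, rfl⟩
  have hq : 1 ≤ q := by rw [hqn]; exact Real.one_le_sqrt.2 hn'
  have hq₀ : 0 < q := one_pos.trans_le hq
  have hqsq : (n : ℝ) = q ^ 2 := by rw [hqn, Real.sq_sqrt (by positivity)]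
  rw [← hqn]
  calc q * F.step ≤ q * (r * e / (100 * n * R)) := mul_le_mul_of_nonneg_left h.2 hq₀.le
    _ = e / 100 * ((r / R) * (1 / q)) := by rw [hqsq]; field_simp
    _ ≤ e / 100 := by
      refine mul_le_of_le_one_right (by positivity) ?_
      exact mul_le_one₀ ((div_le_one hR₀).2 hrR) (by positivity) ((div_le_one hq₀).2 hq)

/-- Separation from membership with few quantum queries. The algorithm for `SEP_{η,ρ}` acts on the
query and answer registers of the separation oracle, on an ancilla `A`, and on the registers of the
membership oracle. It depends on the parameters, the formats and the dimension of the workspace `W`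
of the membership oracle, but not on `K` or on the membership oracle. -/
theorem mainTheorem1 :
    ∃ C D : ℝ, 0 < C ∧ 0 < D ∧
      ∀ (n : ℕ) (r R η ρ ε : ℝ), 1 ≤ n → 0 < r → r ≤ R → 0 < η → η ≤ R → 0 < ρ → ρ ≤ 1 / 3 →
      0 ≤ ε →
      ε ≤ η * (58 * (n : ℝ)) ^ (-(9 / 2) : ℝ) * (r / R) ^ 3 * (η / R) ^ 2 * ρ →
      ∀ F G : FixedPointFormat,
      F.Resolves D n r R (η * (58 * (n : ℝ)) ^ (-(9 / 2) : ℝ) * (r / R) ^ 3 * (η / R) ^ 2 * ρ) →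
      G.Resolves D n r R η →
      ∀ (W : Type) [Fintype W] [DecidableEq W] (w₀ : W),
      ∃ (A : Type) (_ : Fintype A) (_ : DecidableEq A) (a₀ : A)
        (𝒜 : QueryAlgorithm
          (G.Vec n × (Bool × G.Vec n) × A × (F.Vec n × Bool × W))),
        (𝒜.queries : ℝ) ≤
          C * Real.log (n / ρ) * Real.log (n / ρ * (R / η) * (R / r)) ∧
        ∀ K : Set (EuclideanSpace ℝ (Fin n)), Convex ℝ K →
          Metric.closedBall 0 r ⊆ K → K ⊆ Metric.closedBall 0 R →
          ∀ U : Matrix.unitaryGroup (F.Vec n × Bool × W) ℂ, IsMEM F w₀ K ε 0 U →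
            IsSEP G (a₀, (F.zeroBits n, false, w₀)) K η ρ
              (𝒜.run (onSecond (G.Vec n) (onSecond (Bool × G.Vec n) (onSecond A U)))) := by
  -- The count is at most `1 + 2 * 35 * 45 * l₁ * l₂`, and `1 + 3150 < 4000` suffices because both
  -- logarithms are at least `1`.
  refine ⟨4000, 100, by norm_num, by norm_num, ?_⟩
  intro n r R η ρ ε hn hr₀ hrR hη hηR hρ hρ₁ hε hε₀ F G hF hG W _ _ w₀
  have hR₀ : 0 < R := hr₀.trans_le hrR
  have hn' : (1 : ℝ) ≤ n := by exact_mod_cast hn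
  obtain ⟨s, δ, S, M, N, T, k, hM, hN, hs, hS, hdom, hδ, hphase, hwrap, hgap, hk, hacc, hεr, hεη,
      hoff, hkl, hTl⟩ :=
    exists_separation_parameters hn hr₀ hrR hη hηR hρ hρ₁ rfl hε₀
      (hF.sqrt_mul_step_le hn hr₀ hrR (hε.trans hε₀))
  obtain ⟨A, iA, iA', a₀, 𝒜, hcount, h𝒜⟩ :=
    exists_separation_algorithm (n := n) F G w₀ hr₀ hrR hη hηR hε hρ.le hF.1 hG.1
      (hG.sqrt_mul_step_le hn hr₀ hrR hη.le) hM hN hs hS hdom hδ hphase hwrap hgap hk hacc hεr hεη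
      hoff
  refine ⟨A, iA, iA', a₀, 𝒜, ?_, h𝒜⟩
  have hl₁ := one_le_log_div hn hρ hρ₁
  set l₁ := Real.log (n / ρ)
  have hl₂ : 1 ≤ Real.log (n / ρ * (R / η) * (R / r)) := by
    refine hl₁.trans (Real.log_le_log (by positivity) ?_)
    rw [mul_assoc]
    exact le_mul_of_one_le_right (by positivity)
      (one_le_mul_of_one_le_of_one_le ((one_le_div hη).2 hηR) ((one_le_div hr₀).2 hrR))
  set l₂ := Real.log (n / ρ * (R / η) * (R / r))
  have hcount' : (𝒜.queries : ℝ) ≤ 1 + k * (2 * T) := by exact_mod_cast hcount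
  have h₁ : (k : ℝ) * T ≤ 35 * l₁ * (45 * l₂) :=
    mul_le_mul hkl hTl (Nat.cast_nonneg _) (by linarith)
  have h₂ : 1 ≤ l₁ * l₂ := one_le_mul_of_one_le_of_one_le hl₁ hl₂
  linarith
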